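/- Let $\alpha>0$ be real, let $N\ge 0$ be an integer and let $\kappa$ be a partition of length at most $N$. Write $m_\kappa$ for the monomial symmetric polynomial in $N$ variables, and let $P_\kappa^{(\alpha)}(z)=P_\kappa^{(\alpha)}(z_1,\dots,z_N)$ be the symmetric Jack polynomial, that is, the unique symmetric polynomial (with real coefficients) of the form $$P_\kappa^{(\alpha)}=m_\kappa+\sum_{\mu<\kappa}u_{\kappa\mu}m_\mu$$ (sum over partitions $\mu$ of the same modulus that are strictly smaller than $\kappa$ in the dominance order) which is an eigenfunction of $$D_2(\alpha)=\sum_{j=1}^N z_j^2\frac{\partial^2}{\partial z_j^2}+\frac{2}{\alpha}\sum_{\substack{j,k=1\\ j\ne k}}^N\frac{z_j^2}{z_j-z_k}\frac{\partial}{\partial z_j};$$ existence and uniqueness of this polynomial are part of the statement. Let $x=(x_1,\dots,x_N)$, $y=(y_1,\dots,y_N)$ and $$\Pi^{(\alpha)}(x,y):=\prod_{j,k=1}^N(1-x_jy_k)^{-1/\alpha},$$ understood as a formal power series in $x,y$. Then there are nonzero real constants $v_\kappa^{(\alpha)}$, depending only on $\alpha>0$ and on the partition $\kappa$ and not on $N$,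 such that the following holds for all real $\alpha>0$ and all $N$. (1) As formal power series, $$\Pi^{(\alpha/(\alpha+1))}(x,y)=\prod_{j,k=1}^N(1-x_jy_k)^{-(\alpha+1)/\alpha}=\sum_{\kappa}\frac{1}{v_\kappa^{(\alpha/(\alpha+1))}}\,P_\kappa^{(\alpha/(\alpha+1))}(x)\,P_\kappa^{(\alpha/(\alpha+1))}(y),$$ where the sum is over all partitions $\kappa$ of length at most $N$. (2) There is a unique family of symmetric polynomials $g_\kappa$, indexed by the partitions $\kappa$ of length at most $N$, with $$\Pi^{(\alpha)}(x,y)=\sum_\kappa g_\kappa(x)\,m_\kappa(y),$$ there is a unique bilinear form $\langle\cdot,\cdot\rangle_g$ on the real vector space of symmetric polynomials in $N$ variables with $\langle g_\mu,m_\kappa\rangle_g=\delta_{\mu,\kappa}$ for all $\mu,\kappa$ of length at most $N$, and $$\langle P_\kappa^{(\alpha)},P_\mu^{(\alpha)}\rangle_g=v_\kappa^{(\alpha)}\,\delta_{\mu,\kappa}$$ for all partitions $\kappa,\mu$ of length at most $N$. -/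

import Mathlib

noncomputable section

namespace SymJack

/-- The real algebra of symmetric polynomials in the variables `z_1, …, z_N`. -/
abbrev SymPoly (N : ℕ) : Type := MvPolynomial.symmetricSubalgebra (Fin N) ℝ

/-- Integer partitions, of all moduli. -/
abbrev Part : Type := Σ n : ℕ, n.Partition

/-- Partitions of length (number of non-zero parts) at most `N`. -/
abbrev PartLE (N : ℕ) : Type := {κ : Part // Multiset.card κ.2.parts ≤ N}

/-- The partial sum `κ_1 + ⋯ + κ_p`, where `κ_1 ≥ κ_2 ≥ ⋯` are the parts of `κ`. -/
def partialSum {n : ℕ} (κ : n.Partition) (p : ℕ) : ℕ :=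
  ((κ.parts.sort (· ≥ ·)).take p).sum

/-- The strict dominance order `μ < κ` on partitions of the same modulus. -/
def DomLT {n : ℕ} (μ κ : n.Partition) : Prop :=
  μ ≠ κ ∧ ∀ p : ℕ, partialSum μ p ≤ partialSum κ p

/-- The monomial symmetric polynomial `m_κ` in `N` variables. -/
def msym (N : ℕ) {n : ℕ} (κ : n.Partition) : SymPoly N :=
  ⟨MvPolynomial.msymm (Fin N) ℝ κ, MvPolynomial.msymm_isSymmetric (Fin N) ℝ κ⟩

/-- The operator
`D_2(α) = ∑_j z_j² ∂²/∂z_j² + (2/α) ∑_{j ≠ k} z_j² / (z_j - z_k) ∂/∂z_j`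
on polynomials, with values in the field of rational functions in `z_1, …, z_N`. -/
def D2 (N : ℕ) (α : ℝ) (P : MvPolynomial (Fin N) ℝ) :
    FractionRing (MvPolynomial (Fin N) ℝ) :=
  let toFrac := algebraMap (MvPolynomial (Fin N) ℝ) (FractionRing (MvPolynomial (Fin N) ℝ))
  (∑ j : Fin N, toFrac (MvPolynomial.X j ^ 2 *
      MvPolynomial.pderiv j (MvPolynomial.pderiv j P))) +
    (2 / α) • ∑ j : Fin N, ∑ k ∈ Finset.univ.erase j,
      toFrac (MvPolynomial.X j ^ 2) / toFrac (MvPolynomial.X j - MvPolynomial.X k) *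
        toFrac (MvPolynomial.pderiv j P)

/-- `P` is a symmetric polynomial eigenfunction of `D_2(α)` of the form
`m_κ + ∑_{μ < κ} u_{κμ} m_μ`. -/
def IsSymmetricJack (N : ℕ) (α : ℝ) {n : ℕ} (κ : n.Partition) (P : SymPoly N) : Prop :=
  (∃ e : ℝ, D2 N α P =
      algebraMap (MvPolynomial (Fin N) ℝ) (FractionRing (MvPolynomial (Fin N) ℝ))
        (e • (P : MvPolynomial (Fin N) ℝ))) ∧
  ∃ u : n.Partition → ℝ,
    (∀ μ, u μ ≠ 0 → DomLT μ κ) ∧ P = msym N κ + ∑ μ : n.Partition, u μ • msym N μ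

/-- The symmetric Jack polynomial `P_κ^{(α)}(z_1, …, z_N)`: the polynomial that satisfies
`IsSymmetricJack` (there is exactly one if `α > 0` and `κ` has length at most `N`). -/
def jackP (N : ℕ) (α : ℝ) {n : ℕ} (κ : n.Partition) : SymPoly N :=
  Classical.epsilon (IsSymmetricJack N α κ)

/-- Formal power series in the two sets of variables `x_1, …, x_N` (left summand) and
`y_1, …, y_N` (right summand). -/
abbrev Series (N : ℕ) : Type := MvPowerSeries (Fin N ⊕ Fin N) ℝ

/-- `f(x)` as a formal power series. -/
def inX {N : ℕ} (f : SymPoly N) : Series N :=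
  ((MvPolynomial.rename Sum.inl (f : MvPolynomial (Fin N) ℝ) :
    MvPolynomial (Fin N ⊕ Fin N) ℝ) : Series N)

/-- `f(y)` as a formal power series. -/
def inY {N : ℕ} (f : SymPoly N) : Series N :=
  ((MvPolynomial.rename Sum.inr (f : MvPolynomial (Fin N) ℝ) :
    MvPolynomial (Fin N ⊕ Fin N) ℝ) : Series N)

/-- The kernel `Π^{(α)}(x,y) = ∏_{j,k} (1 - x_j y_k)^{-1/α}` as a formal power series, each
factor being the binomial series of `(1 + t)^{-1/α}` at `t = - x_j y_k`. -/
def kernel (N : ℕ) (α : ℝ) : Series N :=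
  ∏ j : Fin N, ∏ k : Fin N,
    (PowerSeries.binomialSeries ℝ (-(1 / α))).subst
      (-(MvPowerSeries.X (Sum.inl j) * MvPowerSeries.X (Sum.inr k)) : Series N)

/-- `F = ∑_i f_i` as formal power series: the sum converges to `F` in each coefficient. -/
def HasFormalSum {ι : Type} {N : ℕ} (f : ι → Series N) (F : Series N) : Prop :=
  ∀ d : (Fin N ⊕ Fin N) →₀ ℕ,
    HasSum (fun i => MvPowerSeries.coeff d (f i)) (MvPowerSeries.coeff d F)

/-- The defining property of the polynomials `g_κ`, `κ` of length at most `N`: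
`Π^{(α)}(x,y) = ∑_κ g_κ(x) m_κ(y)`. -/
def IsGFamily (N : ℕ) (α : ℝ) (g : PartLE N → SymPoly N) : Prop :=
  HasFormalSum (fun κ : PartLE N => inX (g κ) * inY (msym N κ.1.2)) (kernel N α)

/-- The defining property of the bilinear form `⟨·,·⟩_g` on symmetric polynomials:
`⟨g_μ, m_κ⟩_g = δ_{μκ}`. -/
def IsGForm {N : ℕ} (g : PartLE N → SymPoly N) (B : SymPoly N →ₗ[ℝ] SymPoly N →ₗ[ℝ] ℝ) : Prop :=
  ∀ μ κ : PartLE N, B (g μ) (msym N κ.1.2) = if μ = κ then 1 else 0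

end SymJack

end
open SymJack

/-! Put `a = 1/α`. The Heckman–Dunkl operators `D_i = x_i ∂_i + a ∑_{k≠i} x_i (1 - s_{ik})/(x_i -
x_k)` turn the kernel `Π` into a scalar product for which the operators behind the Jack polynomials
are self-adjoint.

Intertwining. With `c_{ij} = x_i y_j/(1 - x_i y_j)` one has `D_i Π = a ∑_j c_{ij} Π`, and `D_i
(c_{ij} Π)` is symmetric under exchanging `(x, i)` with `(y, j)`. As operators in `x` commute with
operators in `y`, the power sums `L_m = ∑_i D_i^m` in `x` and in `y` agree on `Π`
(`sum_ext_dunkl_pow_cauchy`).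

Positivity. The Euler recursion `n Π_n = a ∑_k p_k(x) p_k(y) Π_{n-k}` writes each component of `Π`
as `∑_t w_t q_t(x) q_t(y)` with `w_t > 0` and with `q_t` spanning the symmetric polynomials of
degree `n` (`nonempty_squareDecomp`). Hence the `g_κ` form a basis, the form exists uniquely, and it
is symmetric and positive definite (`gForm_pos`); the intertwining makes every `L_m` self-adjoint
(`gForm_powerSym`).

Triangularity. `L_m m_κ = eig m_κ +` terms strictly below `κ`. The generating function of the
eigenvalues is a rational function from which `κ` can be read off (`eq_of_eig_eq`), and the
eigenvalue of `L_2` strictly increases in dominance order (`eig_two_lt`). On symmetric polynomials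
`D_2(α)` is `L_2` plus a multiple of the Euler operator (`D2_eq`).

Consequences. Projecting `m_κ` orthogonally away from the span of the lower `m_μ` gives a joint
eigenfunction of all `L_m`; monotonicity of the second eigenvalue gives uniqueness, so this is the
Jack polynomial. Separation of eigenvalues gives orthogonality, and expanding `g_μ` in the
orthogonal basis gives the expansion of `Π` with `v_κ` the squared norm. Setting the last variable
to zero respects the Jack polynomials and the `g_κ`, so the norm is independent of `N`
(`jackNorm_succ`). -/

noncomputable section

namespace SymJack

set_option linter.unusedSectionVars false

section

open MvPolynomial

/-! ### Heckman–Dunkl operators on polynomials -/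

section Operators

variable {τ : Type} [DecidableEq τ]

/-- The transposition of two variables. -/
def swapVar (i k : τ) : MvPolynomial τ ℝ →ₐ[ℝ] MvPolynomial τ ℝ := rename (Equiv.swap i k)

@[simp] theorem swapVar_X (i k j : τ) : swapVar i k (X j) = X (Equiv.swap i k j) := by
  simp [swapVar]

/-- Modulo `X i - X k` the two variables coincide, so the transposition induces the identity on the
quotient ring. -/
theorem sub_swapVar_dvd (i k : τ) (f : MvPolynomial τ ℝ) :
    (X i - X k : MvPolynomial τ ℝ) ∣ f - swapVar i k f := by
  rw [← Ideal.mem_span_singleton, ← Ideal.Quotient.mk_eq_mk_iff_sub_mem]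
  have h : (Ideal.Quotient.mkₐ ℝ (Ideal.span {(X i - X k : MvPolynomial τ ℝ)})) =
      (Ideal.Quotient.mkₐ ℝ (Ideal.span {(X i - X k : MvPolynomial τ ℝ)})).comp (swapVar i k) := by
    have hik : Ideal.Quotient.mk (Ideal.span {(X i - X k : MvPolynomial τ ℝ)}) (X i) =
        Ideal.Quotient.mk (Ideal.span {(X i - X k : MvPolynomial τ ℝ)}) (X k) := by
      rw [Ideal.Quotient.mk_eq_mk_iff_sub_mem]
      exact Ideal.mem_span_singleton_self _
    ext j
    simp only [AlgHom.comp_apply, swapVar_X, Ideal.Quotient.mkₐ_eq_mk]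
    rcases eq_or_ne j i with rfl | hi
    · simp [hik]
    rcases eq_or_ne j k with rfl | hk
    · simp [hik]
    rw [Equiv.swap_apply_of_ne_of_ne hi hk]
  exact DFunLike.congr_fun h f

theorem X_sub_X_ne_zero {i k : τ} (h : i ≠ k) : (X i - X k : MvPolynomial τ ℝ) ≠ 0 :=
  sub_ne_zero.2 fun e => h (X_injective e)

/-- The divided difference operator `f ↦ x_i (f - s_{ik} f) / (x_i - x_k)`, for `i ≠ k`. -/
def divDiff (i k : τ) (h : i ≠ k) : MvPolynomial τ ℝ →ₗ[ℝ] MvPolynomial τ ℝ where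
  -- The chosen quotient is unique because `X i - X k` is a non-zero element of a domain; linearity
  -- is checked by cancelling it.
  toFun f := X i * (sub_swapVar_dvd i k f).choose
  map_add' f g := by
    rw [← mul_add]
    congr 1
    apply mul_left_cancel₀ (X_sub_X_ne_zero h)
    rw [mul_add, ← (sub_swapVar_dvd i k _).choose_spec, ← (sub_swapVar_dvd i k _).choose_spec,
      ← (sub_swapVar_dvd i k _).choose_spec, map_add]
    ring
  map_smul' c f := by
    simp only [RingHom.id_apply, ← mul_smul_comm]
    congr 1
    apply mul_left_cancel₀ (X_sub_X_ne_zero h)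
    rw [mul_smul_comm, ← (sub_swapVar_dvd i k _).choose_spec,
      ← (sub_swapVar_dvd i k _).choose_spec, map_smul, smul_sub]

theorem X_sub_X_mul_divDiff {i k : τ} (h : i ≠ k) (f : MvPolynomial τ ℝ) :
    (X i - X k) * divDiff i k h f = X i * (f - swapVar i k f) := by
  change (X i - X k) * (X i * (sub_swapVar_dvd i k f).choose) = _
  rw [mul_left_comm, ← (sub_swapVar_dvd i k f).choose_spec]

theorem divDiff_eq {i k : τ} (h : i ≠ k) {f g : MvPolynomial τ ℝ}
    (hg : (X i - X k) * g = X i * (f - swapVar i k f)) : divDiff i k h f = g :=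
  mul_left_cancel₀ (X_sub_X_ne_zero h) ((X_sub_X_mul_divDiff h f).trans hg.symm)

/-- The operator `x_i ∂/∂x_i`. -/
def euler (i : τ) : MvPolynomial τ ℝ →ₗ[ℝ] MvPolynomial τ ℝ :=
  LinearMap.mulLeft ℝ (X i) ∘ₗ (pderiv i).toLinearMap

theorem euler_apply (i : τ) (f : MvPolynomial τ ℝ) : euler i f = X i * pderiv i f := rfl

theorem euler_mul (i : τ) (f g : MvPolynomial τ ℝ) :
    euler i (f * g) = euler i f * g + f * euler i g := by
  simp only [euler_apply, Derivation.leibniz, smul_eq_mul]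
  ring

theorem coeff_euler (i : τ) (f : MvPolynomial τ ℝ) (d : τ →₀ ℕ) :
    coeff d (euler i f) = d i * coeff d f := by
  rw [euler_apply]
  induction f using MvPolynomial.induction_on' with
  | monomial u c =>
    rw [X_mul_pderiv_monomial, coeff_smul, nsmul_eq_mul, coeff_monomial]
    split_ifs with h
    · rw [h]
    · simp
  | add p q hp hq => rw [map_add, mul_add, coeff_add, hp, hq, coeff_add, mul_add]

variable {σ : Type} [Fintype σ] [DecidableEq σ]

/-- The Heckman–Dunkl operator
`x_i ∂/∂x_i + a ∑_{k ≠ i} x_i (1 - s_{ik}) / (x_i - x_k)` in the variables indexed by the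
range of the embedding `e`. -/
def dunkl (a : ℝ) (e : σ ↪ τ) (i : σ) : Module.End ℝ (MvPolynomial τ ℝ) :=
  -- Allowing an embedding `e` lets one definition act on `x` alone, on the `x` inside `(x, y)`, or
  -- on the `y` inside `(x, y)`.
  euler (e i) + a • ∑ k : σ, if h : e i ≠ e k then divDiff (e i) (e k) h else 0

theorem dunkl_apply (a : ℝ) (e : σ ↪ τ) (i : σ) (f : MvPolynomial τ ℝ) :
    dunkl a e i f = euler (e i) f +
      a • ∑ k : σ, if h : e i ≠ e k then divDiff (e i) (e k) h f else 0 := by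
  simp only [dunkl, LinearMap.add_apply, LinearMap.smul_apply, LinearMap.sum_apply]
  congr 2
  refine Finset.sum_congr rfl fun k _ => ?_
  split_ifs <;> rfl

end Operators

/-! ### Operators on products `f(x) g(y)` -/

section Separate

variable {σ : Type} [Fintype σ] [DecidableEq σ]

/-- `f(x) g(y)` as a polynomial in two sets of variables. -/
def tens (f g : MvPolynomial σ ℝ) : MvPolynomial (σ ⊕ σ) ℝ :=
  rename Sum.inl f * rename Sum.inr g

theorem tens_monomial (p q : σ →₀ ℕ) (b c : ℝ) :
    tens (monomial p b) (monomial q c) = monomial (p.sumElim q) (b * c) := by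
  rw [tens, rename_monomial, rename_monomial, monomial_mul]
  have h : p.mapDomain Sum.inl + q.mapDomain Sum.inr = p.sumElim q := by
    refine Finsupp.ext fun t => ?_
    rcases t with i | i
    · rw [Finsupp.add_apply, Finsupp.mapDomain_apply Sum.inl_injective,
        Finsupp.mapDomain_of_notMem_range _ _ (by simp), Finsupp.sumElim_inl, add_zero]
    · rw [Finsupp.add_apply, Finsupp.mapDomain_apply Sum.inr_injective,
        Finsupp.mapDomain_of_notMem_range _ _ (by simp), Finsupp.sumElim_inr, zero_add]
  rw [h]

theorem exists_sumElim (d : σ ⊕ σ →₀ ℕ) : ∃ p q : σ →₀ ℕ, d = p.sumElim q := by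
  obtain ⟨⟨p, q⟩, rfl⟩ := (Finsupp.sumFinsuppEquivProdFinsupp).symm.surjective d
  exact ⟨p, q, rfl⟩

theorem sumElim_inj {p q p' q' : σ →₀ ℕ} (h : p.sumElim q = p'.sumElim q') : p = p' ∧ q = q' := by
  constructor
  · refine Finsupp.ext fun i => ?_
    simpa using DFunLike.congr_fun h (Sum.inl i)
  · refine Finsupp.ext fun i => ?_
    simpa using DFunLike.congr_fun h (Sum.inr i)

theorem tens_add_left (f f' g : MvPolynomial σ ℝ) : tens (f + f') g = tens f g + tens f' g := by
  rw [tens, map_add, add_mul]; rfl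

theorem tens_add_right (f g g' : MvPolynomial σ ℝ) : tens f (g + g') = tens f g + tens f g' := by
  rw [tens, map_add, mul_add]; rfl

theorem tens_mul (f f' g g' : MvPolynomial σ ℝ) :
    tens (f * f') (g * g') = tens f g * tens f' g' := by
  rw [tens, tens, tens, map_mul, map_mul]
  ring

theorem tens_sum_left {ι : Type} (s : Finset ι) (f : ι → MvPolynomial σ ℝ) (g : MvPolynomial σ ℝ) :
    tens (∑ i ∈ s, f i) g = ∑ i ∈ s, tens (f i) g := by
  rw [tens, map_sum, Finset.sum_mul]; rfl

theorem tens_sum_right {ι : Type} (s : Finset ι) (f : MvPolynomial σ ℝ)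
    (g : ι → MvPolynomial σ ℝ) : tens f (∑ i ∈ s, g i) = ∑ i ∈ s, tens f (g i) := by
  rw [tens, map_sum, Finset.mul_sum]; rfl

theorem coeff_tens (p q : σ →₀ ℕ) (f g : MvPolynomial σ ℝ) :
    coeff (p.sumElim q) (tens f g) = coeff p f * coeff q g := by
  classical
  induction f using MvPolynomial.induction_on' with
  | add f f' hf hf' => rw [tens_add_left, coeff_add, hf, hf', coeff_add, add_mul]
  | monomial u b =>
    induction g using MvPolynomial.induction_on' with
    | add g g' hg hg' => rw [tens_add_right, coeff_add, hg, hg', coeff_add, mul_add]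
    | monomial v c =>
      rw [tens_monomial, coeff_monomial, coeff_monomial, coeff_monomial]
      by_cases h : u = p
      · by_cases h' : v = q
        · rw [if_pos h, if_pos h', if_pos (by rw [h, h'])]
        · rw [if_neg h', if_neg fun e => h' (sumElim_inj e).2, mul_zero]
      · rw [if_neg h, if_neg fun e => h (sumElim_inj e).1, zero_mul]

theorem monomial_eq_tens (d : σ ⊕ σ →₀ ℕ) (c : ℝ) : ∃ f g : MvPolynomial σ ℝ,
    monomial d c = tens f g := by
  obtain ⟨p, q, rfl⟩ := exists_sumElim d
  exact ⟨monomial p c, monomial q 1, by rw [tens_monomial, mul_one]⟩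

theorem rename_swapVar {τ : Type} [DecidableEq τ] (e : σ ↪ τ) (i k : σ) (f : MvPolynomial σ ℝ) :
    swapVar (e i) (e k) (rename e f) = rename e (swapVar i k f) := by
  rw [swapVar, swapVar, rename_rename, rename_rename]
  congr 1
  congr 1
  funext j
  exact (e.injective.map_swap i k j).symm

theorem swapVar_rename_of_notMem {τ : Type} [DecidableEq τ] {ρ : Type} (e : ρ → τ) (i k : τ)
    (hi : ∀ j, e j ≠ i) (hk : ∀ j, e j ≠ k) (f : MvPolynomial ρ ℝ) :
    swapVar i k (rename e f) = rename e f := by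
  rw [swapVar, rename_rename]
  congr 2
  funext j
  exact Equiv.swap_apply_of_ne_of_ne (hi j) (hk j)

theorem divDiff_mul_of_invariant {τ : Type} [DecidableEq τ] {i k : τ} (h : i ≠ k)
    (f g : MvPolynomial τ ℝ) (hg : swapVar i k g = g) :
    divDiff i k h (f * g) = divDiff i k h f * g := by
  apply divDiff_eq
  rw [← mul_assoc, X_sub_X_mul_divDiff, map_mul, hg]
  ring

theorem divDiff_rename {τ : Type} [DecidableEq τ] (e : σ ↪ τ) {i k : σ} (h : i ≠ k)
    (h' : e i ≠ e k) (f : MvPolynomial σ ℝ) :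
    divDiff (e i) (e k) h' (rename e f) = rename e (divDiff i k h f) := by
  apply divDiff_eq
  rw [rename_swapVar, ← map_sub, ← rename_X e i, ← rename_X e k, ← map_sub, ← map_mul, ← map_mul,
    X_sub_X_mul_divDiff]

theorem pderiv_rename_of_notMem {τ ρ : Type} (e : ρ → τ) (i : τ)
    (hi : ∀ j, e j ≠ i) (f : MvPolynomial ρ ℝ) : pderiv i (rename e f) = 0 := by
  classical
  apply pderiv_eq_zero_of_notMem_vars
  intro h
  obtain ⟨j, -, hj⟩ := Finset.mem_image.1 (vars_rename e f h)
  exact hi j hj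

/-- Polynomials in variables outside the range of `e` act as scalars: the derivative kills them and
the transpositions fix them. -/
theorem dunkl_rename_mul {τ ρ : Type} [DecidableEq τ] (a : ℝ) (e : σ ↪ τ) (e' : ρ → τ)
    (he : ∀ i j, e' j ≠ e i) (i : σ) (f : MvPolynomial σ ℝ) (g : MvPolynomial ρ ℝ) :
    dunkl a e i (rename e f * rename e' g) =
      rename e (dunkl a (Function.Embedding.refl σ) i f) * rename e' g := by
  rw [dunkl_apply, dunkl_apply, map_add, add_mul, map_smul, smul_mul_assoc, map_sum,
    Finset.sum_mul]
  congr 1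
  · rw [euler_mul, euler_apply, euler_apply, euler_apply, pderiv_rename_of_notMem _ _ (he i),
      pderiv_rename e.injective]
    simp
  · congr 1
    refine Finset.sum_congr rfl fun k _ => ?_
    by_cases h : i = k
    · subst h
      simp
    · rw [dif_pos (e.injective.ne h), dif_pos (by simpa using h),
        divDiff_mul_of_invariant _ _ _ (swapVar_rename_of_notMem _ _ _ (he i) (he k) g)]
      congr 1
      exact divDiff_rename e h _ f

/-- The inclusion of the variables `x`. -/
abbrev embX (σ : Type) : σ ↪ σ ⊕ σ := Function.Embedding.inl
/-- The inclusion of the variables `y`. -/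
abbrev embY (σ : Type) : σ ↪ σ ⊕ σ := Function.Embedding.inr

/-- The Heckman–Dunkl operator in the variables `z_i`, `i : σ`. -/
abbrev dunklOne (a : ℝ) (i : σ) : Module.End ℝ (MvPolynomial σ ℝ) :=
  dunkl a (Function.Embedding.refl σ) i

theorem dunkl_embX_tens (a : ℝ) (i : σ) (f g : MvPolynomial σ ℝ) :
    dunkl a (embX σ) i (tens f g) = tens (dunklOne a i f) g :=
  dunkl_rename_mul a (embX σ) Sum.inr (by simp) i f g

theorem dunkl_embY_tens (a : ℝ) (i : σ) (f g : MvPolynomial σ ℝ) :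
    dunkl a (embY σ) i (tens f g) = tens f (dunklOne a i g) := by
  rw [tens, mul_comm, tens, mul_comm (rename Sum.inl f)]
  exact dunkl_rename_mul a (embY σ) Sum.inl (by simp) i g f

theorem dunkl_embX_pow_tens (a : ℝ) (i : σ) (m : ℕ) (f g : MvPolynomial σ ℝ) :
    (dunkl a (embX σ) i ^ m) (tens f g) = tens ((dunklOne a i ^ m) f) g := by
  induction m with
  | zero => rfl
  | succ m ih =>
    rw [pow_succ', pow_succ', Module.End.mul_apply, ih, dunkl_embX_tens, Module.End.mul_apply]

theorem dunkl_embY_pow_tens (a : ℝ) (i : σ) (m : ℕ) (f g : MvPolynomial σ ℝ) :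
    (dunkl a (embY σ) i ^ m) (tens f g) = tens f ((dunklOne a i ^ m) g) := by
  induction m with
  | zero => rfl
  | succ m ih =>
    rw [pow_succ', pow_succ', Module.End.mul_apply, ih, dunkl_embY_tens, Module.End.mul_apply]

/-- Every monomial is a product `f(x) g(y)`, and each of the two operators touches only its own
factor. -/
theorem commute_dunkl (a : ℝ) (i j : σ) : Commute (dunkl a (embX σ) i) (dunkl a (embY σ) j) := by
  refine LinearMap.ext fun F => ?_
  induction F using MvPolynomial.induction_on' with
  | add F G hF hG => rw [map_add, hF, hG, map_add]
  | monomial d c =>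
    obtain ⟨f, g, h⟩ := monomial_eq_tens d c
    simp only [h, Module.End.mul_apply, dunkl_embX_tens, dunkl_embY_tens]

end Separate

end

section

open MvPolynomial

/-! ### The kernel as a power series with polynomial coefficients -/

section Extend

variable {τ : Type} [DecidableEq τ]

/-- A linear operator on polynomials acting on the coefficients of power series. -/
def ext (T : Module.End ℝ (MvPolynomial τ ℝ)) :
    Module.End ℝ (PowerSeries (MvPolynomial τ ℝ)) where
  toFun F := PowerSeries.mk fun n => T (PowerSeries.coeff n F)
  map_add' F G := by
    ext1 n
    simp
  map_smul' c F := by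
    ext1 n
    simp

@[simp] theorem coeff_ext (T : Module.End ℝ (MvPolynomial τ ℝ))
    (F : PowerSeries (MvPolynomial τ ℝ)) (n : ℕ) :
    PowerSeries.coeff n (ext T F) = T (PowerSeries.coeff n F) := by
  simp [ext]

theorem coeff_ext_pow (T : Module.End ℝ (MvPolynomial τ ℝ)) (m : ℕ)
    (F : PowerSeries (MvPolynomial τ ℝ)) (n : ℕ) :
    PowerSeries.coeff n ((ext T ^ m) F) = (T ^ m) (PowerSeries.coeff n F) := by
  induction m generalizing F with
  | zero => rfl
  | succ m ih => rw [pow_succ, pow_succ, Module.End.mul_apply, ih, coeff_ext, Module.End.mul_apply]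

theorem commute_ext {S T : Module.End ℝ (MvPolynomial τ ℝ)} (h : Commute S T) :
    Commute (ext S) (ext T) := by
  refine LinearMap.ext fun F => PowerSeries.ext fun n => ?_
  simp only [Module.End.mul_apply, coeff_ext]
  exact LinearMap.congr_fun h.eq _

/-- Constant polynomial coefficients. -/
abbrev con (f : MvPolynomial τ ℝ) : PowerSeries (MvPolynomial τ ℝ) := PowerSeries.C f

/-- The transposition of two variables acting on coefficients. -/
def swapSeries (i k : τ) : PowerSeries (MvPolynomial τ ℝ) →+* PowerSeries (MvPolynomial τ ℝ) :=
  PowerSeries.map (swapVar i k).toRingHom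

/-- This lets divided differences of series be computed by clearing the denominator once, instead of
coefficient by coefficient. -/
theorem ext_divDiff_eq {i k : τ} (h : i ≠ k) {F G : PowerSeries (MvPolynomial τ ℝ)}
    (hG : (con (X i) - con (X k)) * G = con (X i) * (F - swapSeries i k F)) :
    ext (divDiff i k h) F = G := by
  ext1 n
  rw [coeff_ext]
  apply divDiff_eq
  have := congrArg (PowerSeries.coeff n) hG
  rw [← map_sub, PowerSeries.coeff_C_mul, PowerSeries.coeff_C_mul, map_sub] at this
  simpa [swapSeries] using this

theorem ext_euler_mul (i : τ) (F G : PowerSeries (MvPolynomial τ ℝ)) :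
    ext (euler i) (F * G) = ext (euler i) F * G + F * ext (euler i) G := by
  ext1 n
  simp only [coeff_ext, map_add, PowerSeries.coeff_mul, map_sum, euler_mul, Finset.sum_add_distrib]

/-- Logarithmic derivatives add up over a product. -/
theorem ext_euler_prod {ι : Type} (i : τ) (s : Finset ι)
    (F u : ι → PowerSeries (MvPolynomial τ ℝ))
    (h : ∀ t ∈ s, ext (euler i) (F t) = u t * F t) :
    ext (euler i) (∏ t ∈ s, F t) = (∑ t ∈ s, u t) * ∏ t ∈ s, F t := by
  classical
  induction s using Finset.induction_on with
  | empty =>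
    rw [Finset.prod_empty, Finset.sum_empty, zero_mul]
    have := ext_euler_mul i (1 : PowerSeries (MvPolynomial τ ℝ)) 1
    rw [mul_one, one_mul, mul_one] at this
    exact left_eq_add.1 this
  | insert t s hts ih =>
    rw [Finset.prod_insert hts, Finset.sum_insert hts, ext_euler_mul,
      h t (Finset.mem_insert_self _ _), ih fun r hr => h r (Finset.mem_insert_of_mem hr)]
    ring

theorem ext_dunkl_apply {σ : Type} [Fintype σ] [DecidableEq σ] (a : ℝ) (e : σ ↪ τ) (i : σ)
    (F : PowerSeries (MvPolynomial τ ℝ)) :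
    ext (dunkl a e i) F = ext (euler (e i)) F +
      a • ∑ k : σ, if h : e i ≠ e k then ext (divDiff (e i) (e k) h) F else 0 := by
  ext1 n
  rw [coeff_ext, dunkl_apply, map_add, coeff_ext]
  congr 1
  rw [PowerSeries.coeff_smul, map_sum]
  congr 1
  refine Finset.sum_congr rfl fun k _ => ?_
  split_ifs
  · rw [coeff_ext]
  · rw [map_zero]

/-- The series `∑_n c_n η^{2n} z^n`. -/
def evenSeries (c : ℕ → ℝ) (z : MvPolynomial τ ℝ) : PowerSeries (MvPolynomial τ ℝ) :=
  PowerSeries.mk fun d => if Even d then c (d / 2) • z ^ (d / 2) else 0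

/-- The series `η² z`. -/
abbrev quad (z : MvPolynomial τ ℝ) : PowerSeries (MvPolynomial τ ℝ) := PowerSeries.monomial 2 z

theorem quad_mul (f z : MvPolynomial τ ℝ) : quad (f * z) = con f * quad z := by
  ext1 n
  rw [PowerSeries.coeff_C_mul, PowerSeries.coeff_monomial, PowerSeries.coeff_monomial]
  split_ifs <;> simp

theorem quad_eq (z : MvPolynomial τ ℝ) : quad z = con z * PowerSeries.X ^ 2 := by
  ext1 n
  rw [PowerSeries.coeff_monomial, PowerSeries.coeff_C_mul, PowerSeries.coeff_X_pow]
  split_ifs <;> simp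

theorem quad_mul_evenSeries (c : ℕ → ℝ) (z : MvPolynomial τ ℝ) :
    quad z * evenSeries c z = evenSeries (fun n => if n = 0 then 0 else c (n - 1)) z := by
  ext1 d
  rw [quad_eq, mul_assoc, PowerSeries.coeff_C_mul, PowerSeries.coeff_X_pow_mul', evenSeries,
    evenSeries, PowerSeries.coeff_mk]
  by_cases hd : 2 ≤ d
  · obtain ⟨e, rfl⟩ := Nat.exists_eq_add_of_le hd
    have h1 : (2 + e) / 2 = e / 2 + 1 := by omega
    have h2 : Even (2 + e) ↔ Even e := by simp [Nat.even_add]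
    rw [if_pos hd, PowerSeries.coeff_mk, h1, Nat.add_sub_cancel_left, if_neg (Nat.succ_ne_zero _),
      Nat.add_sub_cancel]
    by_cases h : Even e
    · rw [if_pos h, if_pos (h2.2 h), mul_smul_comm, pow_succ']
    · rw [if_neg h, if_neg (mt h2.1 h), mul_zero]
  · rw [if_neg hd, PowerSeries.coeff_mk]
    have : d / 2 = 0 := by omega
    rw [this, if_pos rfl, zero_smul, ite_self, mul_zero]

theorem evenSeries_sub (c c' : ℕ → ℝ) (z : MvPolynomial τ ℝ) :
    evenSeries c z - evenSeries c' z = evenSeries (fun n => c n - c' n) z := by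
  ext1 d
  simp only [evenSeries, map_sub, PowerSeries.coeff_mk]
  split_ifs
  · rw [sub_smul]
  · simp

theorem evenSeries_smul (a : ℝ) (c : ℕ → ℝ) (z : MvPolynomial τ ℝ) :
    a • evenSeries c z = evenSeries (fun n => a * c n) z := by
  ext1 d
  simp only [evenSeries, PowerSeries.coeff_smul, PowerSeries.coeff_mk, mul_smul]
  split_ifs <;> simp

theorem swapSeries_evenSeries (i k : τ) (c : ℕ → ℝ) (z : MvPolynomial τ ℝ) :
    swapSeries i k (evenSeries c z) = evenSeries c (swapVar i k z) := by
  ext1 d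
  simp only [swapSeries, PowerSeries.coeff_map, evenSeries, PowerSeries.coeff_mk]
  split_ifs
  · simp
  · simp

theorem euler_pow (i : τ) (z : MvPolynomial τ ℝ) (b : ℝ) (h : euler i z = b • z) (n : ℕ) :
    euler i (z ^ n) = (n * b) • z ^ n := by
  induction n with
  | zero => simp [euler_apply]
  | succ n ih =>
    rw [pow_succ, euler_mul, ih, h, smul_mul_assoc, mul_smul_comm, ← add_smul]
    congr 1
    push_cast
    ring

theorem ext_euler_evenSeries (i : τ) (c : ℕ → ℝ) (z : MvPolynomial τ ℝ) (b : ℝ)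
    (h : euler i z = b • z) :
    ext (euler i) (evenSeries c z) = b • evenSeries (fun n => n * c n) z := by
  ext1 d
  simp only [evenSeries, coeff_ext, PowerSeries.coeff_smul, PowerSeries.coeff_mk]
  split_ifs
  · rw [map_smul, euler_pow i z b h, smul_smul, smul_smul]
    congr 1
    ring
  · simp

/-- The series of `η² z / (1 - η² z)`. -/
def geo (z : MvPolynomial τ ℝ) : PowerSeries (MvPolynomial τ ℝ) :=
  evenSeries (fun n => if n = 0 then 0 else 1) z

/-- The coefficients of `(1 - t)^{-a}`. -/
def binomCoeff (a : ℝ) (n : ℕ) : ℝ := (-1) ^ n * Ring.choose (-a) n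

theorem binomCoeff_zero (a : ℝ) : binomCoeff a 0 = 1 := by simp [binomCoeff]

/-- Coefficient form of the differential equation `(1 - t) f' = a f` satisfied by `f = (1 -
t)^{-a}`. -/
theorem binomCoeff_succ (a : ℝ) (n : ℕ) :
    (n + 1 : ℝ) * binomCoeff a (n + 1) = (a + n) * binomCoeff a n := by
  have h1 := Ring.descPochhammer_eq_factorial_smul_choose (-a) (n + 1)
  have h2 := Ring.descPochhammer_eq_factorial_smul_choose (-a) n
  rw [descPochhammer_succ_right, Polynomial.smeval_mul, h2] at h1
  have h3 : ((Polynomial.X - (n : Polynomial ℤ)).smeval (-a) : ℝ) = -a - n := by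
    rw [Polynomial.smeval_sub, Polynomial.smeval_X, Polynomial.smeval_natCast]
    simp
  rw [h3, Nat.factorial_succ, nsmul_eq_mul, nsmul_eq_mul] at h1
  have hn : (n.factorial : ℝ) ≠ 0 := by positivity
  push_cast at h1
  have h4 : (n + 1 : ℝ) * Ring.choose (-a) (n + 1) = Ring.choose (-a) n * (-a - n) := by
    apply mul_left_cancel₀ hn
    linear_combination -h1
  rw [binomCoeff, binomCoeff, pow_succ]
  linear_combination (-1) ^ n * (-1) * h4

/-- The series of `(1 - η² z)^{-a}`. -/
def binom (a : ℝ) (z : MvPolynomial τ ℝ) : PowerSeries (MvPolynomial τ ℝ) :=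
  evenSeries (binomCoeff a) z

theorem one_eq_evenSeries (z : MvPolynomial τ ℝ) :
    (1 : PowerSeries (MvPolynomial τ ℝ)) = evenSeries (fun n => if n = 0 then 1 else 0) z := by
  ext1 d
  rw [PowerSeries.coeff_one, evenSeries, PowerSeries.coeff_mk]
  by_cases h : d = 0
  · simp [h]
  · rw [if_neg h]
    split_ifs with h1 h2
    · obtain ⟨r, rfl⟩ := h1
      omega
    · simp
    · rfl

theorem quad_eq_evenSeries (z : MvPolynomial τ ℝ) :
    quad z = evenSeries (fun n => if n = 1 then 1 else 0) z := by
  rw [← mul_one (quad z), one_eq_evenSeries z, quad_mul_evenSeries]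
  congr 1
  funext n
  rcases n with _ | _ | n <;> simp

theorem one_sub_quad_mul_geo (z : MvPolynomial τ ℝ) : (1 - quad z) * geo z = quad z := by
  rw [sub_mul, one_mul, geo, quad_mul_evenSeries, evenSeries_sub, quad_eq_evenSeries]
  congr 1
  funext n
  rcases n with _ | _ | n <;> simp

theorem one_sub_quad_ne_zero (z : MvPolynomial τ ℝ) : 1 - quad z ≠ 0 := by
  intro h
  have := congrArg (PowerSeries.coeff 0) h
  rw [map_sub, PowerSeries.coeff_monomial] at this
  simp at this

/-- For `G = t/(1 - t)` one has `t G' = t/(1 - t)² = G (1 + G)`; here it is found by differentiating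
`(1 - t) G = t`. -/
theorem ext_euler_geo (i : τ) (z : MvPolynomial τ ℝ) (h : euler i z = z) :
    ext (euler i) (geo z) = geo z * (1 + geo z) := by
  apply mul_left_cancel₀ (one_sub_quad_ne_zero z)
  have h1 := congrArg (ext (euler i)) (one_sub_quad_mul_geo z)
  have h2 : ext (euler i) (quad z) = quad z := by
    rw [quad_eq_evenSeries, ext_euler_evenSeries i _ z 1 (by rw [h, one_smul]), one_smul]
    congr 1
    funext n
    split_ifs with hn
    · simp [hn]
    · simp
  have h3 : ext (euler i) (1 : PowerSeries (MvPolynomial τ ℝ)) = 0 := by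
    rw [one_eq_evenSeries z, ext_euler_evenSeries i _ z 1 (by rw [h, one_smul]), one_smul]
    ext1 d
    rw [evenSeries, PowerSeries.coeff_mk]
    split_ifs with h1 h2 <;> simp [h2]
  rw [ext_euler_mul, map_sub, h2, h3] at h1
  linear_combination h1 - (1 + geo z) * one_sub_quad_mul_geo z

/-- After multiplication by `1 - η² z` the claim becomes the recursion `binomCoeff_succ` in each
degree. -/
theorem ext_euler_binom (a : ℝ) (i : τ) (z : MvPolynomial τ ℝ) (h : euler i z = z) :
    ext (euler i) (binom a z) = (a • geo z) * binom a z := by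
  apply mul_left_cancel₀ (one_sub_quad_ne_zero z)
  rw [smul_mul_assoc, mul_smul_comm, ← mul_assoc, one_sub_quad_mul_geo, binom,
    ext_euler_evenSeries i _ z 1 (by rw [h, one_smul]), one_smul, sub_mul, one_mul,
    quad_mul_evenSeries, quad_mul_evenSeries, evenSeries_sub, evenSeries_smul]
  congr 1
  funext n
  rcases n with _ | n
  · simp
  · simp only [Nat.succ_ne_zero, if_false, Nat.add_sub_cancel]
    push_cast
    linear_combination binomCoeff_succ a n

theorem ext_euler_binom_of_eq_zero (a : ℝ) (i : τ) (z : MvPolynomial τ ℝ) (h : euler i z = 0) :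
    ext (euler i) (binom a z) = 0 := by
  rw [binom, ext_euler_evenSeries i _ z 0 (by rw [h, zero_smul]), zero_smul]

end Extend

/-! ### The action of the Heckman–Dunkl operators on the kernel -/

section Kernel

variable {σ : Type} [Fintype σ] [DecidableEq σ] {τ : Type} [DecidableEq τ]

/-- The series `η² x_i y_j / (1 - η² x_i y_j)`. -/
def cross (e e' : σ ↪ τ) (i j : σ) : PowerSeries (MvPolynomial τ ℝ) :=
  geo (X (e i) * X (e' j))

/-- The kernel `∏_{i,j} (1 - η² x_i y_j)^{-a}`. -/
def cauchy (a : ℝ) (e e' : σ ↪ τ) : PowerSeries (MvPolynomial τ ℝ) :=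
  ∏ i : σ, ∏ j : σ, binom a (X (e i) * X (e' j))

theorem cross_comm (e e' : σ ↪ τ) (i j : σ) : cross e e' i j = cross e' e j i := by
  rw [cross, cross, mul_comm]

theorem cauchy_comm (a : ℝ) (e e' : σ ↪ τ) : cauchy a e e' = cauchy a e' e := by
  rw [cauchy, cauchy, Finset.prod_comm]
  refine Finset.prod_congr rfl fun i _ => Finset.prod_congr rfl fun j _ => ?_
  rw [mul_comm]

variable {e e' : σ ↪ τ} (hd : ∀ i j, e i ≠ e' j)
include hd

theorem euler_X_mul_X (i k j : σ) : euler (e i) (X (e k) * X (e' j)) =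
    if k = i then X (e k) * X (e' j) else 0 := by
  rw [euler_mul, euler_apply, euler_apply, pderiv_X, pderiv_X, Pi.single_apply, Pi.single_apply,
    if_neg (hd i j).symm]
  by_cases h : k = i
  · simp [h]
  · rw [if_neg h, if_neg (e.injective.ne h)]
    simp

theorem ext_euler_cauchy (a : ℝ) (i : σ) :
    ext (euler (e i)) (cauchy a e e') = (a • ∑ j, cross e e' i j) * cauchy a e e' := by
  rw [cauchy, ext_euler_prod (e i) Finset.univ _
    (fun k => ∑ j, if k = i then a • cross e e' k j else 0)]
  · congr 1
    rw [Finset.sum_comm, Finset.smul_sum]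
    simp
  · intro k _
    rw [ext_euler_prod]
    intro j _
    have h := euler_X_mul_X hd i k j
    split_ifs at h ⊢
    · exact ext_euler_binom a _ _ h
    · rw [zero_mul]
      exact ext_euler_binom_of_eq_zero a _ _ h

theorem swapVar_X_mul_X (i k l j : σ) : swapVar (e i) (e k) (X (e l) * X (e' j)) =
    X (e (Equiv.swap i k l)) * X (e' j) := by
  rw [map_mul, swapVar_X, swapVar_X, Equiv.swap_apply_of_ne_of_ne (hd i j).symm (hd k j).symm,
    e.injective.map_swap]

theorem swapSeries_cauchy (a : ℝ) (i k : σ) :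
    swapSeries (e i) (e k) (cauchy a e e') = cauchy a e e' := by
  rw [cauchy, map_prod]
  simp only [map_prod, binom, swapSeries_evenSeries, swapVar_X_mul_X hd]
  exact Equiv.prod_comp (Equiv.swap i k)
    (fun l => ∏ j, evenSeries (binomCoeff a) (X (e l) * X (e' j)))

theorem swapSeries_cross (i k l j : σ) :
    swapSeries (e i) (e k) (cross e e' l j) = cross e e' (Equiv.swap i k l) j := by
  rw [cross, geo, swapSeries_evenSeries, swapVar_X_mul_X hd]
  rfl

theorem ext_divDiff_cauchy (a : ℝ) {i k : σ} (h : e i ≠ e k) :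
    ext (divDiff (e i) (e k) h) (cauchy a e e') = 0 := by
  apply ext_divDiff_eq
  rw [swapSeries_cauchy hd]
  ring

/-- The kernel is invariant and factors out. What remains is `c_i - c_k = (x_i - x_k) y / ((1 - x_i
y)(1 - x_k y))`, so that `x_i (c_i - c_k)/(x_i - x_k) = c_i (1 + c_k)`. -/
theorem ext_divDiff_cross_mul_cauchy (a : ℝ) {i k : σ} (j : σ) (h : e i ≠ e k) :
    ext (divDiff (e i) (e k) h) (cross e e' i j * cauchy a e e') =
      cross e e' i j * (1 + cross e e' k j) * cauchy a e e' := by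
  apply ext_divDiff_eq
  rw [map_mul, swapSeries_cauchy hd, swapSeries_cross hd, Equiv.swap_apply_left]
  suffices key : (con (X (e i)) - con (X (e k))) *
      (cross e e' i j * (1 + cross e e' k j)) =
      con (X (e i)) * (cross e e' i j - cross e e' k j) by
    linear_combination cauchy a e e' * key
  have hi := one_sub_quad_mul_geo (X (e i) * X (e' j) : MvPolynomial τ ℝ)
  have hk := one_sub_quad_mul_geo (X (e k) * X (e' j) : MvPolynomial τ ℝ)
  apply mul_left_cancel₀ (one_sub_quad_ne_zero (X (e i) * X (e' j) : MvPolynomial τ ℝ))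
  apply mul_left_cancel₀ (one_sub_quad_ne_zero (X (e k) * X (e' j) : MvPolynomial τ ℝ))
  rw [quad_mul] at hi hk ⊢
  rw [quad_mul]
  change _ * cross e e' i j = _ at hi
  change _ * cross e e' k j = _ at hk
  generalize cross e e' i j = u at *
  generalize cross e e' k j = v at *
  generalize con (X (e i)) = x at *
  generalize con (X (e k)) = w at *
  generalize quad (X (e' j)) = y at *
  linear_combination ((1 - w * y) * ((x - w) * (1 + v) - x)) * hi +
    ((x - w) * (x * y) + x * (1 - x * y)) * hk

theorem ext_dunkl_cauchy (a : ℝ) (i : σ) :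
    ext (dunkl a e i) (cauchy a e e') = a • ∑ j, cross e e' i j * cauchy a e e' := by
  rw [ext_dunkl_apply, ext_euler_cauchy hd, smul_mul_assoc, Finset.sum_mul]
  convert add_zero _
  rw [Finset.sum_eq_zero, smul_zero]
  intro k _
  split_ifs
  · exact ext_divDiff_cauchy hd a _
  · rfl

/-- The point of the explicit formula is its symmetry: exchanging `(x, i)` with `(y, j)` only
permutes its summands. -/
theorem ext_dunkl_cross_mul_cauchy (a : ℝ) (i j : σ) :
    ext (dunkl a e i) (cross e e' i j * cauchy a e e') =
      cross e e' i j * (1 + cross e e' i j + a • ∑ l, cross e e' i l + a • ∑ k, cross e e' k j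
        - a • cross e e' i j + (a * (Fintype.card σ - 1)) • 1) * cauchy a e e' := by
  have h1 : (∑ k : σ, if h : e i ≠ e k then ext (divDiff (e i) (e k) h)
        (cross e e' i j * cauchy a e e') else 0) =
      ∑ k : σ, (cross e e' i j * (1 + cross e e' k j) * cauchy a e e' -
        if k = i then cross e e' i j * (1 + cross e e' k j) * cauchy a e e' else 0) := by
    refine Finset.sum_congr rfl fun k _ => ?_
    by_cases h : k = i
    · subst h
      simp
    · rw [dif_pos (e.injective.ne (Ne.symm h)), if_neg h, sub_zero,
        ext_divDiff_cross_mul_cauchy hd]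
  have h2 : ext (euler (e i)) (cross e e' i j) = cross e e' i j * (1 + cross e e' i j) :=
    ext_euler_geo _ _ (by rw [euler_X_mul_X hd, if_pos rfl])
  rw [ext_dunkl_apply, ext_euler_mul, ext_euler_cauchy hd, h1, h2, Finset.sum_sub_distrib,
    Finset.sum_ite_eq' Finset.univ i, if_pos (Finset.mem_univ i), ← Finset.sum_mul,
    ← Finset.mul_sum, Finset.sum_add_distrib, Finset.sum_const, Finset.card_univ]
  simp only [Algebra.smul_def, map_mul, map_sub, map_natCast, map_one, nsmul_eq_mul]
  ring

omit hd in
theorem ext_dunkl_cross_mul_cauchy_symm (hd : ∀ i j, e i ≠ e' j) (a : ℝ) (i j : σ) :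
    ext (dunkl a e i) (cross e e' i j * cauchy a e e') =
      ext (dunkl a e' j) (cross e e' i j * cauchy a e e') := by
  rw [ext_dunkl_cross_mul_cauchy hd, cross_comm e e' i j, cauchy_comm a e e',
    ext_dunkl_cross_mul_cauchy (fun i j => (hd j i).symm)]
  simp only [cross_comm e' e]
  ring

/-- The kernel intertwines the power sums of the Heckman–Dunkl operators in `x` and in `y`. -/
theorem sum_ext_dunkl_pow_cauchy (a : ℝ)
    (hc : ∀ i j, Commute (dunkl a e i) (dunkl a e' j)) (m : ℕ) :
    ∑ i, (ext (dunkl a e i) ^ m) (cauchy a e e') =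
      ∑ j, (ext (dunkl a e' j) ^ m) (cauchy a e e') := by
  rcases m with _ | m
  · simp
  -- An `x`-operator next to `c_{ij} Π` may be replaced by the `y`-operator, and then moved past the
  -- others. Only commutation between `x` and `y` is needed, none among the `D_i` of one set of
  -- variables.
  have key : ∀ i j (n : ℕ), (ext (dunkl a e i) ^ n) (cross e e' i j * cauchy a e e') =
      (ext (dunkl a e' j) ^ n) (cross e e' i j * cauchy a e e') := by
    intro i j n
    induction n with
    | zero => rfl
    | succ n ih =>
      have h := ((commute_ext (hc i j)).symm.pow_left n).eq
      rw [pow_succ', Module.End.mul_apply, ih, pow_succ, Module.End.mul_apply,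
        ← ext_dunkl_cross_mul_cauchy_symm hd]
      exact (LinearMap.congr_fun h _).symm
  have hy : ∀ j, ext (dunkl a e' j) (cauchy a e e') =
      a • ∑ i, cross e e' i j * cauchy a e e' := by
    intro j
    rw [cauchy_comm, ext_dunkl_cauchy (fun i j => (hd j i).symm)]
    simp only [cross_comm e' e]
  simp only [pow_succ, Module.End.mul_apply, ext_dunkl_cauchy hd, hy, map_smul, map_sum, key]
  rw [← Finset.smul_sum, ← Finset.smul_sum, Finset.sum_comm]

end Kernel

end

section

open MvPolynomial

/-! ### Homogeneous components of the kernel -/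

section Graded

variable {τ : Type} [Fintype τ] [DecidableEq τ]

/-- The homogeneous components of a power series, as the coefficients of a power series in one
variable. -/
def gradedFun (F : MvPowerSeries τ ℝ) : PowerSeries (MvPolynomial τ ℝ) :=
  PowerSeries.mk fun d => ∑ β ∈ Finset.finsuppAntidiag Finset.univ d,
    monomial β (MvPowerSeries.coeff β F)

theorem coeff_coeff_gradedFun (F : MvPowerSeries τ ℝ) (d : ℕ) (β : τ →₀ ℕ) :
    coeff β (PowerSeries.coeff d (gradedFun F)) =
      if β.degree = d then MvPowerSeries.coeff β F else 0 := by
  rw [gradedFun, PowerSeries.coeff_mk, coeff_sum]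
  simp only [coeff_monomial, Finset.sum_ite_eq', Finset.mem_finsuppAntidiag, Finset.subset_univ,
    and_true, Finsupp.degree_eq_sum]

/-- The ring homomorphism that sends a power series to the sequence of its homogeneous
components. -/
def graded : MvPowerSeries τ ℝ →+* PowerSeries (MvPolynomial τ ℝ) where
  toFun := gradedFun
  map_zero' := by
    ext d β
    simp [coeff_coeff_gradedFun]
  map_one' := by
    ext d β
    rw [coeff_coeff_gradedFun, MvPowerSeries.coeff_one, PowerSeries.coeff_one]
    by_cases hd : d = 0
    · subst hd
      rw [if_pos rfl, coeff_one]
      by_cases hβ : β = 0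
      · simp [hβ]
      · simp [hβ, Ne.symm hβ]
    · rw [if_neg hd, coeff_zero]
      split_ifs with h1 h2
      · simp [h2] at h1
        omega
      · rfl
      · rfl
  map_add' F G := by
    ext d β
    rw [map_add, coeff_add, coeff_coeff_gradedFun, coeff_coeff_gradedFun, coeff_coeff_gradedFun,
      map_add]
    split_ifs <;> simp
  map_mul' F G := by
    ext d β
    rw [coeff_coeff_gradedFun, PowerSeries.coeff_mul, coeff_sum, MvPowerSeries.coeff_mul]
    simp only [coeff_mul, coeff_coeff_gradedFun]
    rw [Finset.sum_comm]
    split_ifs with h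
    · refine Finset.sum_congr rfl fun p hp => ?_
      rw [Finset.HasAntidiagonal.mem_antidiagonal] at hp
      rw [Finset.sum_eq_single (p.1.degree, p.2.degree)]
      · simp
      · rintro ⟨i, j⟩ - hij
        by_cases hi : p.1.degree = i
        · rw [if_neg (fun hj : p.2.degree = j => hij (by rw [hi, hj])), mul_zero]
        · rw [if_neg hi, zero_mul]
      · intro hn
        exact absurd (by rw [Finset.HasAntidiagonal.mem_antidiagonal, ← map_add, hp, h]) hn
    · refine (Finset.sum_eq_zero fun p hp => Finset.sum_eq_zero fun ij hij => ?_).symm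
      rw [Finset.HasAntidiagonal.mem_antidiagonal] at hp hij
      dsimp only
      by_cases hi : p.1.degree = ij.1
      · rw [if_neg (fun hj : p.2.degree = ij.2 => h (by rw [← hp, map_add, hi, hj, hij])),
          mul_zero]
      · rw [if_neg hi, zero_mul]

theorem coeff_coeff_graded (F : MvPowerSeries τ ℝ) (d : ℕ) (β : τ →₀ ℕ) :
    coeff β (PowerSeries.coeff d (graded F)) =
      if β.degree = d then MvPowerSeries.coeff β F else 0 :=
  coeff_coeff_gradedFun F d β

/-- The monomial `x_i x_j` has degree 2, so its powers have distinct degrees and at most one term of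
the binomial series contributes to a given exponent. This is why only even powers of the grading
variable occur. -/
theorem graded_subst_binomialSeries (a : ℝ) (i j : τ) :
    graded ((PowerSeries.binomialSeries ℝ (-a)).subst
      (-(MvPowerSeries.X i * MvPowerSeries.X j) : MvPowerSeries τ ℝ)) =
    binom a (X i * X j) := by
  have hX : (-(MvPowerSeries.X i * MvPowerSeries.X j) : MvPowerSeries τ ℝ) =
      MvPowerSeries.monomial (Finsupp.single i 1 + Finsupp.single j 1) (-1) := by
    rw [MvPowerSeries.X_def, MvPowerSeries.X_def, MvPowerSeries.monomial_mul_monomial, mul_one,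
      map_neg]
  have hz : (X i * X j : MvPolynomial τ ℝ) =
      monomial (Finsupp.single i 1 + Finsupp.single j 1) 1 := by
    rw [X, X, monomial_mul, mul_one]
  have hdeg : (Finsupp.single i 1 + Finsupp.single j 1 : τ →₀ ℕ).degree = 2 := by
    simp
  rw [hX, hz]
  generalize (Finsupp.single i 1 + Finsupp.single j 1 : τ →₀ ℕ) = m at hdeg ⊢
  have hm : m ≠ 0 := by
    rintro rfl
    simp at hdeg
  ext d β
  rw [coeff_coeff_graded, PowerSeries.coeff_subst (PowerSeries.HasSubst.monomial hm _), binom,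
    evenSeries, PowerSeries.coeff_mk]
  simp only [MvPowerSeries.monomial_pow, MvPowerSeries.coeff_monomial,
    PowerSeries.binomialSeries_coeff, smul_eq_mul, mul_one, monomial_pow, one_pow]
  by_cases h : ∃ n : ℕ, β = n • m
  · obtain ⟨n, rfl⟩ := h
    have hinj : ∀ r : ℕ, n • m = r • m ↔ r = n := by
      intro r
      constructor
      · intro h
        have := congrArg Finsupp.degree h
        rw [map_nsmul, map_nsmul, hdeg, smul_eq_mul, smul_eq_mul] at this
        omega
      · rintro rfl
        rfl
    have hinj' : ∀ r : ℕ, r • m = n • m ↔ r = n := fun r => eq_comm.trans (hinj r)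
    rw [finsum_eq_single _ n (fun r hr => by rw [if_neg (mt (hinj r).1 hr), mul_zero]), if_pos rfl,
      map_nsmul, hdeg, smul_eq_mul]
    split_ifs with h1 h2 h2
    · rw [coeff_smul, coeff_monomial, if_pos ((hinj' _).2 (by omega)), ← h1, binomCoeff,
        Nat.mul_div_cancel _ (by norm_num), smul_eq_mul, mul_one, mul_comm]
    · exact absurd (by rw [← h1]; simp) h2
    · rw [coeff_smul, coeff_monomial, if_neg (fun h => h1 ?_), smul_zero]
      rw [← (hinj' _).1 h]
      exact Nat.div_mul_cancel h2.two_dvd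
    · rfl
  · have h' : ∀ n : ℕ, β ≠ n • m := fun n hn => h ⟨n, hn⟩
    rw [finsum_eq_zero_of_forall_eq_zero (fun r => by rw [if_neg (h' r), mul_zero]), ite_self]
    split_ifs with h1
    · rw [coeff_smul, coeff_monomial, if_neg (h' _).symm, smul_zero]
    · rfl

end Graded

theorem graded_kernel (N : ℕ) (α : ℝ) :
    graded (kernel N α) = cauchy (1 / α) (embX (Fin N)) (embY (Fin N)) := by
  simp only [kernel, cauchy, map_prod, graded_subst_binomialSeries]
  rfl

/-- The component of degree `n` in `x` and degree `n` in `y` of the kernel. -/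
def kernelPart (N : ℕ) (α : ℝ) (n : ℕ) : MvPolynomial (Fin N ⊕ Fin N) ℝ :=
  PowerSeries.coeff (2 * n) (graded (kernel N α))

theorem degree_sumElim {σ : Type} [Fintype σ] (β γ : σ →₀ ℕ) :
    (β.sumElim γ).degree = β.degree + γ.degree := by
  rw [Finsupp.degree_eq_sum, Finsupp.degree_eq_sum, Finsupp.degree_eq_sum, Fintype.sum_sum_type]
  simp


/-! ### The Euler recursion for the kernel -/

section EulerRecursion

variable {σ : Type} [Fintype σ] [DecidableEq σ]

/-- Expanding each geometric series gives `∑_{i,j} c_{ij} = ∑_{k ≥ 1} p_k(x) p_k(y) η^{2k}`. -/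
theorem coeff_sum_cross (d : ℕ) :
    PowerSeries.coeff d (∑ i, ∑ j, cross (embX σ) (embY σ) i j) =
      if Even d ∧ d ≠ 0 then tens (psum σ ℝ (d / 2)) (psum σ ℝ (d / 2)) else 0 := by
  simp only [map_sum, cross, geo, evenSeries, PowerSeries.coeff_mk]
  by_cases h1 : Even d
  · by_cases h2 : d = 0
    · subst h2
      simp
    · have h3 : d / 2 ≠ 0 := by
        obtain ⟨r, rfl⟩ := h1
        omega
      rw [if_pos (show Even d ∧ d ≠ 0 from ⟨h1, h2⟩), psum, tens_sum_left]
      refine Finset.sum_congr rfl fun i _ => ?_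
      rw [tens_sum_right]
      refine Finset.sum_congr rfl fun j _ => ?_
      rw [if_pos h1, if_neg h3, one_smul, mul_pow, tens, map_pow, map_pow, rename_X, rename_X]
      rfl
  · simp [h1]

theorem sum_ext_euler_cauchy (a : ℝ) :
    ∑ i, ext (euler (embX σ i)) (cauchy a (embX σ) (embY σ)) =
      a • ((∑ i, ∑ j, cross (embX σ) (embY σ) i j) * cauchy a (embX σ) (embY σ)) := by
  simp only [ext_euler_cauchy (e := embX σ) (e' := embY σ) (by simp), smul_mul_assoc]
  rw [← Finset.smul_sum, Finset.sum_mul]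

theorem sum_ext_euler_cauchy' (a : ℝ) :
    ∑ i, ext (euler (embY σ i)) (cauchy a (embX σ) (embY σ)) =
      a • ((∑ i, ∑ j, cross (embX σ) (embY σ) i j) * cauchy a (embX σ) (embY σ)) := by
  rw [cauchy_comm]
  simp only [ext_euler_cauchy (e := embY σ) (e' := embX σ) (by simp), smul_mul_assoc]
  rw [← Finset.smul_sum, ← Finset.sum_mul, Finset.sum_comm]
  simp only [cross_comm]

end EulerRecursion

/-- The Euler operators in `x` and in `y` have the same effect on the kernel, so a monomial that
occurs has equal degrees in `x` and in `y`. -/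
theorem coeff_kernel_eq_zero (N : ℕ) (α : ℝ) {β γ : Fin N →₀ ℕ} (h : β.degree ≠ γ.degree) :
    MvPowerSeries.coeff (β.sumElim γ) (kernel N α) = 0 := by
  have h1 := (sum_ext_euler_cauchy (σ := Fin N) (1 / α)).trans (sum_ext_euler_cauchy' _).symm
  rw [← graded_kernel] at h1
  have h2 := congrArg (fun F => coeff (β.sumElim γ) (PowerSeries.coeff (β.sumElim γ).degree F)) h1
  simp only [map_sum, coeff_ext, coeff_sum, coeff_euler, coeff_coeff_graded, if_true] at h2
  rw [← Finset.sum_mul, ← Finset.sum_mul] at h2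
  simp only [Function.Embedding.inl_apply, Function.Embedding.inr_apply, Finsupp.sumElim_inl,
    Finsupp.sumElim_inr] at h2
  rw [← Nat.cast_sum, ← Nat.cast_sum, ← Finsupp.degree_eq_sum, ← Finsupp.degree_eq_sum] at h2
  by_contra h0
  exact h (Nat.cast_injective (mul_right_cancel₀ h0 h2))

theorem coeff_kernelPart (N : ℕ) (α : ℝ) (n : ℕ) (β γ : Fin N →₀ ℕ) :
    coeff (β.sumElim γ) (kernelPart N α n) = if β.degree = n then
      MvPowerSeries.coeff (β.sumElim γ) (kernel N α) else 0 := by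
  rw [kernelPart, coeff_coeff_graded, degree_sumElim]
  by_cases h : β.degree = γ.degree
  · rw [h]
    congr 1
    rw [eq_iff_iff]
    omega
  · rw [coeff_kernel_eq_zero N α h, ite_self, ite_self]

theorem coeff_kernel (N : ℕ) (α : ℝ) (β γ : Fin N →₀ ℕ) :
    MvPowerSeries.coeff (β.sumElim γ) (kernel N α) =
      coeff (β.sumElim γ) (kernelPart N α β.degree) := by
  rw [coeff_kernelPart, if_pos rfl]

theorem kernelPart_zero (N : ℕ) (α : ℝ) : kernelPart N α 0 = 1 := by
  rw [kernelPart, graded_kernel, mul_zero, cauchy, PowerSeries.coeff_zero_eq_constantCoeff,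
    map_prod]
  refine Finset.prod_eq_one fun i _ => ?_
  rw [map_prod]
  refine Finset.prod_eq_one fun j _ => ?_
  rw [← PowerSeries.coeff_zero_eq_constantCoeff, binom, evenSeries, PowerSeries.coeff_mk]
  simp [binomCoeff_zero]

/-- Compare degrees in `∑_i x_i ∂_i Π = a ∑_{k ≥ 1} p_k(x) p_k(y) Π`; on the left the component has
degree `n` in `x`. -/
theorem nat_smul_kernelPart (N : ℕ) (α : ℝ) (n : ℕ) :
    (n : ℝ) • kernelPart N α n = (1 / α) • ∑ k ∈ Finset.range n,
      tens (psum (Fin N) ℝ (k + 1)) (psum (Fin N) ℝ (k + 1)) * kernelPart N α (n - 1 - k) := by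
  have h1 := congrArg (PowerSeries.coeff (2 * n)) (sum_ext_euler_cauchy (σ := Fin N) (1 / α))
  rw [← graded_kernel, PowerSeries.coeff_smul, PowerSeries.coeff_mul] at h1
  have h2 : PowerSeries.coeff (2 * n) (∑ i, ext (euler (embX (Fin N) i)) (graded (kernel N α))) =
      (n : ℝ) • kernelPart N α n := by
    ext δ
    obtain ⟨β, γ, rfl⟩ := exists_sumElim δ
    rw [coeff_smul, coeff_kernelPart]
    simp only [map_sum, coeff_ext, coeff_sum, coeff_euler]
    rw [← Finset.sum_mul]
    change _ * coeff _ (kernelPart N α n) = _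
    rw [coeff_kernelPart]
    split_ifs with h
    · rw [← h, ← Nat.cast_sum, Finsupp.degree_eq_sum]
      simp
    · simp
  rw [← h2, h1]
  congr 1
  simp only [coeff_sum_cross]
  rw [Finset.Nat.sum_antidiagonal_eq_sum_range_succ_mk]
  have h3 : Finset.image (fun k => 2 * (k + 1)) (Finset.range n) ⊆ Finset.range (2 * n).succ := by
    intro d hd
    rw [Finset.mem_image] at hd
    obtain ⟨k, hk, rfl⟩ := hd
    rw [Finset.mem_range] at hk ⊢
    omega
  -- Only the indices `2(k + 1)` contribute, since the series of `∑ c_{ij}` has neither odd nor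
  -- constant terms.
  rw [← Finset.sum_subset h3]
  · rw [Finset.sum_image (by intro a _ b _ h; simpa using h)]
    refine Finset.sum_congr rfl fun k hk => ?_
    rw [Finset.mem_range] at hk
    rw [if_pos ⟨even_two_mul _, by omega⟩, Nat.mul_div_cancel_left _ (by norm_num), kernelPart]
    have h4 : 2 * n - 2 * (k + 1) = 2 * (n - 1 - k) := by omega
    rw [h4]
  · intro d hd hd'
    rw [Finset.mem_range] at hd
    split_ifs with h
    · exfalso
      apply hd'
      rw [Finset.mem_image]
      obtain ⟨r, hr⟩ := h.1
      refine ⟨r - 1, ?_, ?_⟩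
      · rw [Finset.mem_range]
        omega
      · omega
    · rw [zero_mul]

theorem sum_dunkl_pow_kernelPart (N : ℕ) (α : ℝ) (m n : ℕ) :
    ∑ i, (dunkl (1 / α) (embX (Fin N)) i ^ m) (kernelPart N α n) =
      ∑ j, (dunkl (1 / α) (embY (Fin N)) j ^ m) (kernelPart N α n) := by
  have h := congrArg (PowerSeries.coeff (2 * n)) (sum_ext_dunkl_pow_cauchy
    (e := embX (Fin N)) (e' := embY (Fin N)) (by simp) (1 / α) (fun i j => commute_dunkl _ i j) m)
  rw [← graded_kernel] at h
  simp only [map_sum, coeff_ext_pow] at h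
  exact h

end

section

open MvPolynomial

/-! ### Power sums and the kernel as a positive combination of squares -/

section PowerSum

variable {σ : Type} [Fintype σ] [DecidableEq σ]

/-- The span of the products `p_k g`, `1 ≤ k ≤ n`, where `g` is symmetric and homogeneous of degree
`n - k`. -/
def psumSpan (σ : Type) [Fintype σ] (n : ℕ) : Submodule ℝ (MvPolynomial σ ℝ) :=
  Submodule.span ℝ {f | ∃ k g, k < n ∧ g.IsSymmetric ∧ g.IsHomogeneous (n - 1 - k) ∧
    f = psum σ ℝ (k + 1) * g}

theorem isHomogeneous_psum (k : ℕ) : (psum σ ℝ k).IsHomogeneous k := by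
  rw [psum]
  refine IsHomogeneous.sum _ _ _ fun i _ => ?_
  simpa using (isHomogeneous_X ℝ i).pow k

theorem isSymmetric_homogeneousComponent {f : MvPolynomial σ ℝ} (hf : f.IsSymmetric) (n : ℕ) :
    (homogeneousComponent n f).IsSymmetric := by
  intro e
  rw [rename_homogeneousComponent, hf e]

theorem homogeneousComponent_psum_mul_mem (n k : ℕ) (hk : k ≠ 0) {g : MvPolynomial σ ℝ}
    (hg : g.IsSymmetric) : homogeneousComponent n (g * psum σ ℝ k) ∈ psumSpan σ n := by
  rw [mul_comm]
  nth_rw 1 [← sum_homogeneousComponent g]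
  rw [Finset.mul_sum, map_sum]
  refine Submodule.sum_mem _ fun i _ => ?_
  have h := (isHomogeneous_psum (σ := σ) k).mul (homogeneousComponent_isHomogeneous i g)
  rw [homogeneousComponent_of_mem h]
  split_ifs with hn
  · refine Submodule.subset_span ⟨k - 1, homogeneousComponent i g, by omega,
      isSymmetric_homogeneousComponent hg i, ?_, ?_⟩
    · convert homogeneousComponent_isHomogeneous i g using 1
      omega
    · rw [Nat.sub_add_cancel (by omega)]
  · exact Submodule.zero_mem _

/-- Newton's identity expresses `k e_k` through products `e_i p_{k-i}` with `i < k`, and `k` is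
invertible. -/
theorem homogeneousComponent_mul_esymm_mem (n k : ℕ) (hk : k ≠ 0) {g : MvPolynomial σ ℝ}
    (hg : g.IsSymmetric) : homogeneousComponent n (g * esymm σ ℝ k) ∈ psumSpan σ n := by
  have hk' : (k : ℝ) ≠ 0 := Nat.cast_ne_zero.2 hk
  have h1 : esymm σ ℝ k = (k : ℝ)⁻¹ • ((k : MvPolynomial σ ℝ) * esymm σ ℝ k) := by
    rw [← map_natCast (C : ℝ →+* MvPolynomial σ ℝ), ← smul_eq_C_mul, smul_smul,
      inv_mul_cancel₀ hk', one_smul]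
  rw [h1, mul_esymm_eq_sum, Finset.mul_sum, mul_smul_comm, Finset.mul_sum, map_smul, map_sum]
  refine Submodule.smul_mem _ _ (Submodule.sum_mem _ fun a ha => ?_)
  rw [Finset.mem_filter, Finset.HasAntidiagonal.mem_antidiagonal] at ha
  rw [← mul_assoc, ← mul_assoc, ← mul_assoc]
  refine homogeneousComponent_psum_mul_mem n a.2 (by omega) ?_
  have hsgn : ∀ r, ((-1 : MvPolynomial σ ℝ) ^ r).IsSymmetric := fun r e => by simp
  exact ((hg.mul (hsgn _)).mul (hsgn _)).mul (esymm_isSymmetric _ _ _)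

/-- A symmetric polynomial is a polynomial in the `e_k`. Every non-constant term carries some `e_k`,
hence by Newton a combination of multiples of power sums. This spanning property later yields
definiteness of the form. -/
theorem homogeneousComponent_mem_psumSpan {f : MvPolynomial σ ℝ} (hf : f.IsSymmetric) {n : ℕ}
    (hn : n ≠ 0) : homogeneousComponent n f ∈ psumSpan σ n := by
  obtain ⟨q, hq⟩ := esymmAlgHom_surjective ℝ (σ := σ) le_rfl ⟨f, hf⟩
  have hq' : f = (esymmAlgHom σ ℝ (Fintype.card σ) q : MvPolynomial σ ℝ) := by rw [hq]
  rw [hq']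
  clear hq hq' hf f
  induction q using MvPolynomial.induction_on with
  | C c =>
    have : (esymmAlgHom σ ℝ (Fintype.card σ) (C c) : MvPolynomial σ ℝ) = C c := by
      rw [← algebraMap_eq, AlgHom.commutes]
      rfl
    rw [this, homogeneousComponent_of_mem (isHomogeneous_C σ c), if_neg hn]
    exact Submodule.zero_mem _
  | add p q hp hq =>
    rw [map_add]
    change homogeneousComponent n ((_ : MvPolynomial σ ℝ) + _) ∈ _
    rw [map_add]
    exact Submodule.add_mem _ hp hq
  | mul_X p i hp =>
    rw [map_mul]
    change homogeneousComponent n ((_ : MvPolynomial σ ℝ) * _) ∈ _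
    have : (esymmAlgHom σ ℝ (Fintype.card σ) (X i) : MvPolynomial σ ℝ) = esymm σ ℝ (i + 1) := by
      rw [esymmAlgHom_apply, aeval_X]
    rw [this]
    exact homogeneousComponent_mul_esymm_mem n _ (Nat.succ_ne_zero _) (Subtype.property _)

end PowerSum

/-- A decomposition of the kernel in degree `n` as a positive combination of squares of symmetric
polynomials that span the symmetric polynomials of degree `n`. -/
structure SquareDecomp (N : ℕ) (α : ℝ) (n : ℕ) where
  ι : Type
  fin : Fintype ι
  w : ι → ℝ
  q : ι → MvPolynomial (Fin N) ℝ
  w_pos : ∀ t, 0 < w t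
  symm : ∀ t, (q t).IsSymmetric
  homog : ∀ t, (q t).IsHomogeneous n
  eq : kernelPart N α n = ∑ t, w t • tens (q t) (q t)
  span : ∀ f : MvPolynomial (Fin N) ℝ, f.IsSymmetric → f.IsHomogeneous n →
    f ∈ Submodule.span ℝ (Set.range q)

attribute [instance] SquareDecomp.fin

/-- In the Euler recursion, `p_k(x) p_k(y)` times a positive combination of squares is again one,
and `α > 0` keeps the weights positive. The `q` obtained are products of power sums, possibly
repeated; only spanning is required. -/
theorem nonempty_squareDecomp (N : ℕ) {α : ℝ} (hα : 0 < α) (n : ℕ) :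
    Nonempty (SquareDecomp N α n) := by
  induction n using Nat.strong_induction_on with
  | _ n ih =>
  rcases Nat.eq_zero_or_pos n with rfl | hn
  · refine ⟨⟨Unit, inferInstance, fun _ => 1, fun _ => 1, fun _ => one_pos,
      fun _ => IsSymmetric.one, fun _ => isHomogeneous_one _ _, ?_, ?_⟩⟩
    · rw [kernelPart_zero]
      simp [tens]
    · intro f _ hf
      rw [← totalDegree_zero_iff_isHomogeneous, totalDegree_eq_zero_iff_eq_C] at hf
      rw [hf, ← mul_one (C _), ← smul_eq_C_mul]
      exact Submodule.smul_mem _ _ (Submodule.subset_span ⟨(), rfl⟩)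
  have D : ∀ k : Fin n, SquareDecomp N α (n - 1 - k) := fun k => (ih _ (by omega)).some
  have hn' : (0 : ℝ) < n := Nat.cast_pos.2 hn
  refine ⟨⟨Σ k : Fin n, (D k).ι, inferInstance, fun t => (1 / α) / n * (D t.1).w t.2,
    fun t => psum (Fin N) ℝ (t.1 + 1) * (D t.1).q t.2, ?_, ?_, ?_, ?_, ?_⟩⟩
  · intro t
    have := (D t.1).w_pos t.2
    positivity
  · exact fun t => (psum_isSymmetric _ _ _).mul ((D t.1).symm t.2)
  · intro t
    convert (isHomogeneous_psum _).mul ((D t.1).homog t.2) using 1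
    have := t.1.2
    omega
  · have h := nat_smul_kernelPart N α n
    have h' : kernelPart N α n = (n : ℝ)⁻¹ • ((n : ℝ) • kernelPart N α n) := by
      rw [smul_smul, inv_mul_cancel₀ hn'.ne', one_smul]
    rw [h', h, Fintype.sum_sigma, Finset.sum_range, smul_smul, Finset.smul_sum]
    refine Finset.sum_congr rfl fun k _ => ?_
    rw [(D k).eq, Finset.mul_sum, Finset.smul_sum]
    refine Finset.sum_congr rfl fun t _ => ?_
    rw [tens_mul, mul_smul_comm, smul_smul]
    congr 1
    ring
  · intro f hf hfn
    have h := homogeneousComponent_mem_psumSpan hf hn.ne'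
    rw [homogeneousComponent_eq_self hfn] at h
    refine (Submodule.span_le.2 ?_) h
    rintro _ ⟨k, g, hk, hg, hgn, rfl⟩
    have hg' := (D ⟨k, hk⟩).span g hg hgn
    have h2 := Submodule.mem_map_of_mem (f := LinearMap.mulLeft ℝ (psum (Fin N) ℝ (k + 1))) hg'
    rw [Submodule.map_span] at h2
    refine Submodule.span_mono ?_ h2
    rintro _ ⟨_, ⟨t, rfl⟩, rfl⟩
    exact ⟨⟨⟨k, hk⟩, t⟩, rfl⟩

/-- A fixed decomposition of the kernel in degree `n`. -/
def squareDecomp (N : ℕ) {α : ℝ} (hα : 0 < α) (n : ℕ) : SquareDecomp N α n :=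
  (nonempty_squareDecomp N hα n).some

theorem coeff_kernel_eq_sum (N : ℕ) {α : ℝ} (hα : 0 < α) {n : ℕ} (β γ : Fin N →₀ ℕ)
    (hβ : β.degree = n) :
    MvPowerSeries.coeff (β.sumElim γ) (kernel N α) = ∑ t, (squareDecomp N hα n).w t *
      (coeff β ((squareDecomp N hα n).q t) * coeff γ ((squareDecomp N hα n).q t)) := by
  rw [coeff_kernel, hβ, (squareDecomp N hα n).eq, coeff_sum]
  simp only [coeff_smul, coeff_tens, smul_eq_mul]

/-- The power sums `∑_i D_i^m` of the Heckman–Dunkl operators. -/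
def powerDunkl (N : ℕ) (a : ℝ) (m : ℕ) : Module.End ℝ (MvPolynomial (Fin N) ℝ) :=
  ∑ i, dunklOne a i ^ m

/-- This is the coefficient of `x^β y^γ` in the intertwining identity, after inserting the square
decomposition. -/
theorem powerDunkl_adjoint (N : ℕ) {α : ℝ} (hα : 0 < α) (m n : ℕ) (β γ : Fin N →₀ ℕ) :
    ∑ t, (squareDecomp N hα n).w t *
      (coeff β (powerDunkl N (1 / α) m ((squareDecomp N hα n).q t)) *
        coeff γ ((squareDecomp N hα n).q t)) =
    ∑ t, (squareDecomp N hα n).w t *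
      (coeff β ((squareDecomp N hα n).q t) *
        coeff γ (powerDunkl N (1 / α) m ((squareDecomp N hα n).q t))) := by
  have h := congrArg (coeff (β.sumElim γ)) (sum_dunkl_pow_kernelPart N α m n)
  simp only [(squareDecomp N hα n).eq, map_sum, map_smul, dunkl_embX_pow_tens,
    dunkl_embY_pow_tens, coeff_sum, coeff_smul, coeff_tens, smul_eq_mul] at h
  simp only [powerDunkl, LinearMap.sum_apply, coeff_sum, Finset.sum_mul, Finset.mul_sum]
  rw [Finset.sum_comm, h, Finset.sum_comm]

end

section

open MvPolynomial

/-! ### Exponents and monomial symmetric polynomials -/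

variable {N : ℕ}

theorem PartLE.ext_parts {κ μ : PartLE N} (h : κ.1.2.parts = μ.1.2.parts) : κ = μ := by
  obtain ⟨⟨n, κ⟩, hκ⟩ := κ
  obtain ⟨⟨m, μ⟩, hμ⟩ := μ
  have hnm : n = m := by rw [← κ.parts_sum, ← μ.parts_sum]; exact congrArg _ h
  subst hnm
  have : κ = μ := Nat.Partition.ext h
  subst this
  rfl

/-- The modulus of a partition. -/
abbrev PartLE.size (κ : PartLE N) : ℕ := κ.1.1

/-- The partition formed by the non-zero exponents of a monomial. -/
def shape (β : Fin N →₀ ℕ) : PartLE N :=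
  ⟨⟨β.degree,
    { parts := β.support.val.map β
      parts_pos := by
        intro i hi
        obtain ⟨j, hj, rfl⟩ := Multiset.mem_map.1 hi
        exact Nat.pos_of_ne_zero (Finsupp.mem_support_iff.1 hj)
      parts_sum := rfl }⟩, by
    change Multiset.card (β.support.val.map β) ≤ N
    rw [Multiset.card_map]
    exact (Finset.card_le_univ β.support).trans_eq (Fintype.card_fin N)⟩

theorem shape_parts (β : Fin N →₀ ℕ) : (shape β).1.2.parts = β.support.val.map β := rfl

theorem shape_size (β : Fin N →₀ ℕ) : (shape β).size = β.degree := rfl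

theorem shape_parts_eq_filter (β : Fin N →₀ ℕ) :
    (shape β).1.2.parts = (Finset.univ.val.map β).filter (· ≠ 0) := by
  have : β.support = Finset.univ.filter (fun i => β i ≠ 0) := by
    ext
    simp
  rw [shape_parts, this, Finset.filter_val, Multiset.filter_map]
  rfl

/-- The shape forgets the zero exponents, but their number is recovered from the fixed total `N`. -/
theorem map_univ_eq_of_shape_eq {β γ : Fin N →₀ ℕ} (h : shape β = shape γ) :
    Finset.univ.val.map β = Finset.univ.val.map γ := by
  have h1 : (Finset.univ.val.map β).filter (· ≠ 0) = (Finset.univ.val.map γ).filter (· ≠ 0) := by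
    rw [← shape_parts_eq_filter, ← shape_parts_eq_filter, h]
  have h2 : ∀ δ : Fin N →₀ ℕ, (Finset.univ.val.map δ).filter (fun x => ¬ x ≠ 0) =
      Multiset.replicate (N - Multiset.card ((Finset.univ.val.map δ).filter (· ≠ 0))) 0 := by
    intro δ
    rw [Multiset.eq_replicate]
    constructor
    · have := congrArg Multiset.card (Multiset.filter_add_not (· ≠ 0) (Finset.univ.val.map δ))
      rw [Multiset.card_add, Multiset.card_map, Finset.card_val, Finset.card_univ,
        Fintype.card_fin] at this
      omega
    · intro b hb
      simpa using (Multiset.mem_filter.1 hb).2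
  rw [← Multiset.filter_add_not (· ≠ 0) (Finset.univ.val.map β), h2, h1, ← h2,
    Multiset.filter_add_not]

theorem exists_perm_of_map_eq {β γ : Fin N → ℕ}
    (h : Finset.univ.val.map β = Finset.univ.val.map γ) :
    ∃ e : Equiv.Perm (Fin N), γ = β ∘ e := by
  have key : β ∘ Tuple.sort β = γ ∘ Tuple.sort γ := by
    apply List.ofFn_injective
    apply List.Perm.eq_of_sortedLE (Tuple.monotone_sort β).sortedLE_ofFn
      (Tuple.monotone_sort γ).sortedLE_ofFn
    refine (Equiv.Perm.ofFn_comp_perm _ _).trans (List.Perm.trans ?_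
      (Equiv.Perm.ofFn_comp_perm _ _).symm)
    rw [Fin.univ_val_map, Fin.univ_val_map, Multiset.coe_eq_coe] at h
    exact h
  refine ⟨(Tuple.sort γ).symm.trans (Tuple.sort β), ?_⟩
  funext i
  have := congrFun key ((Tuple.sort γ).symm i)
  simpa using this.symm

theorem exists_perm_of_shape_eq {β γ : Fin N →₀ ℕ} (h : shape β = shape γ) :
    ∃ e : Equiv.Perm (Fin N), ∀ i, γ i = β (e i) := by
  obtain ⟨e, he⟩ := exists_perm_of_map_eq (map_univ_eq_of_shape_eq h)
  exact ⟨e, congrFun he⟩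

theorem shape_eq_of_perm {β γ : Fin N →₀ ℕ} (e : Equiv.Perm (Fin N)) (h : ∀ i, γ i = β (e i)) :
    shape γ = shape β := by
  apply PartLE.ext_parts
  rw [shape_parts_eq_filter, shape_parts_eq_filter]
  have : (⇑γ : Fin N → ℕ) = β ∘ e := funext h
  rw [this, ← Multiset.map_map, Multiset.map_univ_val_equiv]

/-- The `j`-th part of a partition, in non-increasing order, counted from `0`. -/
def part (κ : PartLE N) (j : ℕ) : ℕ := (κ.1.2.parts.sort (· ≥ ·)).getD j 0

theorem part_antitone (κ : PartLE N) : Antitone (part κ) := by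
  intro i j hij
  rcases hij.eq_or_lt with rfl | hij
  · exact le_rfl
  rw [part, part]
  have hs := Multiset.pairwise_sort κ.1.2.parts (· ≥ ·)
  by_cases hj : j < (κ.1.2.parts.sort (· ≥ ·)).length
  · rw [List.getD_eq_getElem _ _ hj, List.getD_eq_getElem _ _ (hij.trans hj)]
    exact List.pairwise_iff_getElem.1 hs i j _ _ hij
  · rw [List.getD_eq_default _ _ (not_lt.1 hj)]
    exact Nat.zero_le _

theorem partialSum_eq_sum_part (κ : PartLE N) (p : ℕ) :
    partialSum κ.1.2 p = ∑ j ∈ Finset.range p, part κ j := by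
  rw [partialSum]
  have : ∀ l : List ℕ, (l.take p).sum = ∑ j ∈ Finset.range p, l.getD j 0 := by
    induction p with
    | zero => simp
    | succ p ih =>
      intro l
      rcases l with _ | ⟨x, l⟩
      · simp
      · rw [List.take_succ_cons, List.sum_cons, ih, Finset.sum_range_succ']
        simp [add_comm]
  exact this _

/-- The exponent `(κ_1, …, κ_N)`. -/
def expo (κ : PartLE N) : Fin N →₀ ℕ := Finsupp.equivFunOnFinite.symm fun j => part κ j

theorem expo_apply (κ : PartLE N) (j : Fin N) : expo κ j = part κ j := rfl

@[simp] theorem shape_expo (κ : PartLE N) : shape (expo κ) = κ := by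
  apply PartLE.ext_parts
  rw [shape_parts_eq_filter, Fin.univ_val_map]
  have hl : (κ.1.2.parts.sort (· ≥ ·)).length ≤ N := by
    rw [Multiset.length_sort]
    exact κ.2
  have h1 : List.ofFn (expo κ) = κ.1.2.parts.sort (· ≥ ·) ++
      List.replicate (N - (κ.1.2.parts.sort (· ≥ ·)).length) 0 := by
    apply List.ext_getElem
    · simp only [List.length_ofFn, List.length_append, List.length_replicate]
      omega
    · intro i h1 h2
      rw [List.getElem_ofFn, expo_apply, part, List.getElem_append]
      split_ifs with h
      · exact List.getD_eq_getElem _ _ h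
      · rw [List.getElem_replicate]
        exact List.getD_eq_default _ _ (not_lt.1 h)
  rw [h1, ← Multiset.coe_add, Multiset.sort_eq, Multiset.filter_add,
    Multiset.filter_eq_self.2 fun a ha => (κ.1.2.parts_pos ha).ne', Multiset.filter_eq_nil.2,
    add_zero]
  intro a ha
  simpa using List.eq_of_mem_replicate ha

theorem degree_expo (κ : PartLE N) : (expo κ).degree = κ.size := by
  rw [← shape_size, shape_expo]

/-- `msymm` sums over multisets of variables whose multiplicities form `κ`; a multiset is the same
thing as an exponent, so each exponent of shape `κ` occurs exactly once. -/
theorem coeff_msym (κ : PartLE N) (β : Fin N →₀ ℕ) :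
    coeff β (msym N κ.1.2 : MvPolynomial (Fin N) ℝ) = if shape β = κ then 1 else 0 := by
  change coeff β (msymm (Fin N) ℝ κ.1.2) = _
  rw [msymm, coeff_sum]
  have h0 : ∀ s : Multiset (Fin N), (s.map (X : Fin N → MvPolynomial (Fin N) ℝ)).prod =
      monomial (Multiset.toFinsupp s) 1 := by
    intro s
    induction s using Multiset.induction_on with
    | empty => simp
    | cons i s ih =>
      rw [Multiset.map_cons, Multiset.prod_cons, ih, ← Multiset.singleton_add, map_add,
        Multiset.toFinsupp_singleton, X, monomial_mul, mul_one]
  simp only [h0, coeff_monomial]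
  have h1 : ∀ (s : Multiset (Fin N)), Multiset.toFinsupp s = β →
      s.dedup.map (fun a => s.count a) = (shape β).1.2.parts := by
    rintro s rfl
    rfl
  split_ifs with h
  · subst h
    have hc : Multiset.card (Finsupp.toMultiset β) = (shape β).1.1 := by
      rw [Finsupp.card_toMultiset]
      rfl
    let s0 : Sym (Fin N) (shape β).1.1 := ⟨Finsupp.toMultiset β, hc⟩
    have hs0 : Nat.Partition.ofSym s0 = (shape β).1.2 := by
      ext1
      exact h1 _ (Finsupp.toMultiset_toFinsupp β)
    rw [Finset.sum_eq_single ⟨s0, hs0⟩]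
    · rw [if_pos (Finsupp.toMultiset_toFinsupp β)]
    · rintro ⟨s, hs⟩ - hne
      rw [if_neg]
      rintro hsβ
      apply hne
      apply Subtype.ext
      apply Subtype.ext
      exact ((Multiset.toFinsupp_toMultiset _).symm.trans (congrArg _ hsβ) :)
    · exact fun hn => absurd (Finset.mem_univ _) hn
  · refine Finset.sum_eq_zero fun s _ => if_neg fun hs => h ?_
    apply PartLE.ext_parts
    exact (h1 _ hs).symm.trans (congrArg Nat.Partition.parts s.2)

/-- The coefficient of `m_κ` in a symmetric polynomial. -/
def cf (κ : PartLE N) : SymPoly N →ₗ[ℝ] ℝ :=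
  lcoeff ℝ (expo κ) ∘ₗ (symmetricSubalgebra (Fin N) ℝ).val.toLinearMap

theorem cf_apply (κ : PartLE N) (f : SymPoly N) :
    cf κ f = coeff (expo κ) (f : MvPolynomial (Fin N) ℝ) := rfl

theorem coeff_eq_of_shape_eq {f : MvPolynomial (Fin N) ℝ} (hf : f.IsSymmetric)
    {β γ : Fin N →₀ ℕ} (h : shape β = shape γ) : coeff β f = coeff γ f := by
  obtain ⟨e, he⟩ := exists_perm_of_shape_eq h
  have : β = γ.mapDomain e := by
    ext i
    obtain ⟨j, rfl⟩ := e.surjective i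
    rw [Finsupp.mapDomain_apply e.injective, he]
  rw [this, ← coeff_rename_mapDomain e e.injective f γ, hf e]

theorem coeff_eq_cf (f : SymPoly N) (β : Fin N →₀ ℕ) :
    coeff β (f : MvPolynomial (Fin N) ℝ) = cf (shape β) f :=
  coeff_eq_of_shape_eq f.2 (shape_expo _).symm

theorem cf_msym (κ μ : PartLE N) : cf κ (msym N μ.1.2) = if κ = μ then 1 else 0 := by
  rw [cf_apply, coeff_msym, shape_expo]

theorem symPoly_ext {f h : SymPoly N} (H : ∀ κ, cf κ f = cf κ h) : f = h := by
  apply Subtype.ext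
  ext β
  rw [coeff_eq_cf, coeff_eq_cf, H]

/-- The partitions `κ` for which `m_κ` occurs in a symmetric polynomial. -/
def cfSupport (f : SymPoly N) : Finset (PartLE N) := by
  classical exact (f : MvPolynomial (Fin N) ℝ).support.image shape

theorem mem_cfSupport {f : SymPoly N} {κ : PartLE N} : κ ∈ cfSupport f ↔ cf κ f ≠ 0 := by
  classical
  rw [cfSupport, Finset.mem_image]
  constructor
  · rintro ⟨β, hβ, rfl⟩
    rwa [← coeff_eq_cf, ← mem_support_iff]
  · intro h
    exact ⟨expo κ, mem_support_iff.2 h, shape_expo κ⟩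

theorem sum_cf_smul_msym (f : SymPoly N) :
    ∑ κ ∈ cfSupport f, cf κ f • msym N κ.1.2 = f := by
  classical
  refine symPoly_ext fun μ => ?_
  simp only [map_sum, map_smul, cf_msym, smul_eq_mul, mul_ite, mul_one, mul_zero]
  rw [Finset.sum_ite_eq, ite_eq_left_iff]
  intro h
  by_contra h'
  exact h (mem_cfSupport.2 (Ne.symm h'))

instance finite_size (n : ℕ) : Finite {κ : PartLE N // κ.size = n} := by
  refine Finite.of_injective (β := n.Partition) (fun κ => κ.2 ▸ κ.1.1.2) ?_
  rintro ⟨⟨⟨m, κ⟩, h1⟩, h2⟩ ⟨⟨⟨m', κ'⟩, h1'⟩, h2'⟩ h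
  dsimp [PartLE.size] at h2 h2'
  subst h2
  subst h2'
  dsimp at h
  subst h
  rfl

instance fintype_size (n : ℕ) : Fintype {κ : PartLE N // κ.size = n} := Fintype.ofFinite _

end

section

open MvPolynomial

/-! ### The polynomials `g_κ` and the form `⟨·,·⟩_g` -/

section Restrict

variable {σ : Type} [Fintype σ] [DecidableEq σ]

theorem dunkl_rename {τ : Type} [DecidableEq τ] (a : ℝ) (e : σ ↪ τ) (i : σ)
    (f : MvPolynomial σ ℝ) : dunkl a e i (rename e f) = rename e (dunklOne a i f) := by
  have h := dunkl_rename_mul a e (ρ := Empty) (fun x => x.elim) (fun _ x => x.elim) i f 1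
  rwa [map_one, mul_one, mul_one] at h

theorem dunkl_equiv (a : ℝ) (e : Equiv.Perm σ) (i : σ) :
    dunkl a e.toEmbedding i = dunklOne a (e i) := by
  rw [dunklOne, dunkl, dunkl]
  congr 2
  exact Equiv.sum_comp e (fun k => if h : e i ≠ k then divDiff (e i) k h else 0)

/-- A permutation of the variables permutes the `D_i` by conjugation; hence their power sums
preserve symmetric polynomials. -/
theorem rename_dunklOne_pow (a : ℝ) (e : Equiv.Perm σ) (i : σ) (m : ℕ) (f : MvPolynomial σ ℝ) :
    rename e ((dunklOne a i ^ m) f) = (dunklOne a (e i) ^ m) (rename e f) := by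
  induction m generalizing f with
  | zero => rfl
  | succ m ih =>
    rw [pow_succ, pow_succ, Module.End.mul_apply, Module.End.mul_apply, ih]
    congr 1
    rw [← dunkl_equiv]
    exact (dunkl_rename a e.toEmbedding i f).symm

end Restrict

variable {N : ℕ}

theorem isSymmetric_powerDunkl (a : ℝ) (m : ℕ) {f : MvPolynomial (Fin N) ℝ}
    (hf : f.IsSymmetric) : (powerDunkl N a m f).IsSymmetric := by
  intro e
  rw [powerDunkl, LinearMap.sum_apply, map_sum]
  simp only [rename_dunklOne_pow, hf e]
  exact Equiv.sum_comp e (fun i => (dunklOne a i ^ m) f)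

/-- The power sums of the Heckman–Dunkl operators on symmetric polynomials. -/
def powerSym (N : ℕ) (a : ℝ) (m : ℕ) : Module.End ℝ (SymPoly N) :=
  (powerDunkl N a m ∘ₗ (symmetricSubalgebra (Fin N) ℝ).val.toLinearMap).codRestrict
    (Subalgebra.toSubmodule (symmetricSubalgebra (Fin N) ℝ))
    (fun f => isSymmetric_powerDunkl a m f.2)

theorem coe_powerSym (a : ℝ) (m : ℕ) (f : SymPoly N) :
    (powerSym N a m f : MvPolynomial (Fin N) ℝ) = powerDunkl N a m f := rfl

theorem coeff_inX_mul_inY (f h : SymPoly N) (β γ : Fin N →₀ ℕ) :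
    MvPowerSeries.coeff (β.sumElim γ) (inX f * inY h) =
      coeff β (f : MvPolynomial (Fin N) ℝ) * coeff γ (h : MvPolynomial (Fin N) ℝ) := by
  rw [← coeff_tens, tens, inX, inY, ← MvPolynomial.coe_mul, MvPolynomial.coeff_coe]

variable {α : ℝ} (hα : 0 < α)

/-- The symmetric polynomials of the square decomposition of the kernel. -/
def qSym (N : ℕ) (n : ℕ) (t : (squareDecomp N hα n).ι) : SymPoly N :=
  ⟨(squareDecomp N hα n).q t, (squareDecomp N hα n).symm t⟩

theorem cf_qSym_eq_zero {n : ℕ} {κ : PartLE N} (h : κ.size ≠ n) (t : (squareDecomp N hα n).ι) :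
    cf κ (qSym hα N n t) = 0 :=
  ((squareDecomp N hα n).homog t).coeff_eq_zero (by rwa [degree_expo])

theorem kernel_symm (hα : 0 < α) (β γ : Fin N →₀ ℕ) : MvPowerSeries.coeff (β.sumElim γ) (kernel N α) =
    MvPowerSeries.coeff (γ.sumElim β) (kernel N α) := by
  by_cases h : β.degree = γ.degree
  · rw [coeff_kernel_eq_sum N hα β γ h, coeff_kernel_eq_sum N hα γ β rfl]
    refine Finset.sum_congr rfl fun t _ => ?_
    ring
  · rw [coeff_kernel_eq_zero N α h, coeff_kernel_eq_zero N α (Ne.symm h)]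

theorem kernel_eq_of_shape_eq (hα : 0 < α) {β γ γ' : Fin N →₀ ℕ} (h : shape γ = shape γ') :
    MvPowerSeries.coeff (β.sumElim γ) (kernel N α) =
      MvPowerSeries.coeff (β.sumElim γ') (kernel N α) := by
  rw [coeff_kernel_eq_sum N hα β γ rfl, coeff_kernel_eq_sum N hα β γ' rfl]
  refine Finset.sum_congr rfl fun t _ => ?_
  rw [coeff_eq_of_shape_eq ((squareDecomp N hα _).symm t) h]

/-- The symmetric polynomial `g_κ`. -/
def gPoly (N : ℕ) (κ : PartLE N) : SymPoly N :=
  ∑ t, ((squareDecomp N hα κ.size).w t * cf κ (qSym hα N κ.size t)) • qSym hα N κ.size t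

theorem coeff_sum_smul {ι : Type} (s : Finset ι) (c : ι → ℝ) (f : ι → SymPoly N)
    (β : Fin N →₀ ℕ) : coeff β ((∑ t ∈ s, c t • f t : SymPoly N) : MvPolynomial (Fin N) ℝ) =
      ∑ t ∈ s, c t * coeff β (f t : MvPolynomial (Fin N) ℝ) := by
  simp only [coeff_eq_cf, map_sum, map_smul, smul_eq_mul]

theorem coeff_gPoly (κ : PartLE N) (β : Fin N →₀ ℕ) :
    coeff β (gPoly hα N κ : MvPolynomial (Fin N) ℝ) =
      MvPowerSeries.coeff (β.sumElim (expo κ)) (kernel N α) := by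
  rw [kernel_symm hα, coeff_kernel_eq_sum N hα _ _ (degree_expo κ), gPoly, coeff_sum_smul]
  refine Finset.sum_congr rfl fun t _ => ?_
  rw [mul_assoc]
  rfl

theorem cf_gPoly_symm (κ μ : PartLE N) : cf κ (gPoly hα N μ) = cf μ (gPoly hα N κ) := by
  rw [cf_apply, cf_apply, coeff_gPoly, coeff_gPoly, kernel_symm hα]

theorem cf_gPoly_eq_zero {κ μ : PartLE N} (h : κ.size ≠ μ.size) : cf κ (gPoly hα N μ) = 0 := by
  rw [cf_apply, coeff_gPoly, coeff_kernel_eq_zero]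
  rwa [degree_expo, degree_expo]

theorem isGFamily_gPoly : IsGFamily N α (gPoly hα N) := by
  classical
  intro d
  obtain ⟨β, γ, rfl⟩ := exists_sumElim d
  simp only [coeff_inX_mul_inY, coeff_msym]
  rw [kernel_eq_of_shape_eq hα (shape_expo (shape γ)).symm, ← coeff_gPoly hα]
  convert hasSum_single (shape γ) ?_ using 1
  · rw [if_pos rfl, mul_one]
  · intro κ hκ
    rw [if_neg (Ne.symm hκ), mul_zero]

/-- At the exponent `expo κ` in `y` only `m_κ` contributes, so the family can be read off from the
kernel. -/
theorem coeff_of_isGFamily {g : PartLE N → SymPoly N} (hg : IsGFamily N α g) (κ : PartLE N)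
    (β : Fin N →₀ ℕ) : coeff β (g κ : MvPolynomial (Fin N) ℝ) =
      MvPowerSeries.coeff (β.sumElim (expo κ)) (kernel N α) := by
  have h := hg (β.sumElim (expo κ))
  simp only [coeff_inX_mul_inY, coeff_msym, shape_expo] at h
  have h2 := hasSum_single (f := fun μ : PartLE N =>
    coeff β (g μ : MvPolynomial (Fin N) ℝ) * if κ = μ then 1 else 0) κ (by
      intro μ hμ
      rw [if_neg (Ne.symm hμ), mul_zero])
  rw [if_pos rfl, mul_one] at h2
  exact h2.unique h

theorem eq_gPoly_of_isGFamily {g : PartLE N → SymPoly N} (hg : IsGFamily N α g) :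
    g = gPoly hα N := by
  funext κ
  refine symPoly_ext fun μ => ?_
  rw [cf_apply, cf_apply, coeff_of_isGFamily hg, coeff_gPoly]

/-- The linear combinations of the `g_κ`. -/
def gComb (N : ℕ) : (PartLE N →₀ ℝ) →ₗ[ℝ] SymPoly N := Finsupp.linearCombination ℝ (gPoly hα N)

/-- The linear combinations of the coordinates with respect to the `m_κ`. -/
def cfComb (N : ℕ) : (PartLE N →₀ ℝ) →ₗ[ℝ] (SymPoly N →ₗ[ℝ] ℝ) := Finsupp.linearCombination ℝ cf

theorem gComb_single (κ : PartLE N) : gComb hα N (Finsupp.single κ 1) = gPoly hα N κ := by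
  simp [gComb]

theorem cfComb_single (κ : PartLE N) : cfComb N (Finsupp.single κ 1) = cf κ := by
  simp [cfComb]

theorem cfComb_msym (x : PartLE N →₀ ℝ) (κ : PartLE N) : cfComb N x (msym N κ.1.2) = x κ := by
  classical
  rw [cfComb, Finsupp.linearCombination_apply, Finsupp.sum, LinearMap.sum_apply]
  simp only [LinearMap.smul_apply, cf_msym, smul_eq_mul, mul_ite, mul_one, mul_zero]
  rw [Finset.sum_ite_eq']
  simp [eq_comm]

/-- The added degrees contribute zero; a common index set lets `g_κ` of different sizes be combined.
-/
theorem gPoly_eq_sum_range (κ : PartLE N) {M : ℕ} (hM : κ.size < M) :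
    gPoly hα N κ = ∑ n ∈ Finset.range M, ∑ t,
      ((squareDecomp N hα n).w t * cf κ (qSym hα N n t)) • qSym hα N n t := by
  rw [Finset.sum_eq_single κ.size]
  · rfl
  · intro n _ hn
    refine Finset.sum_eq_zero fun t _ => ?_
    rw [cf_qSym_eq_zero hα (Ne.symm hn), mul_zero, zero_smul]
  · intro h
    exact absurd (Finset.mem_range.2 hM) h

theorem gComb_eq_sum_range (x : PartLE N →₀ ℝ) {M : ℕ} (hM : ∀ κ ∈ x.support, κ.size < M) :
    gComb hα N x = ∑ n ∈ Finset.range M, ∑ t,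
      ((squareDecomp N hα n).w t * cfComb N x (qSym hα N n t)) • qSym hα N n t := by
  rw [gComb, Finsupp.linearCombination_apply, Finsupp.sum, Finset.sum_congr rfl (fun κ hκ => by
    rw [gPoly_eq_sum_range hα κ (hM κ hκ), Finset.smul_sum]), Finset.sum_comm]
  refine Finset.sum_congr rfl fun n _ => ?_
  simp only [Finset.smul_sum]
  rw [Finset.sum_comm]
  refine Finset.sum_congr rfl fun t _ => ?_
  rw [cfComb, Finsupp.linearCombination_apply, Finsupp.sum, LinearMap.sum_apply, Finset.mul_sum,
    Finset.sum_smul]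
  refine Finset.sum_congr rfl fun κ _ => ?_
  rw [smul_smul, LinearMap.smul_apply, smul_eq_mul]
  congr 1
  ring

theorem exists_size_lt (s : Finset (PartLE N)) : ∃ M, ∀ κ ∈ s, κ.size < M :=
  ⟨s.sup PartLE.size + 1, fun _ hκ => Nat.lt_succ_of_le (Finset.le_sup (f := PartLE.size) hκ)⟩

theorem msym_mem_span_qSym (κ : PartLE N) :
    msym N κ.1.2 ∈ Submodule.span ℝ (Set.range (qSym hα N κ.size)) := by
  have hhom : (msym N κ.1.2 : MvPolynomial (Fin N) ℝ).IsHomogeneous κ.size := by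
    intro β hβ
    rw [coeff_msym] at hβ
    have : shape β = κ := by
      by_contra h
      exact hβ (if_neg h)
    rw [← this, shape_size, Finsupp.degree_eq_weight_one]
    rfl
  have h := (squareDecomp N hα κ.size).span _ (msym N κ.1.2).2 hhom
  have h2 : Set.range (squareDecomp N hα κ.size).q =
      (symmetricSubalgebra (Fin N) ℝ).val.toLinearMap '' Set.range (qSym hα N κ.size) := by
    rw [← Set.range_comp]
    rfl
  rw [h2, ← Submodule.map_span] at h
  obtain ⟨f, hf, hfe⟩ := h
  rwa [← (Subtype.ext hfe : f = msym N κ.1.2)]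

/-- The Gram matrix of the `g_κ` is `∑_t w_t q_t q_tᵀ` in monomial coordinates, so its quadratic
form is a weighted sum of squares. -/
theorem cfComb_gComb (x : PartLE N →₀ ℝ) {M : ℕ} (hM : ∀ κ ∈ x.support, κ.size < M) :
    cfComb N x (gComb hα N x) = ∑ n ∈ Finset.range M, ∑ t,
      (squareDecomp N hα n).w t * cfComb N x (qSym hα N n t) ^ 2 := by
  rw [gComb_eq_sum_range hα x hM, map_sum]
  refine Finset.sum_congr rfl fun n _ => ?_
  rw [map_sum]
  refine Finset.sum_congr rfl fun t _ => ?_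
  rw [map_smul, smul_eq_mul]
  ring

theorem cfComb_gComb_nonneg (x : PartLE N →₀ ℝ) : 0 ≤ cfComb N x (gComb hα N x) := by
  obtain ⟨M, hM⟩ := exists_size_lt x.support
  rw [cfComb_gComb hα x hM]
  exact Finset.sum_nonneg fun n _ => Finset.sum_nonneg fun t _ =>
    mul_nonneg ((squareDecomp N hα n).w_pos t).le (sq_nonneg _)

/-- If all squares vanish, the functional given by `x` kills every `q_t`; these span each degree, so
it kills every `m_κ`, on which it takes the values of `x`. -/
theorem eq_zero_of_cfComb_gComb {x : PartLE N →₀ ℝ} (h : cfComb N x (gComb hα N x) = 0) :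
    x = 0 := by
  obtain ⟨M, hM⟩ := exists_size_lt x.support
  rw [cfComb_gComb hα x hM] at h
  have hw : ∀ n (t : (squareDecomp N hα n).ι),
      0 ≤ (squareDecomp N hα n).w t * cfComb N x (qSym hα N n t) ^ 2 :=
    fun n t => mul_nonneg ((squareDecomp N hα n).w_pos t).le (sq_nonneg _)
  rw [Finset.sum_eq_zero_iff_of_nonneg fun n _ => Finset.sum_nonneg fun t _ => hw n t] at h
  ext κ
  by_contra hκ
  have hκM := hM κ (Finsupp.mem_support_iff.2 hκ)
  have h1 := h κ.size (Finset.mem_range.2 hκM)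
  rw [Finset.sum_eq_zero_iff_of_nonneg fun t _ => hw _ t] at h1
  have h2 : Submodule.span ℝ (Set.range (qSym hα N κ.size)) ≤ LinearMap.ker (cfComb N x) := by
    rw [Submodule.span_le]
    rintro _ ⟨t, rfl⟩
    rcases mul_eq_zero.1 (h1 t (Finset.mem_univ _)) with h3 | h3
    · exact absurd h3 ((squareDecomp N hα _).w_pos t).ne'
    · exact pow_eq_zero_iff two_ne_zero |>.1 h3
  apply hκ
  rw [← cfComb_msym x κ]
  exact h2 (msym_mem_span_qSym hα κ)

theorem gComb_injective : Function.Injective (gComb hα N) := by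
  rw [← LinearMap.ker_eq_bot, LinearMap.ker_eq_bot']
  intro x hx
  apply eq_zero_of_cfComb_gComb hα
  rw [hx, map_zero]

theorem msym_mem_range_gComb (κ : PartLE N) : msym N κ.1.2 ∈ LinearMap.range (gComb hα N) := by
  classical
  let I := {μ : PartLE N // μ.size = κ.size}
  let x : (I → ℝ) →ₗ[ℝ] (PartLE N →₀ ℝ) :=
    Fintype.linearCombination ℝ (fun μ : I => Finsupp.single μ.1 (1 : ℝ))
  have hx : ∀ y ν, x y ν = if h : ν.size = κ.size then y ⟨ν, h⟩ else 0 := by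
    intro y ν
    simp only [x, Fintype.linearCombination_apply, Finsupp.coe_finsetSum, Finset.sum_apply,
      Finsupp.smul_apply, Finsupp.single_apply, smul_eq_mul, mul_ite, mul_one, mul_zero]
    split_ifs with h
    · rw [Finset.sum_eq_single ⟨ν, h⟩]
      · rw [if_pos rfl]
      · intro μ _ hμ
        rw [if_neg fun e => hμ (Subtype.ext e)]
      · exact fun hn => absurd (Finset.mem_univ _) hn
    · refine Finset.sum_eq_zero fun μ _ => if_neg ?_
      rintro rfl
      exact h μ.2
  -- `T` is the Gram matrix in the single degree `κ.size`: a square matrix, so definiteness makes it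
  -- injective and hence surjective.
  let T : (I → ℝ) →ₗ[ℝ] (I → ℝ) := LinearMap.pi fun ν => cf ν.1 ∘ₗ gComb hα N ∘ₗ x
  have hT : Function.Injective T := by
    rw [← LinearMap.ker_eq_bot, LinearMap.ker_eq_bot']
    intro y hy
    have h0 : x y = 0 := by
      apply eq_zero_of_cfComb_gComb hα
      rw [cfComb, Finsupp.linearCombination_apply, Finsupp.sum, LinearMap.sum_apply]
      refine Finset.sum_eq_zero fun ν _ => ?_
      rw [LinearMap.smul_apply]
      by_cases h : ν.size = κ.size
      · have := congrFun hy ⟨ν, h⟩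
        change cf ν (gComb hα N (x y)) = 0 at this
        rw [this, smul_zero]
      · rw [hx, dif_neg h, zero_smul]
    funext ν
    have := hx y ν.1
    rw [h0, dif_pos ν.2] at this
    exact this.symm
  obtain ⟨y, hy⟩ := LinearMap.injective_iff_surjective.1 hT (Pi.single ⟨κ, rfl⟩ 1)
  refine ⟨x y, symPoly_ext fun ν => ?_⟩
  rw [cf_msym]
  by_cases h : ν.size = κ.size
  · have := congrFun hy ⟨ν, h⟩
    change cf ν (gComb hα N (x y)) = _ at this
    rw [this, Pi.single_apply]
    exact if_congr Subtype.ext_iff rfl rfl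
  · rw [if_neg (fun e => h (by rw [e])), gComb, Finsupp.linearCombination_apply, Finsupp.sum,
      map_sum]
    refine Finset.sum_eq_zero fun μ hμ => ?_
    rw [map_smul, cf_gPoly_eq_zero, smul_zero]
    intro e
    rw [Finsupp.mem_support_iff, hx] at hμ
    exact hμ (dif_neg (e ▸ h))

theorem gComb_surjective : Function.Surjective (gComb hα N) := by
  rw [← LinearMap.range_eq_top, eq_top_iff]
  intro f _
  rw [← sum_cf_smul_msym f]
  exact Submodule.sum_mem _ fun κ _ => Submodule.smul_mem _ _ (msym_mem_range_gComb hα κ)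

/-- The symmetric polynomials `g_κ` as a basis. -/
def gEquiv (N : ℕ) : (PartLE N →₀ ℝ) ≃ₗ[ℝ] SymPoly N :=
  LinearEquiv.ofBijective (gComb hα N) ⟨gComb_injective hα, gComb_surjective hα⟩

/-- The form `⟨·,·⟩_g`. -/
def gForm (N : ℕ) : SymPoly N →ₗ[ℝ] SymPoly N →ₗ[ℝ] ℝ :=
  cfComb N ∘ₗ (gEquiv hα N).symm.toLinearMap

theorem gForm_gComb (x : PartLE N →₀ ℝ) : gForm hα N (gComb hα N x) = cfComb N x := by
  rw [gForm, LinearMap.comp_apply]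
  congr 1
  exact (gEquiv hα N).symm_apply_apply x

theorem gForm_gPoly (κ : PartLE N) : gForm hα N (gPoly hα N κ) = cf κ := by
  rw [← gComb_single, gForm_gComb, cfComb_single]

theorem isGForm_gForm : IsGForm (gPoly hα N) (gForm hα N) := by
  intro μ κ
  rw [gForm_gPoly, cf_msym]

/-- A linear map on symmetric polynomials is determined by its values on the `g_κ`. -/
theorem hom_ext_gPoly {M : Type} [AddCommGroup M] [Module ℝ M] {A B : SymPoly N →ₗ[ℝ] M}
    (h : ∀ κ, A (gPoly hα N κ) = B (gPoly hα N κ)) : A = B := by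
  refine LinearMap.ext fun f => ?_
  obtain ⟨x, rfl⟩ := gComb_surjective hα f
  rw [gComb, Finsupp.linearCombination_apply, Finsupp.sum, map_sum, map_sum]
  simp only [map_smul, h]

theorem hom_ext_msym {M : Type} [AddCommGroup M] [Module ℝ M] {A B : SymPoly N →ₗ[ℝ] M}
    (h : ∀ κ : PartLE N, A (msym N κ.1.2) = B (msym N κ.1.2)) : A = B := by
  refine LinearMap.ext fun f => ?_
  rw [← sum_cf_smul_msym f, map_sum, map_sum]
  simp only [map_smul, h]

theorem eq_gForm_of_isGForm {B : SymPoly N →ₗ[ℝ] SymPoly N →ₗ[ℝ] ℝ}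
    (hB : IsGForm (gPoly hα N) B) : B = gForm hα N := by
  refine hom_ext_gPoly hα fun μ => hom_ext_msym fun κ => ?_
  rw [hB, isGForm_gForm]

theorem gForm_symm (f h : SymPoly N) : gForm hα N f h = gForm hα N h f := by
  have : gForm hα N = (gForm hα N).flip := by
    refine hom_ext_gPoly hα fun μ => hom_ext_gPoly hα fun κ => ?_
    rw [LinearMap.flip_apply, gForm_gPoly, gForm_gPoly, cf_gPoly_symm]
  exact LinearMap.congr_fun (LinearMap.congr_fun this f) h

theorem gForm_pos {f : SymPoly N} (hf : f ≠ 0) : 0 < gForm hα N f f := by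
  obtain ⟨x, rfl⟩ := gComb_surjective hα f
  rw [gForm_gComb]
  refine lt_of_le_of_ne (cfComb_gComb_nonneg hα x) fun h => hf ?_
  rw [eq_zero_of_cfComb_gComb hα h.symm, map_zero]

/-- It suffices to test on pairs `g_μ`, `g_κ`. Pairing with `g_μ` extracts a monomial coefficient,
so equal sizes reduce to `powerDunkl_adjoint`; for different sizes both sides vanish. -/
theorem gForm_powerSym (m : ℕ) (f h : SymPoly N) :
    gForm hα N (powerSym N (1 / α) m f) h = gForm hα N f (powerSym N (1 / α) m h) := by
  have key : gForm hα N ∘ₗ powerSym N (1 / α) m =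
      (gForm hα N).compl₂ (powerSym N (1 / α) m) := by
    refine hom_ext_gPoly hα fun μ => hom_ext_gPoly hα fun κ => ?_
    rw [LinearMap.comp_apply, LinearMap.compl₂_apply, gForm_symm, gForm_gPoly, gForm_gPoly]
    by_cases hs : μ.size = κ.size
    · rw [gPoly, gPoly, hs, map_sum, map_sum, map_sum, map_sum]
      simp only [map_smul, smul_eq_mul]
      have h := powerDunkl_adjoint N hα m κ.size (expo κ) (expo μ)
      refine Eq.trans ?_ (h.trans ?_)
      · refine Finset.sum_congr rfl fun t _ => ?_
        rw [mul_assoc, mul_comm (cf μ _)]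
        rfl
      · refine Finset.sum_congr rfl fun t _ => ?_
        rw [mul_assoc]
        rfl
    · have hz : ∀ κ μ : PartLE N, μ.size ≠ κ.size →
          cf μ (powerSym N (1 / α) m (gPoly hα N κ)) = 0 := by
        intro κ μ hs
        rw [gPoly, map_sum, map_sum]
        simp only [map_smul, smul_eq_mul]
        have h := powerDunkl_adjoint N hα m κ.size (expo κ) (expo μ)
        -- The adjointness identity moves the operator onto the other factor, exposing a coefficient
        -- of `q_t` in the wrong degree.
        refine Eq.trans (Eq.trans ?_ h.symm) (Finset.sum_eq_zero fun t _ => ?_)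
        · refine Finset.sum_congr rfl fun t _ => ?_
          rw [mul_assoc]
          rfl
        · have : coeff (expo μ) ((squareDecomp N hα κ.size).q t) = 0 := cf_qSym_eq_zero hα hs t
          rw [this, mul_zero, mul_zero]
      rw [hz κ μ hs, hz μ κ (Ne.symm hs)]
  exact LinearMap.congr_fun (LinearMap.congr_fun key f) h

end

section

open MvPolynomial

/-! ### Dominance order and triangularity -/

variable {N : ℕ}

/-- The weak dominance order. -/
def Dom (μ κ : PartLE N) : Prop :=
  μ.size = κ.size ∧ ∀ p, partialSum μ.1.2 p ≤ partialSum κ.1.2 p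

/-- The strict dominance order. -/
def SDom (μ κ : PartLE N) : Prop := μ ≠ κ ∧ Dom μ κ

theorem part_eq_zero_of_le (κ : PartLE N) {j : ℕ} (hj : N ≤ j) : part κ j = 0 := by
  rw [part, List.getD_eq_default]
  rw [Multiset.length_sort]
  exact κ.2.trans hj

theorem eq_of_part_eq {μ κ : PartLE N} (h : ∀ j, part μ j = part κ j) : μ = κ := by
  rw [← shape_expo μ, ← shape_expo κ]
  congr 1
  ext j
  exact h j

theorem Dom.antisymm {μ κ : PartLE N} (h : Dom μ κ) (h' : Dom κ μ) : μ = κ := by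
  apply eq_of_part_eq
  have key : ∀ p, ∑ j ∈ Finset.range p, part μ j = ∑ j ∈ Finset.range p, part κ j := by
    intro p
    rw [← partialSum_eq_sum_part, ← partialSum_eq_sum_part]
    exact le_antisymm (h.2 p) (h'.2 p)
  intro j
  have := key (j + 1)
  rw [Finset.sum_range_succ, Finset.sum_range_succ, key j] at this
  omega

theorem Dom.trans {μ κ ν : PartLE N} (h : Dom μ κ) (h' : Dom κ ν) : Dom μ ν :=
  ⟨h.1.trans h'.1, fun p => (h.2 p).trans (h'.2 p)⟩

theorem SDom.trans_dom {μ κ ν : PartLE N} (h : SDom μ κ) (h' : Dom κ ν) : SDom μ ν := by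
  refine ⟨?_, h.2.trans h'⟩
  rintro rfl
  exact h.1 (h.2.antisymm h')

theorem SDom.trans {μ κ ν : PartLE N} (h : SDom μ κ) (h' : SDom κ ν) : SDom μ ν :=
  h.trans_dom h'.2

theorem sum_le_sum_range_of_antitone {f : ℕ → ℕ} (hf : Antitone f) (p : ℕ) (S : Finset ℕ)
    (hS : S.card ≤ p) : ∑ j ∈ S, f j ≤ ∑ j ∈ Finset.range p, f j := by
  induction p generalizing S with
  | zero => simp [Finset.card_eq_zero.1 (Nat.le_zero.1 hS)]
  | succ p ih =>
    rw [Finset.sum_range_succ]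
    rcases hS.lt_or_eq with h | h
    · exact (ih S (Nat.lt_succ_iff.1 h)).trans (Nat.le_add_right _ _)
    · have hne : S.Nonempty := by
        rw [← Finset.card_pos]
        omega
      have hm := S.max'_mem hne
      rw [← Finset.sum_erase_add _ _ hm]
      refine add_le_add (ih _ ?_) (hf ?_)
      · rw [Finset.card_erase_of_mem hm]
        omega
      · have hsub : S ⊆ Finset.range (S.max' hne + 1) := fun j hj =>
          Finset.mem_range.2 (Nat.lt_succ_of_le (S.le_max' j hj))
        have := Finset.card_le_card hsub
        rw [Finset.card_range] at this
        omega

/-- Together with `exists_sum_eq_partialSum` this describes `κ_1 + ⋯ + κ_p` as the largest sum of at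
most `p` entries, so dominance of shapes can be checked without sorting. -/
theorem sum_le_partialSum (β : Fin N →₀ ℕ) (S : Finset (Fin N)) {p : ℕ} (hS : S.card ≤ p) :
    ∑ j ∈ S, β j ≤ partialSum (shape β).1.2 p := by
  obtain ⟨e, he⟩ := exists_perm_of_shape_eq (shape_expo (shape β))
  have h := sum_le_sum_range_of_antitone (part_antitone (shape β)) p
    ((S.map e.toEmbedding).map Fin.valEmbedding) (by rwa [Finset.card_map, Finset.card_map])
  rw [Finset.sum_map, Finset.sum_map] at h
  rw [partialSum_eq_sum_part]
  refine le_trans (le_of_eq ?_) h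
  exact Finset.sum_congr rfl fun j _ => he j

theorem exists_sum_eq_partialSum (β : Fin N →₀ ℕ) (p : ℕ) :
    ∃ S : Finset (Fin N), S.card ≤ p ∧ ∑ j ∈ S, β j = partialSum (shape β).1.2 p := by
  obtain ⟨e, he⟩ := exists_perm_of_shape_eq (β := β) (shape_expo (shape β)).symm
  have h1 : ∑ j ∈ Finset.univ.filter (fun j : Fin N => (j : ℕ) < p), expo (shape β) j =
      ∑ j ∈ Finset.range p, part (shape β) j := by
    rw [Finset.sum_filter]
    simp only [expo_apply]
    rw [Fin.sum_univ_eq_sum_range (fun j => if j < p then part (shape β) j else 0),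
      ← Finset.sum_filter]
    refine Finset.sum_subset (fun j hj => ?_) fun j hj hj' => ?_
    · exact Finset.mem_range.2 (Finset.mem_filter.1 hj).2
    · apply part_eq_zero_of_le
      by_contra h
      exact hj' (Finset.mem_filter.2 ⟨Finset.mem_range.2 (not_le.1 h), Finset.mem_range.1 hj⟩)
  refine ⟨(Finset.univ.filter (fun j : Fin N => (j : ℕ) < p)).map e.toEmbedding, ?_, ?_⟩
  · rw [Finset.card_map, ← Finset.card_map Fin.valEmbedding]
    refine (Finset.card_le_card (t := Finset.range p) fun j hj => ?_).trans_eq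
      (Finset.card_range p)
    obtain ⟨i, hi, rfl⟩ := Finset.mem_map.1 hj
    exact Finset.mem_range.2 (Finset.mem_filter.1 hi).2
  · rw [Finset.sum_map, partialSum_eq_sum_part, ← h1]
    exact Finset.sum_congr rfl fun j _ => (he j).symm

/-- Sums over sets containing both or neither of `i`, `k` do not change. A set containing one of
them is compared with the set in which that index is replaced by the one carrying the larger of `β
i` and `β k`. -/
theorem dom_of_move {β γ : Fin N →₀ ℕ} {i k : Fin N} (hik : i ≠ k)
    (hne : ∀ j, j ≠ i → j ≠ k → γ j = β j) (hsum : γ i + γ k = β i + β k)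
    (hi : γ i ≤ max (β i) (β k)) (hk : γ k ≤ max (β i) (β k)) : Dom (shape γ) (shape β) := by
  classical
  constructor
  · rw [shape_size, shape_size, Finsupp.degree_eq_sum, Finsupp.degree_eq_sum,
      ← Finset.add_sum_erase _ _ (Finset.mem_univ i),
      ← Finset.add_sum_erase _ (fun j => β j) (Finset.mem_univ i),
      ← Finset.add_sum_erase _ _ (Finset.mem_erase.2 ⟨hik.symm, Finset.mem_univ k⟩),
      ← Finset.add_sum_erase _ (fun j => β j) (Finset.mem_erase.2 ⟨hik.symm, Finset.mem_univ k⟩),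
      ← add_assoc, ← add_assoc, hsum]
    congr 1
    refine Finset.sum_congr rfl fun j hj => ?_
    rw [Finset.mem_erase, Finset.mem_erase] at hj
    exact hne j hj.2.1 hj.1
  · intro p
    obtain ⟨S, hS, hSp⟩ := exists_sum_eq_partialSum γ p
    rw [← hSp]
    have swap1 : ∀ (S : Finset (Fin N)) (i k : Fin N), i ≠ k → S.card ≤ p → i ∈ S → k ∉ S →
        (∀ j, j ≠ i → j ≠ k → γ j = β j) → γ i ≤ max (β i) (β k) →
        ∑ j ∈ S, γ j ≤ partialSum (shape β).1.2 p := by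
      intro S i k hik hS hiS hkS hne hi
      rw [← Finset.add_sum_erase _ _ hiS]
      have h1 : ∑ j ∈ S.erase i, γ j = ∑ j ∈ S.erase i, β j := by
        refine Finset.sum_congr rfl fun j hj => ?_
        rw [Finset.mem_erase] at hj
        exact hne j hj.1 (fun e => hkS (e ▸ hj.2))
      rw [h1]
      rcases le_total (β i) (β k) with h | h
      · rw [max_eq_right h] at hi
        refine (add_le_add_left hi _).trans ?_
        rw [← Finset.sum_insert (f := β) (fun h => hkS (Finset.mem_of_mem_erase h))]
        refine sum_le_partialSum β _ ?_
        rwa [Finset.card_insert_of_notMem (fun h => hkS (Finset.mem_of_mem_erase h)),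
          Finset.card_erase_add_one hiS]
      · rw [max_eq_left h] at hi
        refine (add_le_add_left hi _).trans ?_
        rw [Finset.add_sum_erase _ _ hiS]
        exact sum_le_partialSum β _ hS
    by_cases hiS : i ∈ S
    · by_cases hkS : k ∈ S
      · refine le_trans (le_of_eq ?_) (sum_le_partialSum β S hS)
        rw [← Finset.add_sum_erase _ _ hiS, ← Finset.add_sum_erase _ (fun j => β j) hiS,
          ← Finset.add_sum_erase _ _ (Finset.mem_erase.2 ⟨hik.symm, hkS⟩),
          ← Finset.add_sum_erase _ (fun j => β j) (Finset.mem_erase.2 ⟨hik.symm, hkS⟩),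
          ← add_assoc, ← add_assoc, hsum]
        congr 1
        refine Finset.sum_congr rfl fun j hj => ?_
        rw [Finset.mem_erase, Finset.mem_erase] at hj
        exact hne j hj.2.1 hj.1
      · exact swap1 S i k hik hS hiS hkS hne hi
    · by_cases hkS : k ∈ S
      · exact swap1 S k i hik.symm hS hkS hiS (fun j h h' => hne j h' h) (max_comm (β i) _ ▸ hk)
      · refine le_trans (le_of_eq ?_) (sum_le_partialSum β S hS)
        refine Finset.sum_congr rfl fun j hj => hne j ?_ ?_
        · rintro rfl
          exact hiS hj
        · rintro rfl
          exact hkS hj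

theorem sum_comp_of_shape_eq {M : Type} [AddCommMonoid M] {β γ : Fin N →₀ ℕ}
    (h : shape β = shape γ) (φ : ℕ → M) : ∑ j, φ (β j) = ∑ j, φ (γ j) := by
  obtain ⟨e, he⟩ := exists_perm_of_shape_eq h
  simp only [he]
  exact (Equiv.sum_comp e (fun j => φ (β j))).symm

/-- The sum of the squares of the entries depends only on the shape, and it strictly drops when the
two entries move closer with fixed sum. -/
theorem sdom_of_move {β γ : Fin N →₀ ℕ} {i k : Fin N} (hik : i ≠ k)
    (hne : ∀ j, j ≠ i → j ≠ k → γ j = β j) (hsum : γ i + γ k = β i + β k)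
    (hi : γ i < max (β i) (β k)) (hk : γ k < max (β i) (β k)) : SDom (shape γ) (shape β) := by
  refine ⟨fun h => ?_, dom_of_move hik hne hsum hi.le hk.le⟩
  have h1 := sum_comp_of_shape_eq h (fun x => x ^ 2)
  rw [← Finset.add_sum_erase _ _ (Finset.mem_univ i),
      ← Finset.add_sum_erase _ (fun j => β j ^ 2) (Finset.mem_univ i),
      ← Finset.add_sum_erase _ _ (Finset.mem_erase.2 ⟨hik.symm, Finset.mem_univ k⟩),
      ← Finset.add_sum_erase _ (fun j => β j ^ 2)
        (Finset.mem_erase.2 ⟨hik.symm, Finset.mem_univ k⟩), ← add_assoc, ← add_assoc,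
      Finset.sum_congr rfl (g := fun j => β j ^ 2) (fun j hj => by
        rw [Finset.mem_erase, Finset.mem_erase] at hj
        rw [hne j hj.2.1 hj.1])] at h1
  have h2 := Nat.add_right_cancel h1
  clear h1
  zify at h2 hsum
  rcases le_total (β i) (β k) with h | h
  · rw [max_eq_right h] at hi hk
    zify at hi hk
    nlinarith [mul_pos (sub_pos.2 hi) (sub_pos.2 hk)]
  · rw [max_eq_left h] at hi hk
    zify at hi hk
    nlinarith [mul_pos (sub_pos.2 hi) (sub_pos.2 hk)]

/-- The polynomials all of whose monomials are strictly dominated by `κ`. -/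
def lower (κ : PartLE N) : Submodule ℝ (MvPolynomial (Fin N) ℝ) :=
  restrictSupport ℝ {β | SDom (shape β) κ}

theorem monomial_mem_lower {κ : PartLE N} {β : Fin N →₀ ℕ} (h : SDom (shape β) κ) (c : ℝ) :
    monomial β c ∈ lower κ := by
  intro γ hγ
  have := support_monomial_subset hγ
  rw [Finset.mem_singleton] at this
  rw [this]
  exact h

theorem lower_mono {κ μ : PartLE N} (h : Dom κ μ) : lower κ ≤ lower μ :=
  fun _ hf _ hβ => (hf hβ).trans_dom h

theorem coeff_eq_zero_of_mem_lower {κ : PartLE N} {f : MvPolynomial (Fin N) ℝ} (hf : f ∈ lower κ)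
    {β : Fin N →₀ ℕ} (h : ¬ SDom (shape β) κ) : coeff β f = 0 := by
  by_contra h'
  exact h (hf (mem_support_iff.2 h'))

/-- The exponent with the entries at `i` and `k` replaced. -/
def replaceTwo (β : Fin N →₀ ℕ) (i k : Fin N) (u v : ℕ) : Fin N →₀ ℕ :=
  (β.update i u).update k v

theorem replaceTwo_left (β : Fin N →₀ ℕ) {i k : Fin N} (h : i ≠ k) (u v : ℕ) :
    replaceTwo β i k u v i = u := by
  simp [replaceTwo, Finsupp.update_apply, h]

theorem replaceTwo_right (β : Fin N →₀ ℕ) (i k : Fin N) (u v : ℕ) :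
    replaceTwo β i k u v k = v := by
  simp [replaceTwo, Finsupp.update_apply]

theorem replaceTwo_of_ne (β : Fin N →₀ ℕ) {i k j : Fin N} (hi : j ≠ i) (hk : j ≠ k) (u v : ℕ) :
    replaceTwo β i k u v j = β j := by
  simp [replaceTwo, Finsupp.update_apply, hi, hk]

theorem replaceTwo_self (β : Fin N →₀ ℕ) (i k : Fin N) : replaceTwo β i k (β i) (β k) = β := by
  simp [replaceTwo]

theorem monomial_replaceTwo (β : Fin N →₀ ℕ) {i k : Fin N} (h : i ≠ k) (u v : ℕ) (c : ℝ) :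
    monomial (replaceTwo β i k u v) c = monomial (replaceTwo β i k 0 0) c * (X i ^ u * X k ^ v) := by
  rw [X_pow_eq_monomial, X_pow_eq_monomial, monomial_mul, monomial_mul, mul_one, mul_one]
  congr 2
  ext j
  rw [Finsupp.add_apply, Finsupp.add_apply]
  rcases eq_or_ne j i with rfl | hi
  · simp [replaceTwo_left, h]
  rcases eq_or_ne j k with rfl | hk
  · simp [replaceTwo_right, h]
  · simp [replaceTwo_of_ne, hi, hk]

theorem swapVar_monomial (i k : Fin N) (β : Fin N →₀ ℕ) (c : ℝ) :
    swapVar i k (monomial β c) = monomial (β.mapDomain (Equiv.swap i k)) c :=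
  rename_monomial _ _ _

theorem mapDomain_swap_apply (i k : Fin N) (β : Fin N →₀ ℕ) (j : Fin N) :
    β.mapDomain (Equiv.swap i k) j = β (Equiv.swap i k j) := by
  conv_lhs => rw [← Equiv.swap_apply_self i k j]
  rw [Finsupp.mapDomain_apply (Equiv.injective _)]

theorem shape_mapDomain_swap (i k : Fin N) (β : Fin N →₀ ℕ) :
    shape (β.mapDomain (Equiv.swap i k)) = shape β :=
  shape_eq_of_perm (Equiv.swap i k) (mapDomain_swap_apply i k β)

/-- The part of the monomial without `X i` and `X k` is fixed by the swap and factors out; the rest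
is a geometric sum. -/
theorem divDiff_monomial_of_le {β : Fin N →₀ ℕ} {i k : Fin N} (h : i ≠ k) (hle : β k ≤ β i)
    (c : ℝ) : divDiff i k h (monomial β c) = ∑ r ∈ Finset.range (β i - β k),
      monomial (replaceTwo β i k (β k + 1 + r) (β i - 1 - r)) c := by
  have hw : swapVar i k (monomial (replaceTwo β i k 0 0) c) =
      monomial (replaceTwo β i k 0 0) c := by
    rw [swapVar_monomial]
    congr 2
    ext j
    rw [mapDomain_swap_apply]
    rcases eq_or_ne j i with rfl | hi
    · rw [Equiv.swap_apply_left, replaceTwo_right, replaceTwo_left _ h]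
    rcases eq_or_ne j k with rfl | hk
    · rw [Equiv.swap_apply_right, replaceTwo_right, replaceTwo_left _ h]
    · rw [Equiv.swap_apply_of_ne_of_ne hi hk]
  obtain ⟨m, hm⟩ := Nat.exists_eq_add_of_le hle
  conv_lhs => rw [← replaceTwo_self β i k]
  rw [monomial_replaceTwo β h, mul_comm, divDiff_mul_of_invariant _ _ _ hw, mul_comm]
  have h1 : ∀ r ∈ Finset.range (β i - β k),
      monomial (replaceTwo β i k (β k + 1 + r) (β i - 1 - r)) c =
        monomial (replaceTwo β i k 0 0) c *
          (X i ^ (β k + 1) * X k ^ β k * (X i ^ r * X k ^ (m - 1 - r))) := by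
    intro r hr
    rw [Finset.mem_range] at hr
    rw [monomial_replaceTwo β h]
    congr 1
    have : β i - 1 - r = β k + (m - 1 - r) := by omega
    rw [this, pow_add, pow_add (X k)]
    ring
  rw [Finset.sum_congr rfl h1, ← Finset.mul_sum, ← Finset.mul_sum]
  congr 1
  apply divDiff_eq
  have hg := (Commute.all (X i : MvPolynomial (Fin N) ℝ) (X k)).geom_sum₂_mul m
  have hm' : β i - β k = m := by omega
  rw [hm', map_mul, map_pow, map_pow, swapVar_X, swapVar_X, Equiv.swap_apply_left,
    Equiv.swap_apply_right, hm, pow_add, pow_add]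
  linear_combination (X i ^ (β k + 1) * X k ^ β k) * hg

/-- The last term of the geometric sum is `x^β` itself; in all others both entries lie strictly
below `β i`, so their shapes are strictly dominated. -/
theorem divDiff_monomial_of_lt {β : Fin N →₀ ℕ} {i k : Fin N} (h : i ≠ k) (hlt : β k < β i)
    (c : ℝ) : divDiff i k h (monomial β c) - monomial β c ∈ lower (shape β) := by
  rw [divDiff_monomial_of_le h hlt.le]
  obtain ⟨m, hm⟩ := Nat.exists_eq_add_of_lt hlt
  have hm' : β i - β k = m + 1 := by omega
  have h1 : replaceTwo β i k (β k + 1 + m) (β i - 1 - m) = β := by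
    have e1 : β k + 1 + m = β i := by omega
    have e2 : β i - 1 - m = β k := by omega
    rw [e2, e1, replaceTwo_self]
  rw [hm', Finset.sum_range_succ, h1, add_sub_cancel_right]
  refine Submodule.sum_mem _ fun r hr => monomial_mem_lower ?_ c
  rw [Finset.mem_range] at hr
  refine sdom_of_move h (fun j hi hk => replaceTwo_of_ne β hi hk _ _) ?_ ?_ ?_
  · rw [replaceTwo_left _ h, replaceTwo_right]
    omega
  · rw [replaceTwo_left _ h, max_eq_left hlt.le]
    omega
  · rw [replaceTwo_right, max_eq_left hlt.le]
    omega

theorem divDiff_monomial_of_eq {β : Fin N →₀ ℕ} {i k : Fin N} (h : i ≠ k) (he : β k = β i)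
    (c : ℝ) : divDiff i k h (monomial β c) = 0 := by
  rw [divDiff_monomial_of_le h he.le, he, Nat.sub_self, Finset.sum_range_zero]

/-- This antisymmetry reduces the case `β i < β k` to the opposite one. -/
theorem divDiff_swapVar {τ : Type} [DecidableEq τ] {i k : τ} (h : i ≠ k) (f : MvPolynomial τ ℝ) :
    divDiff i k h (swapVar i k f) = - divDiff i k h f := by
  apply divDiff_eq
  have h1 : swapVar i k (swapVar i k f) = f := by
    rw [swapVar, rename_rename]
    convert rename_id_apply f
    funext j
    simp
  rw [h1, mul_neg, X_sub_X_mul_divDiff]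
  ring

theorem divDiff_monomial_of_gt {β : Fin N →₀ ℕ} {i k : Fin N} (h : i ≠ k) (hlt : β i < β k)
    (c : ℝ) : divDiff i k h (monomial β c) + monomial (β.mapDomain (Equiv.swap i k)) c ∈
      lower (shape β) := by
  have h1 := divDiff_monomial_of_lt (β := β.mapDomain (Equiv.swap i k)) h (by
    rw [mapDomain_swap_apply, mapDomain_swap_apply, Equiv.swap_apply_left,
      Equiv.swap_apply_right]
    exact hlt) c
  rw [← swapVar_monomial, divDiff_swapVar, shape_mapDomain_swap] at h1
  rw [← swapVar_monomial]
  convert Submodule.neg_mem _ h1 using 1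
  ring

/-- The leading part of `D_i x^β`. -/
theorem dunklOne_monomial (a : ℝ) (i : Fin N) (β : Fin N →₀ ℕ) (c : ℝ) :
    dunklOne a i (monomial β c) - ((β i : ℝ) • monomial β c + a • ∑ k,
      ((if β k < β i then monomial β c else 0) -
        (if β i < β k then monomial (β.mapDomain (Equiv.swap i k)) c else 0))) ∈
      lower (shape β) := by
  have he : euler i (monomial β c) = (β i : ℝ) • monomial β c := by
    rw [euler_apply, X_mul_pderiv_monomial, Nat.cast_smul_eq_nsmul]
  rw [dunklOne, dunkl_apply]
  simp only [Function.Embedding.refl_apply]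
  rw [he, add_sub_add_left_eq_sub, ← smul_sub, ← Finset.sum_sub_distrib]
  refine Submodule.smul_mem _ _ (Submodule.sum_mem _ fun k _ => ?_)
  by_cases hik : i = k
  · subst hik
    simp
  · rw [dif_pos hik]
    rcases lt_trichotomy (β k) (β i) with h | h | h
    · rw [if_pos h, if_neg (not_lt.2 h.le), sub_zero]
      exact divDiff_monomial_of_lt hik h c
    · rw [divDiff_monomial_of_eq hik h, if_neg (by omega), if_neg (by omega)]
      simp
    · rw [if_neg (not_lt.2 h.le), if_pos h, zero_sub, sub_neg_eq_add]
      exact divDiff_monomial_of_gt hik h c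

theorem dunklOne_mem_lower (a : ℝ) (i : Fin N) {κ : PartLE N} {f : MvPolynomial (Fin N) ℝ}
    (hf : f ∈ lower κ) : dunklOne a i f ∈ lower κ := by
  rw [f.as_sum, map_sum]
  refine Submodule.sum_mem _ fun β hβ => ?_
  have hβκ : SDom (shape β) κ := hf hβ
  rw [← sub_add_cancel (dunklOne a i (monomial β (coeff β f)))]
  refine Submodule.add_mem _ (lower_mono hβκ.2 (dunklOne_monomial a i β _)) ?_
  refine Submodule.add_mem _ (Submodule.smul_mem _ _ (monomial_mem_lower hβκ _))
    (Submodule.smul_mem _ _ (Submodule.sum_mem _ fun k _ => Submodule.sub_mem _ ?_ ?_))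
  · split_ifs
    · exact monomial_mem_lower hβκ _
    · exact Submodule.zero_mem _
  · split_ifs
    · refine monomial_mem_lower ?_ _
      rwa [shape_mapDomain_swap]
    · exact Submodule.zero_mem _

/-- The exponents of shape `κ`. -/
def orbit (κ : PartLE N) : Finset (Fin N →₀ ℕ) := (msym N κ.1.2 : MvPolynomial (Fin N) ℝ).support

theorem mem_orbit {κ : PartLE N} {β : Fin N →₀ ℕ} : β ∈ orbit κ ↔ shape β = κ := by
  rw [orbit, mem_support_iff, coeff_msym]
  simp

/-- The polynomial `∑_β h(β_i) x^β`, the sum over the exponents of shape `κ`. -/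
def orbitSum (κ : PartLE N) (i : Fin N) (h : ℕ → ℝ) : MvPolynomial (Fin N) ℝ :=
  ∑ β ∈ orbit κ, monomial β (h (β i))

/-- The action of `D_i` on the leading coefficients. -/
def leadOp (a : ℝ) (κ : PartLE N) (h : ℕ → ℝ) (v : ℕ) : ℝ :=
  v * h v + a * ∑ k, if expo κ k < v then h v - h (expo κ k) else 0

/-- Modulo lower terms, `D_i` preserves the combinations of `x^β` of shape `κ` whose coefficients
depend only on `β i`. Hence powers of `D_i` on `m_κ` are governed by iterating `leadOp` on functions
of one integer. -/
theorem dunklOne_orbitSum (a : ℝ) (κ : PartLE N) (i : Fin N) (h : ℕ → ℝ) :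
    dunklOne a i (orbitSum κ i h) - orbitSum κ i (leadOp a κ h) ∈ lower κ := by
  have key : orbitSum κ i (leadOp a κ h) = ∑ β ∈ orbit κ,
      ((β i : ℝ) • monomial β (h (β i)) + a • ∑ k,
        ((if β k < β i then monomial β (h (β i)) else 0) -
        (if β i < β k then monomial (β.mapDomain (Equiv.swap i k)) (h (β i)) else 0))) := by
    -- Reindexing the orbit by the swap turns each swapped monomial into `x^β` with coefficient `h
    -- (β k)`.
    have h2 : ∀ k, (∑ β ∈ orbit κ, if β i < β k then
        monomial (β.mapDomain (Equiv.swap i k)) (h (β i)) else 0) =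
        ∑ β ∈ orbit κ, if β k < β i then monomial β (h (β k)) else 0 := by
      intro k
      refine Finset.sum_bij' (fun β _ => β.mapDomain (Equiv.swap i k))
        (fun β _ => β.mapDomain (Equiv.swap i k)) ?_ ?_ ?_ ?_ ?_
      · intro β hβ
        rw [mem_orbit, shape_mapDomain_swap]
        exact mem_orbit.1 hβ
      · intro β hβ
        rw [mem_orbit, shape_mapDomain_swap]
        exact mem_orbit.1 hβ
      · intro β _
        ext j
        rw [mapDomain_swap_apply, mapDomain_swap_apply, Equiv.swap_apply_self]
      · intro β _
        ext j
        rw [mapDomain_swap_apply, mapDomain_swap_apply, Equiv.swap_apply_self]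
      · intro β _
        rw [mapDomain_swap_apply, mapDomain_swap_apply, Equiv.swap_apply_left,
          Equiv.swap_apply_right]
    simp only [Finset.sum_sub_distrib, Finset.sum_add_distrib, ← Finset.smul_sum]
    rw [Finset.sum_comm (s := orbit κ), Finset.sum_comm (s := orbit κ)]
    simp only [h2]
    rw [← Finset.sum_sub_distrib, Finset.smul_sum]
    simp only [← Finset.sum_sub_distrib]
    simp only [Finset.smul_sum]
    rw [Finset.sum_comm, ← Finset.sum_add_distrib, orbitSum]
    refine Finset.sum_congr rfl fun β hβ => ?_
    rw [leadOp, sum_comp_of_shape_eq (β := expo κ) (γ := β)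
      (by rw [shape_expo, mem_orbit.1 hβ]) (fun x => if x < β i then h (β i) - h x else 0),
      map_add, ← smul_eq_mul, ← smul_eq_mul, Finset.smul_sum, map_sum, smul_monomial]
    congr 1
    refine Finset.sum_congr rfl fun k _ => ?_
    split_ifs
    · rw [smul_eq_mul, ← smul_eq_mul, ← smul_monomial, map_sub]
    · simp
  rw [key, orbitSum, map_sum, ← Finset.sum_sub_distrib]
  refine Submodule.sum_mem _ fun β hβ => ?_
  have := dunklOne_monomial a i β (h (β i))
  rwa [mem_orbit.1 hβ] at this

theorem msym_eq_orbitSum (κ : PartLE N) (i : Fin N) :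
    (msym N κ.1.2 : MvPolynomial (Fin N) ℝ) = orbitSum κ i (fun _ => 1) := by
  rw [orbitSum, (msym N κ.1.2 : MvPolynomial (Fin N) ℝ).as_sum]
  refine Finset.sum_congr rfl fun β hβ => ?_
  rw [coeff_msym, if_pos (mem_orbit.1 hβ)]

theorem dunklOne_pow_msym (a : ℝ) (κ : PartLE N) (i : Fin N) (m : ℕ) :
    (dunklOne a i ^ m) (msym N κ.1.2 : MvPolynomial (Fin N) ℝ) -
      orbitSum κ i ((leadOp a κ)^[m] fun _ => 1) ∈ lower κ := by
  induction m with
  | zero => rw [pow_zero, Module.End.one_apply, msym_eq_orbitSum κ i]; simp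
  | succ m ih =>
    rw [pow_succ', Module.End.mul_apply, Function.iterate_succ_apply']
    have h1 := dunklOne_mem_lower a i ih
    have h2 := dunklOne_orbitSum a κ i ((leadOp a κ)^[m] fun _ => 1)
    rw [map_sub] at h1
    convert Submodule.add_mem _ h1 h2 using 1
    abel

/-- The eigenvalue of `∑_i D_i^m` with leading term `m_κ`. -/
def eig (a : ℝ) (m : ℕ) (κ : PartLE N) : ℝ :=
  ∑ i, ((leadOp a κ)^[m] fun _ => 1) (expo κ i)

theorem coeff_orbitSum (κ : PartLE N) (i : Fin N) (h : ℕ → ℝ) (β : Fin N →₀ ℕ) :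
    coeff β (orbitSum κ i h) = if shape β = κ then h (β i) else 0 := by
  rw [orbitSum, coeff_sum]
  simp only [coeff_monomial]
  rw [Finset.sum_ite_eq']
  simp only [mem_orbit]

theorem cf_powerSym_msym (a : ℝ) (m : ℕ) (κ μ : PartLE N) (h : ¬ SDom μ κ) :
    cf μ (powerSym N a m (msym N κ.1.2)) = if μ = κ then eig a m κ else 0 := by
  rw [cf_apply, coe_powerSym, powerDunkl, LinearMap.sum_apply, coeff_sum]
  have h1 : ∀ i, coeff (expo μ) ((dunklOne a i ^ m) (msym N κ.1.2 : MvPolynomial (Fin N) ℝ)) =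
      if μ = κ then ((leadOp a κ)^[m] fun _ => 1) (expo μ i) else 0 := by
    intro i
    have h2 := coeff_eq_zero_of_mem_lower (dunklOne_pow_msym a κ i m) (β := expo μ)
      (by rwa [shape_expo])
    rw [coeff_sub, coeff_orbitSum, shape_expo, sub_eq_zero] at h2
    exact h2
  simp only [h1]
  split_ifs with h3
  · rw [eig, h3]
  · simp

end

section

/-! ### The eigenvalues -/

variable {N : ℕ}

/-! ### Cancellation in products of shifted linear factors -/

section Separation

open Polynomial

/-- If the largest roots differed, say `b' J < b J`, evaluating at `1/(b J + a)` would make one side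
zero and all factors of the other positive. So the largest agree, their factors cancel, and
induction applies. -/
theorem prod_one_sub_injective {a : ℝ} (ha : 0 < a) (J : ℕ) {b b' : ℕ → ℝ} (hb : Monotone b)
    (hb' : Monotone b') (h0 : ∀ j, 0 ≤ b j) (h0' : ∀ j, 0 ≤ b' j)
    (h : (∏ j ∈ Finset.range J, (1 - C (b j) * X)) *
        ∏ j ∈ Finset.range J, (1 - C (b' j + a) * X) =
      (∏ j ∈ Finset.range J, (1 - C (b' j) * X)) *
        ∏ j ∈ Finset.range J, (1 - C (b j + a) * X)) :
    ∀ j < J, b j = b' j := by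
  induction J with
  | zero => intro j hj; omega
  | succ J ih =>
    have aux : ∀ {b b' : ℕ → ℝ}, Monotone b → Monotone b' → (∀ j, 0 ≤ b j) →
        ((∏ j ∈ Finset.range (J + 1), (1 - C (b j) * X)) *
          ∏ j ∈ Finset.range (J + 1), (1 - C (b' j + a) * X) =
        (∏ j ∈ Finset.range (J + 1), (1 - C (b' j) * X)) *
          ∏ j ∈ Finset.range (J + 1), (1 - C (b j + a) * X)) → ¬ b' J < b J := by
      intro b b' hb hb' h0 h hlt
      have hpos : 0 < b J + a := add_pos_of_nonneg_of_pos (h0 J) ha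
      have h1 := congrArg (Polynomial.eval (b J + a)⁻¹) h
      simp only [eval_mul, eval_prod, eval_sub, eval_one, eval_C, eval_X] at h1
      have h2 : ∏ j ∈ Finset.range (J + 1), (1 - (b j + a) * (b J + a)⁻¹) = 0 := by
        refine Finset.prod_eq_zero (Finset.self_mem_range_succ J) ?_
        rw [mul_inv_cancel₀ hpos.ne', sub_self]
      have h3 : ∀ x, x < b J + a → 0 < 1 - x * (b J + a)⁻¹ := by
        intro x hx
        rw [sub_pos, ← div_eq_mul_inv, div_lt_one hpos]
        exact hx
      have h4 : 0 < ∏ j ∈ Finset.range (J + 1), (1 - b j * (b J + a)⁻¹) := by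
        refine Finset.prod_pos fun j hj => h3 _ ?_
        have := hb (Nat.lt_succ_iff.1 (Finset.mem_range.1 hj))
        linarith
      have h5 : 0 < ∏ j ∈ Finset.range (J + 1), (1 - (b' j + a) * (b J + a)⁻¹) := by
        refine Finset.prod_pos fun j hj => h3 _ ?_
        have := hb' (Nat.lt_succ_iff.1 (Finset.mem_range.1 hj))
        linarith
      rw [h2, mul_zero] at h1
      exact (mul_pos h4 h5).ne' h1
    have hJ : b J = b' J := le_antisymm (not_lt.1 (aux hb hb' h0 h))
      (not_lt.1 (aux hb' hb h0' h.symm))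
    have hne : ∀ x : ℝ, (1 - C x * X : ℝ[X]) ≠ 0 := by
      intro x hx
      simpa using congrArg (Polynomial.eval 0) hx
    have h' := h
    rw [Finset.prod_range_succ, Finset.prod_range_succ, Finset.prod_range_succ,
      Finset.prod_range_succ, hJ] at h'
    have key := ih (by
      apply mul_right_cancel₀ (mul_ne_zero (hne (b' J)) (hne (b' J + a)))
      linear_combination h')
    intro j hj
    rcases (Nat.lt_succ_iff.1 hj).lt_or_eq with hj | rfl
    · exact key j hj
    · exact hJ

end Separation

/-- The parts of a partition, in non-decreasing order, padded with zeros. -/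
def ascPart (κ : PartLE N) (j : ℕ) : ℕ := part κ (N - 1 - j)

theorem ascPart_monotone (κ : PartLE N) : Monotone (ascPart κ) := by
  intro i j hij
  exact part_antitone κ (by omega)

theorem sum_expo_eq_sum_ascPart {M : Type} [AddCommMonoid M] (κ : PartLE N) (φ : ℕ → M) :
    ∑ i, φ (expo κ i) = ∑ j ∈ Finset.range N, φ (ascPart κ j) := by
  simp only [expo_apply]
  rw [Fin.sum_univ_eq_sum_range (fun j => φ (part κ j)), ← Finset.sum_range_reflect]
  rfl

/-- In non-decreasing order the condition on smaller parts becomes `k < j`, ties contributing zero;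
the operator is then triangular. -/
theorem leadOp_ascPart (a : ℝ) (κ : PartLE N) (h : ℕ → ℝ) {j : ℕ} (hj : j < N) :
    leadOp a κ h (ascPart κ j) = ascPart κ j * h (ascPart κ j) +
      a * ∑ k ∈ Finset.range j, (h (ascPart κ j) - h (ascPart κ k)) := by
  rw [leadOp, sum_expo_eq_sum_ascPart κ
    (fun x => if x < ascPart κ j then h (ascPart κ j) - h x else 0)]
  congr 2
  have h1 : Finset.range j = (Finset.range N).filter (· < j) := by
    ext k
    simp only [Finset.mem_range, Finset.mem_filter]
    omega
  rw [h1, Finset.sum_filter]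
  refine Finset.sum_congr rfl fun k _ => ?_
  by_cases hk : k < j
  · rw [if_pos hk]
    rcases (ascPart_monotone κ hk.le).lt_or_eq with h2 | h2
    · rw [if_pos h2]
    · rw [h2, if_neg (lt_irrefl _), sub_self]
  · rw [if_neg hk, if_neg (not_lt.2 (ascPart_monotone κ (not_lt.1 hk)))]

/-! ### Generating function of the eigenvalues -/

section GeneratingFunction

open PowerSeries

/-- The generating function of the leading coefficients. -/
def leadSeries (a : ℝ) (κ : PartLE N) (j : ℕ) : PowerSeries ℝ :=
  PowerSeries.mk fun m => ((leadOp a κ)^[m] fun _ => 1) (ascPart κ j)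

theorem leadSeries_eq (a : ℝ) (κ : PartLE N) {j : ℕ} (hj : j < N) :
    leadSeries a κ j = 1 + X * (C (ascPart κ j : ℝ) * leadSeries a κ j +
      C a * ∑ k ∈ Finset.range j, (leadSeries a κ j - leadSeries a κ k)) := by
  ext m
  rcases m with _ | m
  · simp [leadSeries]
  · rw [map_add, coeff_succ_X_mul, map_add, coeff_C_mul, coeff_C_mul, map_sum, coeff_one,
      if_neg (Nat.succ_ne_zero m), zero_add, leadSeries, coeff_mk, coeff_mk,
      Function.iterate_succ_apply', leadOp_ascPart a κ _ hj]
    simp only [leadSeries, map_sub, coeff_mk]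

/-- Write `H_J` for the series, `S_J` for the sum of the first `J` and `κ_j` for the ascending
parts. The recursion says `(1 - (κ_J + aJ)X) H_J = 1 - aX S_J`, so `1 - aX S_{J+1}` is `1 - aX S_J`
times `(1 - (κ_J + aJ + a)X)/(1 - (κ_J + aJ)X)`, and the product telescopes. -/
theorem prod_leadSeries (a : ℝ) (κ : PartLE N) {J : ℕ} (hJ : J ≤ N) :
    (1 - C a * X * ∑ k ∈ Finset.range J, leadSeries a κ k) *
      ∏ j ∈ Finset.range J, (1 - C (ascPart κ j + a * j : ℝ) * X) =
      ∏ j ∈ Finset.range J, (1 - C (ascPart κ j + a * j + a : ℝ) * X) := by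
  induction J with
  | zero => simp
  | succ J ih =>
    have h1 := leadSeries_eq a κ (Nat.lt_of_succ_le hJ)
    have h2 := ih (Nat.le_of_succ_le hJ)
    rw [Finset.sum_sub_distrib, Finset.sum_const, Finset.card_range, nsmul_eq_mul] at h1
    rw [Finset.prod_range_succ, Finset.prod_range_succ, ← h2, Finset.sum_range_succ]
    simp only [map_add, map_mul, map_natCast] at h1 ⊢
    generalize leadSeries a κ J = H at *
    generalize (∑ k ∈ Finset.range J, leadSeries a κ k) = S at *
    linear_combination (-(C a * X *
      ∏ j ∈ Finset.range J, (1 - ((ascPart κ j : PowerSeries ℝ) + C a * (j : PowerSeries ℝ)) * X))) * h1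

theorem sum_leadSeries (a : ℝ) (κ : PartLE N) :
    ∑ k ∈ Finset.range N, leadSeries a κ k = PowerSeries.mk fun m => eig a m κ := by
  ext m
  rw [map_sum, coeff_mk, eig, sum_expo_eq_sum_ascPart]
  simp only [leadSeries, coeff_mk]

/-- The eigenvalues of the operators `∑_i D_i^m` separate the partitions. -/
theorem eq_of_eig_eq {a : ℝ} (ha : 0 < a) {κ μ : PartLE N} (h : ∀ m, eig a m κ = eig a m μ) :
    κ = μ := by
  have h1 := prod_leadSeries a κ le_rfl
  have h2 := prod_leadSeries a μ le_rfl
  rw [sum_leadSeries] at h1 h2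
  simp only [← h] at h2
  have hne : (1 - C a * X * (PowerSeries.mk fun m => eig a m κ)) ≠ 0 := by
    intro h0
    simpa using congrArg constantCoeff h0
  have hb : ∀ ν : PartLE N, Monotone fun j : ℕ => (ascPart ν j + a * j : ℝ) := by
    intro ν i j hij
    have e1 : (ascPart ν i : ℝ) ≤ ascPart ν j := by exact_mod_cast ascPart_monotone ν hij
    have e2 : (i : ℝ) ≤ j := by exact_mod_cast hij
    dsimp only
    nlinarith
  -- Both product formulas share the factor `1 - aX ∑ eig X^m`, which is cancelled; the compared
  -- numbers are `κ_j + a j`.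
  have key := prod_one_sub_injective ha N (hb κ) (hb μ) (fun j => by positivity)
    (fun j => by positivity) (by
      apply Polynomial.coe_injective
      have hcoe : ∀ x : ℕ → ℝ, ((∏ j ∈ Finset.range N, (1 - Polynomial.C (x j) * Polynomial.X) :
          Polynomial ℝ) : PowerSeries ℝ) = ∏ j ∈ Finset.range N, (1 - C (x j) * X) := by
        intro x
        rw [← Polynomial.coeToPowerSeries.ringHom_apply, map_prod]
        simp
      rw [Polynomial.coe_mul, Polynomial.coe_mul, hcoe, hcoe, hcoe, hcoe]
      apply mul_left_cancel₀ hne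
      rw [← mul_assoc, h1, ← mul_assoc, h2, mul_comm])
  apply eq_of_part_eq
  intro j
  by_cases hj : j < N
  · have h3 := key (N - 1 - j) (by omega)
    have h4 := Nat.cast_injective (R := ℝ) (add_right_cancel h3)
    rw [ascPart, ascPart] at h4
    convert h4 using 2 <;> omega
  · rw [part_eq_zero_of_le κ (not_lt.1 hj), part_eq_zero_of_le μ (not_lt.1 hj)]

end GeneratingFunction

/-! ### Monotonicity of the second eigenvalue in dominance order -/

section Monotone

theorem sum_sum_sub_eq (f : ℕ → ℝ) (n : ℕ) :
    ∑ i ∈ Finset.range n, ∑ k ∈ Finset.range n, (if i < k then f i - f k else 0) =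
      2 * ∑ p ∈ Finset.range n, ∑ j ∈ Finset.range p, f j -
        (n - 1) * ∑ j ∈ Finset.range n, f j := by
  induction n with
  | zero => simp
  | succ n ih =>
    have h1 : ∀ i ∈ Finset.range n,
        ∑ k ∈ Finset.range (n + 1), (if i < k then f i - f k else 0) =
        ∑ k ∈ Finset.range n, (if i < k then f i - f k else 0) + (f i - f n) := by
      intro i hi
      rw [Finset.sum_range_succ, if_pos (Finset.mem_range.1 hi)]
    have h2 : ∑ k ∈ Finset.range (n + 1), (if n < k then f n - f k else 0) = 0 := by
      refine Finset.sum_eq_zero fun k hk => if_neg ?_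
      rw [Finset.mem_range] at hk
      omega
    rw [Finset.sum_range_succ, h2, Finset.sum_congr rfl h1, Finset.sum_add_distrib, ih,
      Finset.sum_sub_distrib, Finset.sum_const, Finset.card_range, Finset.sum_range_succ _ n,
      Finset.sum_range_succ _ n, nsmul_eq_mul]
    push_cast
    ring

/-- Rewriting the sum of differences of parts through partial sums makes the dependence on dominance
visible. -/
theorem eig_two (a : ℝ) (κ : PartLE N) :
    eig a 2 κ = ∑ j ∈ Finset.range N, (part κ j : ℝ) ^ 2 +
      a * (2 * ∑ p ∈ Finset.range N, (partialSum κ.1.2 p : ℝ) -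
        (N - 1) * (partialSum κ.1.2 N : ℝ)) := by
  have h1 : ((leadOp a κ)^[2] fun _ => 1) = fun v : ℕ =>
      (v : ℝ) ^ 2 + a * ∑ k, if expo κ k < v then (v : ℝ) - expo κ k else 0 := by
    funext v
    have h2 : leadOp a κ (fun _ => 1) = fun v : ℕ => (v : ℝ) := by
      funext v
      simp [leadOp]
    change leadOp a κ (leadOp a κ fun _ => 1) v = _
    rw [h2, leadOp, sq]
  rw [eig, h1, Finset.sum_add_distrib, ← Finset.mul_sum]
  simp only [expo_apply]
  rw [Fin.sum_univ_eq_sum_range (fun j => (part κ j : ℝ) ^ 2)]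
  congr 2
  have h3 : ∀ φ : ℕ → ℕ → ℝ, ∑ i : Fin N, ∑ k : Fin N, φ i k =
      ∑ i ∈ Finset.range N, ∑ k ∈ Finset.range N, φ i k := by
    intro φ
    simp only [Finset.sum_range]
  refine (h3 fun i k => if part κ k < part κ i then (part κ i : ℝ) - part κ k else 0).trans ?_
  simp only [partialSum_eq_sum_part, Nat.cast_sum]
  rw [← sum_sum_sub_eq]
  refine Finset.sum_congr rfl fun i _ => Finset.sum_congr rfl fun k _ => ?_
  by_cases h : part κ k < part κ i
  · rw [if_pos h, if_pos]
    by_contra hik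
    exact absurd (part_antitone κ (not_lt.1 hik)) (not_le.2 h)
  · rw [if_neg h]
    split_ifs with hik
    · rw [le_antisymm (not_lt.1 h) (part_antitone κ hik.le), sub_self]
    · rfl

/-- Summation by parts: non-negative partial sums against a decreasing weight. -/
theorem sum_mul_nonneg_of_antitone {d g : ℕ → ℝ} (hg : Antitone g)
    (hd : ∀ p, 0 ≤ ∑ j ∈ Finset.range p, d j) (n : ℕ) :
    (∑ j ∈ Finset.range n, d j) * g n ≤ ∑ j ∈ Finset.range n, d j * g j := by
  induction n with
  | zero => simp
  | succ n ih =>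
    have h1 := mul_le_mul_of_nonneg_left (hg (Nat.le_succ n)) (hd (n + 1))
    rw [Finset.sum_range_succ] at h1
    rw [Finset.sum_range_succ, Finset.sum_range_succ]
    nlinarith

theorem partialSum_eq_size (κ : PartLE N) : partialSum κ.1.2 N = κ.size := by
  rw [← degree_expo, Finsupp.degree_eq_sum, partialSum_eq_sum_part]
  exact (Fin.sum_univ_eq_sum_range (part κ) N).symm

/-- The total of the partial sums strictly increases, since otherwise all of them would agree; the
sum of squares weakly increases. -/
theorem eig_two_lt {a : ℝ} (ha : 0 < a) {μ κ : PartLE N} (h : SDom μ κ) :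
    eig a 2 μ < eig a 2 κ := by
  rw [eig_two, eig_two, partialSum_eq_size, partialSum_eq_size, h.2.1]
  have hle : ∀ p, (partialSum μ.1.2 p : ℝ) ≤ partialSum κ.1.2 p :=
    fun p => by exact_mod_cast h.2.2 p
  have h1 : ∑ p ∈ Finset.range N, (partialSum μ.1.2 p : ℝ) <
      ∑ p ∈ Finset.range N, (partialSum κ.1.2 p : ℝ) := by
    refine Finset.sum_lt_sum (fun p _ => hle p) ?_
    by_contra hc
    push Not at hc
    have heq : ∀ p ≤ N, partialSum κ.1.2 p = partialSum μ.1.2 p := by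
      intro p hp
      rcases hp.lt_or_eq with hp | rfl
      · have := hc p (Finset.mem_range.2 hp)
        exact le_antisymm (by exact_mod_cast this) (h.2.2 p)
      · rw [partialSum_eq_size, partialSum_eq_size, h.2.1]
    apply h.1
    apply eq_of_part_eq
    intro j
    by_cases hj : j < N
    · have e1 := heq (j + 1) hj
      have e2 := heq j hj.le
      rw [partialSum_eq_sum_part, partialSum_eq_sum_part] at e1 e2
      rw [Finset.sum_range_succ, Finset.sum_range_succ] at e1
      omega
    · rw [part_eq_zero_of_le κ (not_lt.1 hj), part_eq_zero_of_le μ (not_lt.1 hj)]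
  have h2 : ∑ j ∈ Finset.range N, (part μ j : ℝ) ^ 2 ≤
      ∑ j ∈ Finset.range N, (part κ j : ℝ) ^ 2 := by
    -- The difference of the sums of squares is `∑ (κ_j - μ_j)(κ_j + μ_j)`, to which summation by
    -- parts applies.
    have hg : Antitone fun j => (part κ j + part μ j : ℝ) := by
      intro i j hij
      have e1 : (part κ j : ℝ) ≤ part κ i := by exact_mod_cast part_antitone κ hij
      have e2 : (part μ j : ℝ) ≤ part μ i := by exact_mod_cast part_antitone μ hij
      dsimp only
      linarith
    have hd : ∀ p, 0 ≤ ∑ j ∈ Finset.range p, (part κ j - part μ j : ℝ) := by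
      intro p
      have := hle p
      rw [partialSum_eq_sum_part, partialSum_eq_sum_part] at this
      push_cast at this
      rw [Finset.sum_sub_distrib]
      linarith
    have h3 := sum_mul_nonneg_of_antitone hg hd N
    have h4 : 0 ≤ (∑ j ∈ Finset.range N, (part κ j - part μ j : ℝ)) *
        (part κ N + part μ N : ℝ) := mul_nonneg (hd N) (by positivity)
    have h5 : ∑ j ∈ Finset.range N, (part κ j - part μ j : ℝ) * (part κ j + part μ j) =
        ∑ j ∈ Finset.range N, (part κ j : ℝ) ^ 2 - ∑ j ∈ Finset.range N, (part μ j : ℝ) ^ 2 := by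
      rw [← Finset.sum_sub_distrib]
      exact Finset.sum_congr rfl fun j _ => by ring
    linarith
  nlinarith [mul_lt_mul_of_pos_left h1 ha]

end Monotone

end

section

open MvPolynomial

/-! ### Existence, uniqueness and orthogonality of the Jack polynomials -/

variable {N : ℕ}

/-- The symmetric polynomials in the span of the `m_μ` with `μ < κ`. -/
def lowSym (κ : PartLE N) : Submodule ℝ (SymPoly N) where
  carrier := {f | ∀ μ, cf μ f ≠ 0 → SDom μ κ}
  zero_mem' := fun μ h => absurd (map_zero _) h
  add_mem' := by
    intro f g hf hg μ h
    by_cases hfμ : cf μ f = 0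
    · apply hg
      rwa [map_add, hfμ, zero_add] at h
    · exact hf μ hfμ
  smul_mem' := by
    intro c f hf μ h
    apply hf
    rw [map_smul] at h
    exact right_ne_zero_of_mul h

theorem cf_eq_zero_of_mem_lowSym {κ μ : PartLE N} {f : SymPoly N} (hf : f ∈ lowSym κ)
    (h : ¬ SDom μ κ) : cf μ f = 0 := by
  by_contra h'
  exact h (hf μ h')

theorem msym_mem_lowSym {κ μ : PartLE N} (h : SDom μ κ) : msym N μ.1.2 ∈ lowSym κ := by
  intro ν hν
  rw [cf_msym] at hν
  have : ν = μ := by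
    by_contra h'
    exact hν (if_neg h')
  rwa [this]

theorem lowSym_le {κ μ : PartLE N} (h : SDom μ κ) : lowSym μ ≤ lowSym κ :=
  fun _ hf ν hν => (hf ν hν).trans h

theorem powerSym_msym_sub_mem (a : ℝ) (m : ℕ) (κ : PartLE N) :
    powerSym N a m (msym N κ.1.2) - eig a m κ • msym N κ.1.2 ∈ lowSym κ := by
  intro μ hμ
  by_contra h
  rw [map_sub, cf_powerSym_msym a m κ μ h, map_smul, cf_msym] at hμ
  apply hμ
  split_ifs <;> simp

theorem powerSym_mem_lowSym (a : ℝ) (m : ℕ) {κ : PartLE N} {f : SymPoly N} (hf : f ∈ lowSym κ) :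
    powerSym N a m f ∈ lowSym κ := by
  rw [← sum_cf_smul_msym f, map_sum]
  refine Submodule.sum_mem _ fun μ hμ => ?_
  have hμκ : SDom μ κ := hf μ (mem_cfSupport.1 hμ)
  rw [map_smul]
  refine Submodule.smul_mem _ _ ?_
  rw [← sub_add_cancel (powerSym N a m (msym N μ.1.2)) (eig a m μ • msym N μ.1.2)]
  exact Submodule.add_mem _ (lowSym_le hμκ (powerSym_msym_sub_mem a m μ))
    (Submodule.smul_mem _ _ (msym_mem_lowSym hμκ))

instance finiteDimensional_lowSym (κ : PartLE N) : FiniteDimensional ℝ (lowSym κ) := by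
  have hle : lowSym κ ≤ Submodule.span ℝ
      (Set.range fun μ : {μ : PartLE N // μ.size = κ.size} => msym N μ.1.1.2) := by
    intro f hf
    rw [← sum_cf_smul_msym f]
    refine Submodule.sum_mem _ fun μ hμ => Submodule.smul_mem _ _ (Submodule.subset_span ?_)
    exact ⟨⟨μ, (hf μ (mem_cfSupport.1 hμ)).2.1⟩, rfl⟩
  have := FiniteDimensional.span_of_finite ℝ
    (Set.finite_range fun μ : {μ : PartLE N // μ.size = κ.size} => msym N μ.1.1.2)
  exact Submodule.finiteDimensional_of_le hle

variable {α : ℝ} (hα : 0 < α)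

theorem exists_dual_eq {V : Type} [AddCommGroup V] [Module ℝ V] [FiniteDimensional ℝ V]
    (T : V →ₗ[ℝ] Module.Dual ℝ V) (hT : ∀ v, v ≠ 0 → T v v ≠ 0) (φ : Module.Dual ℝ V) :
    ∃ v, T v = φ := by
  refine (LinearMap.injective_iff_surjective_of_finrank_eq_finrank
    (Subspace.dual_finrank_eq (K := ℝ) (V := V)).symm).1 ?_ φ
  refine (injective_iff_map_eq_zero T).2 fun w hw => ?_
  by_contra h
  exact hT w h (by rw [hw, LinearMap.zero_apply])

/-- An anisotropic form stays non-degenerate on a finite-dimensional subspace, so orthogonal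
projection works though the whole space may be infinite-dimensional. -/
theorem exists_projection {V : Type} [AddCommGroup V] [Module ℝ V] (B : V →ₗ[ℝ] V →ₗ[ℝ] ℝ)
    (hB : ∀ v, v ≠ 0 → B v v ≠ 0) (W : Submodule ℝ V) [FiniteDimensional ℝ W] (f : V) :
    ∃ w ∈ W, ∀ w' ∈ W, B (f - w) w' = 0 := by
  obtain ⟨w, hw⟩ := exists_dual_eq (V := W) (B.compl₁₂ W.subtype W.subtype)
    (fun w hw => hB w (fun e => hw (Subtype.ext e))) (B f ∘ₗ W.subtype)
  refine ⟨w, w.2, fun w' hw' => ?_⟩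
  have h : B w w' = B f w' := LinearMap.congr_fun hw ⟨w', hw'⟩
  rw [map_sub, LinearMap.sub_apply, h, sub_self]

include hα in
/-- There is a joint eigenfunction of the operators `∑_i D_i^m` with leading term `m_κ`. -/
theorem exists_jointEigen (κ : PartLE N) : ∃ P : SymPoly N, P - msym N κ.1.2 ∈ lowSym κ ∧
    ∀ m, powerSym N (1 / α) m P = eig (1 / α) m κ • P := by
  obtain ⟨w, hw, horth⟩ := exists_projection (gForm hα N)
    (fun v hv => (gForm_pos hα hv).ne') (lowSym κ) (msym N κ.1.2)
  refine ⟨msym N κ.1.2 - w, ?_, fun m => ?_⟩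
  · rw [sub_sub_cancel_left]
    exact Submodule.neg_mem _ hw
  -- The defect of the eigenvalue equation lies in `lowSym κ` by triangularity and is orthogonal to
  -- `lowSym κ` by self-adjointness, so definiteness forces it to vanish.
  have h1 : powerSym N (1 / α) m (msym N κ.1.2 - w) -
      eig (1 / α) m κ • (msym N κ.1.2 - w) ∈ lowSym κ := by
    rw [map_sub, smul_sub, sub_sub_sub_comm]
    exact Submodule.sub_mem _ (powerSym_msym_sub_mem _ _ _)
      (Submodule.sub_mem _ (powerSym_mem_lowSym _ _ hw) (Submodule.smul_mem _ _ hw))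
  have h2 : ∀ w' ∈ lowSym κ, gForm hα N (powerSym N (1 / α) m (msym N κ.1.2 - w) -
      eig (1 / α) m κ • (msym N κ.1.2 - w)) w' = 0 := by
    intro w' hw'
    rw [map_sub, LinearMap.sub_apply, gForm_powerSym, horth _ (powerSym_mem_lowSym _ _ hw'),
      map_smul, LinearMap.smul_apply, horth _ hw', smul_zero, sub_zero]
  by_contra h
  exact (gForm_pos hα (sub_ne_zero.2 h)).ne' (h2 _ h1)

theorem cf_powerSym_of_maximal (a : ℝ) (m : ℕ) {f : SymPoly N} {μ : PartLE N}
    (hmax : ∀ ν, cf ν f ≠ 0 → ¬ SDom μ ν) : cf μ (powerSym N a m f) = eig a m μ * cf μ f := by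
  nth_rw 1 [← sum_cf_smul_msym f]
  rw [map_sum, map_sum]
  have h1 : ∀ ν ∈ cfSupport f, cf μ (powerSym N a m (cf ν f • msym N ν.1.2)) =
      if μ = ν then eig a m μ * cf μ f else 0 := by
    intro ν hν
    rw [map_smul, map_smul, cf_powerSym_msym a m ν μ (hmax ν (mem_cfSupport.1 hν))]
    split_ifs with h
    · rw [h, smul_eq_mul, mul_comm]
    · rw [smul_zero]
  rw [Finset.sum_congr rfl h1, Finset.sum_ite_eq, ite_eq_left_iff]
  intro h
  have : cf μ f = 0 := by
    by_contra h'
    exact h (mem_cfSupport.2 h')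
  rw [this, mul_zero]

/-- The leading coefficient forces both eigenvalues to be `eig a 2 κ`. A non-zero difference would
have a top term `m_μ` with `μ < κ`, whose eigenvalue is strictly smaller. -/
theorem eq_of_eigen {a : ℝ} (ha : 0 < a) {κ : PartLE N} {P Q : SymPoly N}
    (hP : P - msym N κ.1.2 ∈ lowSym κ) (hQ : Q - msym N κ.1.2 ∈ lowSym κ) {e e' : ℝ}
    (heP : powerSym N a 2 P = e • P) (heQ : powerSym N a 2 Q = e' • Q) : P = Q := by
  have hcf : ∀ {P : SymPoly N}, P - msym N κ.1.2 ∈ lowSym κ → cf κ P = 1 := by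
    intro P hP
    have h := cf_eq_zero_of_mem_lowSym hP (fun h : SDom κ κ => h.1 rfl)
    rwa [map_sub, cf_msym, if_pos rfl, sub_eq_zero] at h
  have he : ∀ {P : SymPoly N} {e : ℝ}, P - msym N κ.1.2 ∈ lowSym κ →
      powerSym N a 2 P = e • P → e = eig a 2 κ := by
    intro P e hP heP
    have h := cf_powerSym_of_maximal a 2 (f := P) (μ := κ) (by
      intro ν hν h
      have h1 : cf ν (P - msym N κ.1.2) ≠ 0 := by
        rw [map_sub, cf_msym, if_neg (Ne.symm h.1), sub_zero]
        exact hν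
      exact h.1 (h.2.antisymm (hP ν h1).2))
    rwa [heP, map_smul, hcf hP, smul_eq_mul, mul_one, mul_one] at h
  by_contra hne
  have hd : P - Q ∈ lowSym κ := by
    rw [← sub_sub_sub_cancel_right P Q (msym N κ.1.2)]
    exact Submodule.sub_mem _ hP hQ
  have hed : powerSym N a 2 (P - Q) = eig a 2 κ • (P - Q) := by
    rw [map_sub, heP, heQ, he hP heP, he hQ heQ, smul_sub]
  have hne' : (cfSupport (P - Q)).Nonempty := by
    rw [Finset.nonempty_iff_ne_empty]
    intro h
    apply hne
    rw [← sub_eq_zero, ← sum_cf_smul_msym (P - Q), h, Finset.sum_empty]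
  -- Maximal eigenvalue implies that nothing in the support strictly dominates `μ`, by `eig_two_lt`.
  obtain ⟨μ, hμ, hmax⟩ := Finset.exists_max_image (cfSupport (P - Q)) (eig a 2) hne'
  have h := cf_powerSym_of_maximal a 2 (f := P - Q) (μ := μ) (fun ν hν hs =>
    absurd (hmax ν (mem_cfSupport.2 hν)) (not_le.2 (eig_two_lt ha hs)))
  rw [hed, map_smul, smul_eq_mul] at h
  have h2 := mul_right_cancel₀ (mem_cfSupport.1 hμ) h
  exact (eig_two_lt ha (hd μ (mem_cfSupport.1 hμ))).ne h2.symm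

/-! ### Comparison of `D_2(α)` with the sum of squares of the Heckman–Dunkl operators -/

section Operator

/-- Split `2 x_i t_i = x_i (t_i - t_k) + (x_k t_i + x_i t_k) + (x_i - x_k) t_i`. The middle part is
symmetric over an antisymmetric denominator and sums to zero. Diagonal quotients are `0` by division
by zero, which leaves `N - 1` copies of each `t_i`. -/
theorem sum_div_sub_identity {K : Type} [Field K] [CharZero K] {x : Fin N → K} (hx : Function.Injective x)
    (t : Fin N → K) : 2 * ∑ i, ∑ k, x i * t i / (x i - x k) =
      ∑ i, ∑ k, x i * (t i - t k) / (x i - x k) + (N - 1) * ∑ i, t i := by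
  have h1 : ∑ i, ∑ k, (x k * t i + x i * t k) / (x i - x k) = 0 := by
    rw [← self_eq_neg]
    nth_rw 1 [Finset.sum_comm]
    rw [← Finset.sum_neg_distrib]
    refine Finset.sum_congr rfl fun i _ => ?_
    rw [← Finset.sum_neg_distrib]
    refine Finset.sum_congr rfl fun k _ => ?_
    rw [← div_neg, neg_sub, add_comm]
  have h2 : ∀ i k, 2 * (x i * t i / (x i - x k)) = x i * (t i - t k) / (x i - x k) +
      (x k * t i + x i * t k) / (x i - x k) + (t i - if k = i then t i else 0) := by
    intro i k
    split_ifs with h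
    · subst h
      simp
    · have h3 : x i - x k ≠ 0 := sub_ne_zero.2 (hx.ne (Ne.symm h))
      field_simp
      ring
  simp only [Finset.mul_sum, h2, Finset.sum_add_distrib, h1, Finset.sum_sub_distrib,
    Finset.sum_const, Finset.card_univ, Fintype.card_fin, Finset.sum_ite_eq', Finset.mem_univ,
    if_true, ← Finset.smul_sum]
  rw [← Finset.mul_sum, nsmul_eq_mul]
  ring

theorem divDiff_of_isSymmetric {f : MvPolynomial (Fin N) ℝ} (hf : f.IsSymmetric) {i k : Fin N}
    (h : i ≠ k) : divDiff i k h f = 0 := by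
  apply divDiff_eq
  rw [swapVar, hf, sub_self, mul_zero, mul_zero]

theorem rename_euler (e : Equiv.Perm (Fin N)) (i : Fin N) (f : MvPolynomial (Fin N) ℝ) :
    rename e (euler i f) = euler (e i) (rename e f) := by
  rw [euler_apply, euler_apply, map_mul, rename_X, pderiv_rename e.injective]

theorem dunklOne_of_isSymmetric (a : ℝ) {f : MvPolynomial (Fin N) ℝ} (hf : f.IsSymmetric)
    (i : Fin N) : dunklOne a i f = euler i f := by
  rw [dunklOne, dunkl_apply]
  refine Eq.trans ?_ (add_zero _)
  refine congrArg₂ (· + ·) rfl ?_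
  rw [Finset.sum_eq_zero, smul_zero]
  intro k _
  split_ifs with h
  · exact divDiff_of_isSymmetric hf h
  · rfl

/-- The first application of `D_i` to a symmetric polynomial has no difference part; only the second
one does. -/
theorem powerDunkl_two (a : ℝ) {f : MvPolynomial (Fin N) ℝ} (hf : f.IsSymmetric) :
    powerDunkl N a 2 f = ∑ i, euler i (euler i f) +
      a • ∑ i, ∑ k, if h : i ≠ k then divDiff i k h (euler i f) else 0 := by
  rw [powerDunkl, LinearMap.sum_apply, Finset.smul_sum, ← Finset.sum_add_distrib]
  refine Finset.sum_congr rfl fun i _ => ?_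
  rw [sq, Module.End.mul_apply, dunklOne_of_isSymmetric a hf, dunklOne, dunkl_apply]
  rfl

/-- Apply the identity above with `t_i = x_i ∂_i f`: for symmetric `f` the swap takes `t_i` to
`t_k`. The diagonal second-order part differs by `x_i² ∂_i² = (x_i ∂_i)² - x_i ∂_i`. -/
theorem D2_eq (α : ℝ) {f : MvPolynomial (Fin N) ℝ} (hf : f.IsSymmetric) :
    D2 N α f = algebraMap (MvPolynomial (Fin N) ℝ) (FractionRing (MvPolynomial (Fin N) ℝ))
      (powerDunkl N (1 / α) 2 f - (1 - 1 / α * (N - 1)) • ∑ i, euler i f) := by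
  set φ := algebraMap (MvPolynomial (Fin N) ℝ) (FractionRing (MvPolynomial (Fin N) ℝ)) with hφ
  have hinj : Function.Injective φ := IsFractionRing.injective _ _
  have hsmul : ∀ (c : ℝ) (p : MvPolynomial (Fin N) ℝ), φ (c • p) = c • φ p := fun c p =>
    map_smul (IsScalarTower.toAlgHom ℝ (MvPolynomial (Fin N) ℝ)
      (FractionRing (MvPolynomial (Fin N) ℝ))) c p
  have hxi : Function.Injective fun i : Fin N => φ (X i) := hinj.comp (X_injective)
  have hdiv : ∀ i k, φ (if h : i ≠ k then divDiff i k h (euler i f) else 0) =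
      φ (X i) * (φ (euler i f) - φ (euler k f)) / (φ (X i) - φ (X k)) := by
    intro i k
    by_cases h : i = k
    · subst h
      simp
    · rw [dif_pos h, eq_div_iff (sub_ne_zero.2 (hxi.ne h)), mul_comm, ← map_sub, ← map_mul,
        X_sub_X_mul_divDiff, swapVar, rename_euler, hf, Equiv.swap_apply_left, map_mul, map_sub]
  have : CharZero (FractionRing (MvPolynomial (Fin N) ℝ)) :=
    charZero_of_injective_algebraMap (algebraMap ℝ _).injective
  have hmain := sum_div_sub_identity hxi (fun i => φ (euler i f))
  have hsq : ∀ j, X j ^ 2 * pderiv j (pderiv j f) = euler j (euler j f) - euler j f := by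
    intro j
    rw [euler_apply, euler_apply, Derivation.leibniz, pderiv_X_self]
    simp only [smul_eq_mul]
    ring
  have hsum : ∑ j : Fin N, ∑ k ∈ Finset.univ.erase j,
      φ (X j ^ 2) / φ (X j - X k) * φ (pderiv j f) =
      ∑ j : Fin N, ∑ k, φ (X j) * φ (euler j f) / (φ (X j) - φ (X k)) := by
    refine Finset.sum_congr rfl fun j _ => ?_
    rw [Finset.sum_erase _ (by simp)]
    refine Finset.sum_congr rfl fun k _ => ?_
    rw [euler_apply, map_sub, map_mul, map_pow]
    ring
  rw [D2]
  simp only [← hφ]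
  rw [hsum, powerDunkl_two _ hf, map_sub, map_add, hsmul, hsmul]
  simp only [map_sum, hdiv, hsq, map_sub, Finset.sum_sub_distrib]
  simp only [Algebra.smul_def, map_sub, map_mul, map_one, map_natCast] at hmain ⊢
  have h2 : algebraMap ℝ (FractionRing (MvPolynomial (Fin N) ℝ)) (2 / α) =
      algebraMap ℝ _ (1 / α) * 2 := by
    rw [← map_ofNat (algebraMap ℝ (FractionRing (MvPolynomial (Fin N) ℝ))) 2, ← map_mul]
    congr 1
    ring
  rw [h2]
  linear_combination (algebraMap ℝ (FractionRing (MvPolynomial (Fin N) ℝ)) (1 / α)) * hmain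

end Operator

theorem sum_euler_of_size {f : SymPoly N} {n : ℕ} (hf : ∀ μ, cf μ f ≠ 0 → μ.size = n) :
    ∑ i, euler i (f : MvPolynomial (Fin N) ℝ) = (n : ℝ) • (f : MvPolynomial (Fin N) ℝ) := by
  ext β
  rw [coeff_sum, coeff_smul]
  simp only [coeff_euler]
  rw [← Finset.sum_mul, ← Nat.cast_sum, ← Finsupp.degree_eq_sum, smul_eq_mul]
  by_cases h : coeff β (f : MvPolynomial (Fin N) ℝ) = 0
  · rw [h, mul_zero, mul_zero]
  · rw [← hf (shape β) (by rwa [← coeff_eq_cf]), shape_size]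

theorem msym_eq_zero {n : ℕ} {μ : n.Partition} (h : N < Multiset.card μ.parts) : msym N μ = 0 := by
  apply Subtype.ext
  change msymm (Fin N) ℝ μ = 0
  rw [msymm]
  refine Finset.sum_eq_zero fun s _ => ?_
  exfalso
  have h1 : Multiset.card μ.parts = s.1.1.toFinset.card := 
    (congrArg (fun π : n.Partition => Multiset.card π.parts) s.2).symm.trans (Multiset.card_map _ _)
  have h2 := Finset.card_le_univ s.1.1.toFinset
  rw [Fintype.card_fin] at h2
  omega

/-- The sum runs over all partitions of the modulus; those longer than `N` have `m_μ = 0`, so their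
coefficients are immaterial and may be taken to be zero. -/
theorem isSymmetricJack_form_iff (κ : PartLE N) (P : SymPoly N) :
    (∃ u : κ.1.1.Partition → ℝ, (∀ μ, u μ ≠ 0 → DomLT μ κ.1.2) ∧
      P = msym N κ.1.2 + ∑ μ : κ.1.1.Partition, u μ • msym N μ) ↔
    P - msym N κ.1.2 ∈ lowSym κ := by
  classical
  obtain ⟨⟨n, κ⟩, hκ⟩ := κ
  dsimp only
  constructor
  · rintro ⟨u, hu, rfl⟩
    rw [add_sub_cancel_left]
    refine Submodule.sum_mem _ fun μ _ => ?_
    by_cases h : N < Multiset.card μ.parts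
    · rw [msym_eq_zero h, smul_zero]
      exact Submodule.zero_mem _
    · by_cases hμ : u μ = 0
      · rw [hμ, zero_smul]
        exact Submodule.zero_mem _
      · have h1 := hu μ hμ
        refine Submodule.smul_mem _ _ (msym_mem_lowSym (μ := ⟨⟨n, μ⟩, not_lt.1 h⟩) ⟨?_, rfl, h1.2⟩)
        intro e
        apply h1.1
        injection e with e
        exact eq_of_heq (Sigma.mk.inj e).2
  · intro hP
    refine ⟨fun μ => if h : Multiset.card μ.parts ≤ N then
      cf ⟨⟨n, μ⟩, h⟩ (P - msym N κ) else 0, ?_, ?_⟩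
    · intro μ hμ
      dsimp only at hμ
      split_ifs at hμ with h
      · have h1 := hP _ hμ
        refine ⟨?_, h1.2.2⟩
        rintro rfl
        exact h1.1 rfl
      · exact absurd rfl hμ
    · rw [← sub_eq_iff_eq_add']
      refine symPoly_ext fun ν => ?_
      rw [map_sum]
      have h1 : ∀ μ : n.Partition, cf ν ((if h : Multiset.card μ.parts ≤ N then
          cf ⟨⟨n, μ⟩, h⟩ (P - msym N κ) else 0) • msym N μ) =
          if ν.1 = ⟨n, μ⟩ then cf ν (P - msym N κ) else 0 := by
        intro μ
        by_cases h : Multiset.card μ.parts ≤ N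
        · rw [dif_pos h, map_smul, cf_msym ν ⟨⟨n, μ⟩, h⟩]
          by_cases e : ν = ⟨⟨n, μ⟩, h⟩
          · subst e
            simp
          · rw [if_neg e, if_neg (fun e' => e (Subtype.ext e')), smul_zero]
        · rw [dif_neg h, zero_smul, map_zero, if_neg]
          intro e
          have := ν.2
          rw [e] at this
          exact h this
      simp only [h1]
      by_cases hν : ν.size = n
      · obtain ⟨⟨n', ν⟩, hν'⟩ := ν
        dsimp [PartLE.size] at hν
        subst hν
        simp
      · rw [cf_eq_zero_of_mem_lowSym hP (fun h => hν h.2.1)]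
        simp

/-- On polynomials homogeneous of degree `|κ|` the Euler operator is a scalar, so `D_2(α)` and `L_2`
have the same eigenfunctions. -/
theorem isSymmetricJack_iff (κ : PartLE N) (P : SymPoly N) : IsSymmetricJack N α κ.1.2 P ↔
    P - msym N κ.1.2 ∈ lowSym κ ∧ ∃ e : ℝ, powerSym N (1 / α) 2 P = e • P := by
  rw [IsSymmetricJack, isSymmetricJack_form_iff, and_comm]
  refine and_congr_right fun hP => ?_
  have hsize : ∀ μ, cf μ P ≠ 0 → μ.size = κ.size := by
    intro μ hμ
    by_cases h : μ = κ
    · rw [h]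
    · refine (hP μ ?_).2.1
      rwa [map_sub, cf_msym, if_neg h, sub_zero]
  have h1 : ∀ e : ℝ, D2 N α P = algebraMap (MvPolynomial (Fin N) ℝ)
      (FractionRing (MvPolynomial (Fin N) ℝ)) (e • (P : MvPolynomial (Fin N) ℝ)) ↔
      powerSym N (1 / α) 2 P = (e + (1 - 1 / α * (N - 1)) * κ.size) • P := by
    intro e
    rw [D2_eq α P.2, (IsFractionRing.injective (MvPolynomial (Fin N) ℝ)
      (FractionRing (MvPolynomial (Fin N) ℝ))).eq_iff, sum_euler_of_size hsize, smul_smul,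
      sub_eq_iff_eq_add, ← add_smul, ← coe_powerSym]
    exact ⟨fun h => Subtype.ext h, fun h => congrArg Subtype.val h⟩
  constructor
  · rintro ⟨e, he⟩
    exact ⟨_, (h1 e).1 he⟩
  · rintro ⟨e, he⟩
    refine ⟨e - (1 - 1 / α * (N - 1)) * κ.size, (h1 _).2 ?_⟩
    rw [he, sub_add_cancel]

include hα in
theorem existsUnique_jack (κ : PartLE N) : ∃! P : SymPoly N, IsSymmetricJack N α κ.1.2 P := by
  obtain ⟨P, hP, heP⟩ := exists_jointEigen hα κ
  refine ⟨P, (isSymmetricJack_iff κ P).2 ⟨hP, _, heP 2⟩, fun Q hQ => ?_⟩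
  obtain ⟨hQ, e, heQ⟩ := (isSymmetricJack_iff κ Q).1 hQ
  exact eq_of_eigen (one_div_pos.2 hα) hQ hP heQ (heP 2)

include hα in
theorem isSymmetricJack_jackP (κ : PartLE N) : IsSymmetricJack N α κ.1.2 (jackP N α κ.1.2) :=
  Classical.epsilon_spec (existsUnique_jack hα κ).exists

include hα in
theorem jackP_sub_mem (κ : PartLE N) : jackP N α κ.1.2 - msym N κ.1.2 ∈ lowSym κ :=
  ((isSymmetricJack_iff κ _).1 (isSymmetricJack_jackP hα κ)).1

include hα in
theorem eq_jackP {κ : PartLE N} {P : SymPoly N} (hP : P - msym N κ.1.2 ∈ lowSym κ) {e : ℝ}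
    (he : powerSym N (1 / α) 2 P = e • P) : P = jackP N α κ.1.2 :=
  (existsUnique_jack hα κ).unique ((isSymmetricJack_iff κ P).2 ⟨hP, e, he⟩)
    (isSymmetricJack_jackP hα κ)

include hα in
theorem powerSym_jackP (m : ℕ) (κ : PartLE N) :
    powerSym N (1 / α) m (jackP N α κ.1.2) = eig (1 / α) m κ • jackP N α κ.1.2 := by
  obtain ⟨P, hP, heP⟩ := exists_jointEigen hα κ
  rw [← eq_jackP hα hP (heP 2), heP]

/-- If the product were non-zero, self-adjointness would force all eigenvalues of `κ` and `μ` to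
agree. All `m` are used, since one `L_m` need not separate incomparable partitions. -/
theorem gForm_jackP_of_ne {κ μ : PartLE N} (h : κ ≠ μ) :
    gForm hα N (jackP N α κ.1.2) (jackP N α μ.1.2) = 0 := by
  by_contra hne
  refine h (eq_of_eig_eq (one_div_pos.2 hα) fun m => ?_)
  have h1 := gForm_powerSym hα m (jackP N α κ.1.2) (jackP N α μ.1.2)
  rw [powerSym_jackP hα, powerSym_jackP hα, map_smul, LinearMap.smul_apply, map_smul,
    smul_eq_mul, smul_eq_mul] at h1
  exact mul_right_cancel₀ hne h1

include hα in
theorem cf_jackP_self (κ : PartLE N) : cf κ (jackP N α κ.1.2) = 1 := by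
  have h := cf_eq_zero_of_mem_lowSym (jackP_sub_mem hα κ) (fun h : SDom κ κ => h.1 rfl)
  rwa [map_sub, cf_msym, if_pos rfl, sub_eq_zero] at h

include hα in
theorem jackP_ne_zero (κ : PartLE N) : jackP N α κ.1.2 ≠ 0 := by
  intro h
  have := cf_jackP_self hα κ
  rw [h, map_zero] at this
  exact zero_ne_one this

include hα in
theorem cf_jackP_of_size_ne {κ μ : PartLE N} (h : μ.size ≠ κ.size) :
    cf μ (jackP N α κ.1.2) = 0 := by
  have h1 := cf_eq_zero_of_mem_lowSym (jackP_sub_mem hα κ) (μ := μ) (fun hs => h hs.2.1)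
  rwa [map_sub, cf_msym, if_neg (fun e => h (by rw [e])), sub_zero] at h1

end

section

open MvPolynomial

/-! ### Expansion of the kernel in Jack polynomials -/

variable {N : ℕ} {α : ℝ} (hα : 0 < α)

theorem finite_sDom (κ : PartLE N) : {μ | SDom μ κ}.Finite :=
  (Set.finite_range fun μ : {μ : PartLE N // μ.size = κ.size} => μ.1).subset
    fun μ hμ => ⟨⟨μ, hμ.2.1⟩, rfl⟩

theorem ncard_sDom_lt {μ κ : PartLE N} (h : SDom μ κ) :
    {ν | SDom ν μ}.ncard < {ν | SDom ν κ}.ncard := by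
  refine Set.ncard_lt_ncard ?_ (finite_sDom κ)
  exact ⟨fun ν hν => SDom.trans hν h, fun h' => (h' h : SDom μ μ).1 rfl⟩

include hα in
theorem msym_mem_span_jackP (κ : PartLE N) : msym N κ.1.2 ∈
    Submodule.span ℝ (Set.range fun μ : PartLE N => jackP N α μ.1.2) := by
  -- Induction on the number of partitions strictly below `κ`.
  induction hn : {ν | SDom ν κ}.ncard using Nat.strong_induction_on generalizing κ with
  | _ n ih =>
    rw [← sub_sub_cancel (jackP N α κ.1.2) (msym N κ.1.2)]
    refine Submodule.sub_mem _ (Submodule.subset_span ⟨κ, rfl⟩) ?_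
    rw [← sum_cf_smul_msym (jackP N α κ.1.2 - msym N κ.1.2)]
    refine Submodule.sum_mem _ fun μ hμ => Submodule.smul_mem _ _ ?_
    have h := jackP_sub_mem hα κ μ (mem_cfSupport.1 hμ)
    exact ih _ (hn ▸ ncard_sDom_lt h) μ rfl

include hα in
/-- A linear map on symmetric polynomials is determined by its values on Jack polynomials. -/
theorem hom_ext_jackP {M : Type} [AddCommGroup M] [Module ℝ M] {A B : SymPoly N →ₗ[ℝ] M}
    (h : ∀ κ : PartLE N, A (jackP N α κ.1.2) = B (jackP N α κ.1.2)) : A = B := by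
  refine hom_ext_msym fun κ => ?_
  refine LinearMap.eqOn_span (s := Set.range fun μ : PartLE N => jackP N α μ.1.2) ?_
    (msym_mem_span_jackP hα κ)
  rintro _ ⟨μ, rfl⟩
  exact h μ

/-- The squared norm of a Jack polynomial. -/
def jackNorm (κ : PartLE N) : ℝ := gForm hα N (jackP N α κ.1.2) (jackP N α κ.1.2)

theorem jackNorm_pos (κ : PartLE N) : 0 < jackNorm hα κ := gForm_pos hα (jackP_ne_zero hα κ)

theorem gForm_jackP (κ μ : PartLE N) : gForm hα N (jackP N α κ.1.2) (jackP N α μ.1.2) =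
    if μ = κ then jackNorm hα κ else 0 := by
  split_ifs with h
  · rw [h, jackNorm]
  · exact gForm_jackP_of_ne hα (Ne.symm h)

/-- Orthogonal expansion: pairing `g_μ` with a Jack polynomial gives its coefficient at `m_μ`. -/
theorem gPoly_eq_sum_jackP (μ : PartLE N) : gPoly hα N μ = ∑ κ : {κ : PartLE N // κ.size = μ.size},
    (1 / jackNorm hα κ.1 * cf μ (jackP N α κ.1.1.2)) • jackP N α κ.1.1.2 := by
  classical
  rw [← sub_eq_zero]
  by_contra hne
  have h0 := gForm_pos hα hne
  refine h0.ne' ?_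
  have key : gForm hα N (gPoly hα N μ - ∑ κ : {κ : PartLE N // κ.size = μ.size},
      (1 / jackNorm hα κ.1 * cf μ (jackP N α κ.1.1.2)) • jackP N α κ.1.1.2) = 0 := by
    refine hom_ext_jackP hα fun ν => ?_
    rw [map_sub, LinearMap.sub_apply, gForm_gPoly, map_sum, LinearMap.sum_apply,
      LinearMap.zero_apply, sub_eq_zero]
    simp only [map_smul, LinearMap.smul_apply, gForm_jackP, smul_eq_mul]
    by_cases h : ν.size = μ.size
    · rw [Finset.sum_eq_single ⟨ν, h⟩]
      · rw [if_pos rfl, mul_right_comm, one_div_mul_cancel (jackNorm_pos hα ν).ne', one_mul]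
      · intro κ _ hκ
        rw [if_neg fun e => hκ (Subtype.ext e.symm), mul_zero]
      · exact fun h' => absurd (Finset.mem_univ _) h'
    · rw [cf_jackP_of_size_ne hα (Ne.symm h), Finset.sum_eq_zero]
      intro κ _
      rw [if_neg, mul_zero]
      rintro rfl
      exact h κ.2
  rw [key, LinearMap.zero_apply]

/-- Fixing the exponent in `y` selects one `g_μ(x)`, whose Jack expansion is finite; all other `κ`
contribute zero for reasons of degree. -/
theorem hasFormalSum_jackP : HasFormalSum (fun κ : PartLE N => (1 / jackNorm hα κ) •
    (inX (jackP N α κ.1.2) * inY (jackP N α κ.1.2))) (kernel N α) := by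
  classical
  intro d
  obtain ⟨β, γ, rfl⟩ := exists_sumElim d
  rw [kernel_eq_of_shape_eq hα (shape_expo (shape γ)).symm, ← coeff_gPoly hα, gPoly_eq_sum_jackP,
    coeff_sum_smul]
  simp only [map_smul, coeff_inX_mul_inY, smul_eq_mul]
  have h := hasSum_sum_of_ne_finset_zero (L := .unconditional _) (f := fun κ : PartLE N => 1 / jackNorm hα κ *
      (coeff β (jackP N α κ.1.2 : MvPolynomial (Fin N) ℝ) *
        coeff γ (jackP N α κ.1.2 : MvPolynomial (Fin N) ℝ)))
    (s := (Finset.univ : Finset {κ : PartLE N // κ.size = (shape γ).size}).map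
      (Function.Embedding.subtype _)) (by
    intro κ hκ
    have h1 : (shape γ).size ≠ κ.size := by
      intro e
      exact hκ (Finset.mem_map.2 ⟨⟨κ, e.symm⟩, Finset.mem_univ _, rfl⟩)
    rw [coeff_eq_cf _ γ, cf_jackP_of_size_ne hα h1, mul_zero, mul_zero])
  rw [Finset.sum_map] at h
  convert h using 1
  refine Finset.sum_congr rfl fun κ _ => ?_
  rw [Function.Embedding.subtype_apply, coeff_eq_cf _ γ]
  ring

/-! ### Restriction of the number of variables -/

section Restriction

variable {σ τ : Type}

theorem coeff_killCompl {f : σ → τ} (hf : Function.Injective f) (p : MvPolynomial τ ℝ)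
    (β : σ →₀ ℕ) : coeff β (killCompl hf p) = coeff (β.mapDomain f) p := by
  classical
  induction p using MvPolynomial.induction_on' with
  | add p q hp hq => rw [map_add, coeff_add, coeff_add, hp, hq]
  | monomial d c =>
    by_cases h : (d.support : Set τ) ⊆ Set.range f
    · rw [← Finsupp.mapDomain_comapDomain f hf d h, ← rename_monomial, killCompl_rename_app,
        coeff_rename_mapDomain f hf]
    · obtain ⟨j, hj, hjf⟩ := Set.not_subset.1 h
      have h1 : killCompl hf (monomial d c) = 0 := by
        rw [killCompl, aeval_monomial, Finsupp.prod, Finset.prod_eq_zero hj, mul_zero]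
        rw [dif_neg hjf, zero_pow (Finsupp.mem_support_iff.1 hj)]
      rw [h1, coeff_zero, coeff_monomial, if_neg]
      rintro rfl
      rw [Finset.mem_coe, Finsupp.mem_support_iff] at hj
      exact hj (Finsupp.mapDomain_of_notMem_range _ _ hjf)

theorem killCompl_X {f : σ → τ} (hf : Function.Injective f) (i : σ) :
    killCompl hf (X (f i) : MvPolynomial τ ℝ) = X i := by
  rw [← rename_X, killCompl_rename_app]

theorem killCompl_X_of_notMem {f : σ → τ} (hf : Function.Injective f) {j : τ}
    (hj : j ∉ Set.range f) : killCompl hf (X j : MvPolynomial τ ℝ) = 0 := by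
  rw [killCompl, aeval_X, dif_neg hj]

end Restriction

/-- The substitution `z_N = 0`. -/
abbrev dropLast (N : ℕ) : MvPolynomial (Fin (N + 1)) ℝ →ₐ[ℝ] MvPolynomial (Fin N) ℝ :=
  killCompl (Fin.castSucc_injective N)

theorem last_notMem_range : Fin.last N ∉ Set.range (Fin.castSucc : Fin N → Fin (N + 1)) := by
  rintro ⟨i, hi⟩
  exact Fin.castSucc_ne_last i hi

/-- A partition of length at most `N` as a partition of length at most `N + 1`. -/
def PartLE.succ (κ : PartLE N) : PartLE (N + 1) := ⟨κ.1, κ.2.trans (Nat.le_succ N)⟩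

theorem PartLE.succ_injective : Function.Injective (PartLE.succ : PartLE N → PartLE (N + 1)) :=
  fun _ _ h => Subtype.ext (congrArg (fun ν : PartLE (N + 1) => ν.1) h)

theorem PartLE.eq_succ_or_card_eq (κ : PartLE (N + 1)) :
    (∃ μ : PartLE N, κ = μ.succ) ∨ Multiset.card κ.1.2.parts = N + 1 := by
  rcases Nat.lt_or_ge N (Multiset.card κ.1.2.parts) with h | h
  · exact Or.inr (le_antisymm κ.2 h)
  · exact Or.inl ⟨⟨κ.1, h⟩, rfl⟩

theorem shape_castSucc (β : Fin N →₀ ℕ) : shape (β.mapDomain Fin.castSucc) = (shape β).succ := by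
  apply PartLE.ext_parts
  change (shape (β.mapDomain Fin.castSucc)).1.2.parts = (shape β).1.2.parts
  rw [shape_parts, shape_parts, Finsupp.mapDomain_support_of_injective (Fin.castSucc_injective N),
    Finset.image_val_of_injOn (Fin.castSucc_injective N).injOn, Multiset.map_map]
  refine Multiset.map_congr rfl fun i _ => ?_
  exact Finsupp.mapDomain_apply (Fin.castSucc_injective N) β i

theorem isSymmetric_dropLast {f : MvPolynomial (Fin (N + 1)) ℝ} (hf : f.IsSymmetric) :
    (dropLast N f).IsSymmetric := by
  intro e
  ext β
  obtain ⟨γ, rfl⟩ : ∃ γ : Fin N →₀ ℕ, β = γ.mapDomain e :=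
    ⟨β.mapDomain e.symm, by
      rw [← Finsupp.mapDomain_comp, Equiv.self_comp_symm, Finsupp.mapDomain_id]⟩
  rw [coeff_rename_mapDomain e e.injective, coeff_killCompl, coeff_killCompl]
  apply coeff_eq_of_shape_eq hf
  rw [shape_castSucc, shape_castSucc]
  congr 1
  refine shape_eq_of_perm e fun i => ?_
  exact (Finsupp.mapDomain_apply e.injective γ i).symm

/-- The substitution `z_N = 0` on symmetric polynomials. -/
def restrict (N : ℕ) : SymPoly (N + 1) →ₗ[ℝ] SymPoly N :=
  ((dropLast N).toLinearMap ∘ₗ (symmetricSubalgebra (Fin (N + 1)) ℝ).val.toLinearMap).codRestrict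
    (Subalgebra.toSubmodule (symmetricSubalgebra (Fin N) ℝ)) (fun f => isSymmetric_dropLast f.2)

theorem coe_restrict (f : SymPoly (N + 1)) :
    (restrict N f : MvPolynomial (Fin N) ℝ) = dropLast N f := rfl

theorem cf_restrict (κ : PartLE N) (f : SymPoly (N + 1)) : cf κ (restrict N f) = cf κ.succ f := by
  rw [cf_apply, coe_restrict, coeff_killCompl, coeff_eq_cf, shape_castSucc, shape_expo]

theorem restrict_msym (κ : PartLE N) : restrict N (msym (N + 1) κ.1.2) = msym N κ.1.2 := by
  refine symPoly_ext fun μ => ?_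
  rw [cf_restrict, cf_msym]
  refine (cf_msym μ.succ κ.succ).trans ?_
  exact if_congr PartLE.succ_injective.eq_iff rfl rfl

section Operator

theorem dropLast_euler_castSucc (i : Fin N) (f : MvPolynomial (Fin (N + 1)) ℝ) :
    dropLast N (euler i.castSucc f) = euler i (dropLast N f) := by
  ext β
  rw [coeff_killCompl, coeff_euler, coeff_euler, coeff_killCompl,
    Finsupp.mapDomain_apply (Fin.castSucc_injective N)]

theorem dropLast_euler_last (f : MvPolynomial (Fin (N + 1)) ℝ) :
    dropLast N (euler (Fin.last N) f) = 0 := by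
  rw [euler_apply, map_mul, killCompl_X_of_notMem _ last_notMem_range, zero_mul]

theorem dropLast_swapVar (i k : Fin N) (f : MvPolynomial (Fin (N + 1)) ℝ) :
    dropLast N (swapVar i.castSucc k.castSucc f) = swapVar i k (dropLast N f) := by
  refine DFunLike.congr_fun (f := (dropLast N).comp (swapVar i.castSucc k.castSucc))
    (g := (swapVar i k).comp (dropLast N)) (algHom_ext fun j => ?_) f
  rw [AlgHom.comp_apply, AlgHom.comp_apply, swapVar_X]
  refine Fin.lastCases ?_ (fun j => ?_) j
  · rw [Equiv.swap_apply_of_ne_of_ne (Fin.castSucc_ne_last i).symm (Fin.castSucc_ne_last k).symm,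
      killCompl_X_of_notMem _ last_notMem_range, map_zero]
  · rw [(Fin.castSucc_injective N).swap_apply, killCompl_X, killCompl_X, swapVar_X]

theorem dropLast_divDiff_castSucc {i k : Fin N} (h : i ≠ k) (h' : i.castSucc ≠ k.castSucc)
    (f : MvPolynomial (Fin (N + 1)) ℝ) :
    dropLast N (divDiff i.castSucc k.castSucc h' f) = divDiff i k h (dropLast N f) := by
  symm
  apply divDiff_eq
  have := congrArg (dropLast N) (X_sub_X_mul_divDiff h' f)
  rwa [map_mul, map_mul, map_sub, map_sub, killCompl_X, killCompl_X, dropLast_swapVar] at this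

variable {f : MvPolynomial (Fin (N + 1)) ℝ} (hf : f.IsSymmetric)
include hf

/-- When the last variable is zero, the swapped term `x_N ∂_N f` vanishes and the factor `x_i/(x_i -
x_N)` becomes 1. This is the source of the extra Euler term in `dropLast_powerDunkl_two`. -/
theorem dropLast_divDiff_last (i : Fin N) (h : i.castSucc ≠ Fin.last N) :
    dropLast N (divDiff i.castSucc (Fin.last N) h (euler i.castSucc f)) =
      euler i (dropLast N f) := by
  have := congrArg (dropLast N) (X_sub_X_mul_divDiff h (euler i.castSucc f))
  rw [swapVar, rename_euler, hf, Equiv.swap_apply_left, map_mul, map_mul, map_sub, map_sub,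
    killCompl_X, killCompl_X_of_notMem _ last_notMem_range, dropLast_euler_last, sub_zero, sub_zero,
    dropLast_euler_castSucc] at this
  exact mul_left_cancel₀ (X_ne_zero i) this

theorem dropLast_divDiff_last_left (k : Fin N) (h : Fin.last N ≠ k.castSucc) :
    dropLast N (divDiff (Fin.last N) k.castSucc h (euler (Fin.last N) f)) = 0 := by
  have := congrArg (dropLast N) (X_sub_X_mul_divDiff h (euler (Fin.last N) f))
  rw [map_mul, map_mul, map_sub, killCompl_X, killCompl_X_of_notMem _ last_notMem_range, zero_mul,
    zero_sub] at this
  exact (mul_eq_zero.1 this).resolve_left (neg_ne_zero.2 (X_ne_zero k))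

theorem dropLast_powerDunkl_two (a : ℝ) : dropLast N (powerDunkl (N + 1) a 2 f) =
    powerDunkl N a 2 (dropLast N f) + a • ∑ i, euler i (dropLast N f) := by
  rw [powerDunkl_two a hf, powerDunkl_two a (isSymmetric_dropLast hf), map_add, map_smul, map_sum,
    map_sum, Fin.sum_univ_castSucc, Fin.sum_univ_castSucc, dropLast_euler_last, add_zero, map_sum,
    Fin.sum_univ_castSucc, dif_neg (not_not.2 rfl), map_zero, add_zero]
  have h1 : ∀ k : Fin N, dropLast N (if h : Fin.last N ≠ k.castSucc then
      divDiff (Fin.last N) k.castSucc h (euler (Fin.last N) f) else 0) = 0 := by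
    intro k
    rw [dif_pos (Fin.castSucc_ne_last k).symm, dropLast_divDiff_last_left hf]
  have h2 : ∀ i : Fin N, dropLast N (∑ k, if h : i.castSucc ≠ k then
      divDiff i.castSucc k h (euler i.castSucc f) else 0) =
      (∑ k, if h : i ≠ k then divDiff i k h (euler i (dropLast N f)) else 0) +
        euler i (dropLast N f) := by
    intro i
    rw [map_sum, Fin.sum_univ_castSucc, dif_pos (Fin.castSucc_ne_last i),
      dropLast_divDiff_last hf]
    congr 1
    refine Finset.sum_congr rfl fun k _ => ?_
    by_cases h : i = k
    · subst h
      simp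
    · rw [dif_pos h, dif_pos (fun e => h (Fin.castSucc_injective N e)),
        dropLast_divDiff_castSucc h, dropLast_euler_castSucc]
  simp only [h1, h2, dropLast_euler_castSucc, Finset.sum_const_zero, add_zero,
    Finset.sum_add_distrib, smul_add]
  abel

end Operator

-- The restriction is still triangular with leading term `m_κ`, and an eigenfunction of `L_2`
-- because the extra Euler term is a scalar in fixed degree; uniqueness identifies it.
include hα in
theorem restrict_jackP (κ : PartLE N) : restrict N (jackP (N + 1) α κ.1.2) = jackP N α κ.1.2 := by
  have hP := jackP_sub_mem hα κ.succ
  refine eq_jackP hα (e := eig (1 / α) 2 κ.succ - 1 / α * κ.size) ?_ ?_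
  · intro μ hμ
    rw [← restrict_msym, ← map_sub, cf_restrict] at hμ
    have h := hP _ hμ
    exact ⟨fun e => h.1 (congrArg _ e), h.2⟩
  · have h := congrArg (restrict N) (powerSym_jackP hα 2 κ.succ)
    rw [map_smul] at h
    apply Subtype.ext
    have h2 := congrArg Subtype.val h
    rw [coe_restrict, coe_powerSym, dropLast_powerDunkl_two (jackP (N + 1) α κ.succ.1.2).2,
      ← coe_restrict, sum_euler_of_size (n := κ.size)] at h2
    · rw [coe_powerSym, sub_smul]
      exact eq_sub_of_add_eq ((congrArg _ (smul_smul _ _ _).symm).trans h2)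
    · intro μ hμ
      rw [cf_restrict] at hμ
      by_contra hne
      exact hμ (cf_jackP_of_size_ne hα hne)

/-- The first `N` parts of `μ` already sum to the whole modulus, whereas `κ` has a positive part
left. -/
theorem not_dom_of_card_eq {κ : PartLE (N + 1)} (h : Multiset.card κ.1.2.parts = N + 1)
    (μ : PartLE N) : ¬ Dom μ.succ κ := by
  intro hd
  have h1 : partialSum μ.1.2 N ≤ partialSum κ.1.2 N := hd.2 N
  have h2 : μ.size = κ.size := hd.1
  rw [partialSum_eq_size, h2, ← partialSum_eq_size κ, partialSum_eq_sum_part,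
    partialSum_eq_sum_part, Finset.sum_range_succ] at h1
  have h3 : N < (κ.1.2.parts.sort (· ≥ ·)).length := by
    rw [Multiset.length_sort]
    omega
  have h4 : 0 < part κ N := by
    rw [part, List.getD_eq_getElem _ _ h3]
    exact κ.1.2.parts_pos ((Multiset.mem_sort (· ≥ ·)).1 (List.getElem_mem h3))
  omega

include hα in
theorem restrict_jackP_of_card_eq {κ : PartLE (N + 1)} (h : Multiset.card κ.1.2.parts = N + 1) :
    restrict N (jackP (N + 1) α κ.1.2) = 0 := by
  refine symPoly_ext fun μ => ?_
  rw [cf_restrict, map_zero]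
  have h1 : μ.succ ≠ κ := by
    rintro rfl
    have := μ.2
    change Multiset.card μ.1.2.parts = N + 1 at h
    omega
  have h2 := cf_eq_zero_of_mem_lowSym (jackP_sub_mem hα κ) (μ := μ.succ)
    (fun hs => not_dom_of_card_eq h μ hs.2)
  rwa [map_sub, cf_msym, if_neg h1, sub_zero] at h2

/-! ### Restriction of the kernel -/

section Kernel

/-- The substitution `x_N = y_N = 0`. -/
abbrev dropLasts (N : ℕ) : MvPolynomial (Fin (N + 1) ⊕ Fin (N + 1)) ℝ →ₐ[ℝ]
    MvPolynomial (Fin N ⊕ Fin N) ℝ :=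
  killCompl (f := Sum.map Fin.castSucc Fin.castSucc)
    ((Fin.castSucc_injective N).sumMap (Fin.castSucc_injective N))

theorem mapDomain_castSucc_last (β : Fin N →₀ ℕ) : β.mapDomain Fin.castSucc (Fin.last N) = 0 :=
  Finsupp.mapDomain_of_notMem_range _ _ last_notMem_range

theorem mapDomain_sumMap (β γ : Fin N →₀ ℕ) :
    (β.sumElim γ).mapDomain (Sum.map Fin.castSucc Fin.castSucc) =
      (β.mapDomain Fin.castSucc).sumElim (γ.mapDomain Fin.castSucc) := by
  have hinj := (Fin.castSucc_injective N).sumMap (Fin.castSucc_injective N)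
  ext j
  rcases j with j | j <;> refine Fin.lastCases ?_ (fun j => ?_) j
  · rw [Finsupp.mapDomain_of_notMem_range, Finsupp.sumElim_inl, mapDomain_castSucc_last]
    rintro ⟨i | i, hi⟩ <;> simp [Fin.castSucc_ne_last] at hi
  · rw [← Sum.map_inl Fin.castSucc Fin.castSucc, Finsupp.mapDomain_apply hinj, Sum.map_inl,
      Finsupp.sumElim_inl, Finsupp.sumElim_inl, Finsupp.mapDomain_apply (Fin.castSucc_injective N)]
  · rw [Finsupp.mapDomain_of_notMem_range, Finsupp.sumElim_inr, mapDomain_castSucc_last]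
    rintro ⟨i | i, hi⟩ <;> simp [Fin.castSucc_ne_last] at hi
  · rw [← Sum.map_inr Fin.castSucc Fin.castSucc, Finsupp.mapDomain_apply hinj, Sum.map_inr,
      Finsupp.sumElim_inr, Finsupp.sumElim_inr, Finsupp.mapDomain_apply (Fin.castSucc_injective N)]

theorem dropLasts_tens (f h : MvPolynomial (Fin (N + 1)) ℝ) :
    dropLasts N (tens f h) = tens (dropLast N f) (dropLast N h) := by
  ext δ
  obtain ⟨β, γ, rfl⟩ := exists_sumElim δ
  rw [coeff_killCompl, mapDomain_sumMap, coeff_tens, coeff_tens, coeff_killCompl, coeff_killCompl]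

theorem dropLast_psum (k : ℕ) :
    dropLast N (psum (Fin (N + 1)) ℝ (k + 1)) = psum (Fin N) ℝ (k + 1) := by
  rw [psum, psum, map_sum, Fin.sum_univ_castSucc, map_pow,
    killCompl_X_of_notMem _ last_notMem_range, zero_pow (Nat.succ_ne_zero k), add_zero]
  simp only [map_pow, killCompl_X]

theorem dropLasts_kernelPart (α : ℝ) (n : ℕ) :
    dropLasts N (kernelPart (N + 1) α n) = kernelPart N α n := by
  induction n using Nat.strong_induction_on with
  | _ n ih =>
    rcases Nat.eq_zero_or_pos n with rfl | hn
    · rw [kernelPart_zero, kernelPart_zero, map_one]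
    · have h := congrArg (dropLasts N) (nat_smul_kernelPart (N + 1) α n)
      rw [map_smul, map_smul, map_sum] at h
      have h2 : ∀ k ∈ Finset.range n, dropLasts N (tens (psum (Fin (N + 1)) ℝ (k + 1))
          (psum (Fin (N + 1)) ℝ (k + 1)) * kernelPart (N + 1) α (n - 1 - k)) =
          tens (psum (Fin N) ℝ (k + 1)) (psum (Fin N) ℝ (k + 1)) *
            kernelPart N α (n - 1 - k) := by
        intro k _
        rw [map_mul, dropLasts_tens, dropLast_psum, ih _ (by omega)]
      rw [Finset.sum_congr rfl h2, ← nat_smul_kernelPart] at h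
      exact smul_right_injective _ (Nat.cast_ne_zero.2 hn.ne') h

theorem coeff_kernel_castSucc (α : ℝ) (β γ : Fin N →₀ ℕ) :
    MvPowerSeries.coeff ((β.mapDomain Fin.castSucc).sumElim (γ.mapDomain Fin.castSucc))
      (kernel (N + 1) α) = MvPowerSeries.coeff (β.sumElim γ) (kernel N α) := by
  have h : (β.mapDomain Fin.castSucc).degree = β.degree := by
    rw [← shape_size, shape_castSucc]
    rfl
  rw [coeff_kernel, coeff_kernel N, ← dropLasts_kernelPart (N := N), coeff_killCompl,
    mapDomain_sumMap, h]

end Kernel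

theorem restrict_gPoly (κ : PartLE N) : restrict N (gPoly hα (N + 1) κ.succ) = gPoly hα N κ := by
  refine symPoly_ext fun μ => ?_
  rw [cf_restrict, cf_apply, cf_apply, coeff_gPoly, coeff_gPoly, ← coeff_kernel_castSucc α (expo μ) (expo κ)]
  have h : ∀ ν : PartLE N, shape (expo ν.succ) = shape ((expo ν).mapDomain Fin.castSucc) := by
    intro ν
    rw [shape_expo, shape_castSucc, shape_expo]
  rw [kernel_eq_of_shape_eq hα (h κ), kernel_symm hα, kernel_eq_of_shape_eq hα (h μ),
    kernel_symm hα]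

/-- Two functionals on `N + 1` variables, pairing with the Jack polynomial before and after
restriction, are proportional on the Jack basis. At `g_κ` both pairings equal 1, so the two norms
coincide. -/
theorem jackNorm_succ (κ : PartLE N) : jackNorm hα κ.succ = jackNorm hα κ := by
  classical
  have key : jackNorm hα κ.succ • (gForm hα N).flip (jackP N α κ.1.2) ∘ₗ restrict N =
      jackNorm hα κ • (gForm hα (N + 1)).flip (jackP (N + 1) α κ.succ.1.2) := by
    refine hom_ext_jackP hα fun ν => ?_
    simp only [LinearMap.smul_apply, LinearMap.comp_apply, LinearMap.flip_apply, smul_eq_mul]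
    rw [gForm_jackP]
    rcases ν.eq_succ_or_card_eq with ⟨ν, rfl⟩ | hν
    · have h : restrict N (jackP (N + 1) α ν.succ.1.2) = jackP N α ν.1.2 := restrict_jackP hα ν
      rw [h, gForm_jackP]
      by_cases e : κ = ν
      · subst e
        rw [if_pos rfl, if_pos rfl, mul_comm]
      · rw [if_neg e, if_neg (PartLE.succ_injective.ne e), mul_zero, mul_zero]
    · rw [restrict_jackP_of_card_eq hα hν, map_zero, LinearMap.zero_apply, if_neg, mul_zero,
        mul_zero]
      rintro rfl
      have := κ.2
      change Multiset.card κ.1.2.parts = N + 1 at hν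
      omega
  have h := LinearMap.congr_fun key (gPoly hα (N + 1) κ.succ)
  simpa only [LinearMap.smul_apply, LinearMap.comp_apply, LinearMap.flip_apply, smul_eq_mul,
    restrict_gPoly, gForm_gPoly, cf_jackP_self hα, mul_one] using h

theorem jackNorm_eq {κ : Part} {N M : ℕ} (hN : Multiset.card κ.2.parts ≤ N) (hNM : N ≤ M) :
    jackNorm hα (N := M) ⟨κ, hN.trans hNM⟩ = jackNorm hα (N := N) ⟨κ, hN⟩ := by
  induction M, hNM using Nat.le_induction with
  | base => rfl
  | succ M hM ih => exact (jackNorm_succ hα ⟨κ, hN.trans hM⟩).trans ih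

open Classical in
/-- The constants `v_κ^{(α)}`. -/
def vConst (α : ℝ) (κ : Part) : ℝ :=
  if h : 0 < α then jackNorm h (N := Multiset.card κ.2.parts) ⟨κ, le_rfl⟩ else 1

theorem vConst_eq (κ : PartLE N) : vConst α κ.1 = jackNorm hα κ := by
  rw [vConst, dif_pos hα]
  exact (jackNorm_eq hα le_rfl κ.2).symm

include hα in
theorem vConst_ne_zero (κ : Part) : vConst α κ ≠ 0 := by
  rw [vConst, dif_pos hα]
  exact (jackNorm_pos hα _).ne'

end

end SymJack

end

theorem proposition3p2 :
    -- for `α > 0` the symmetric Jack polynomials are well defined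
    (∀ (α : ℝ), 0 < α → ∀ (N : ℕ) (κ : PartLE N), ∃! P : SymPoly N, IsSymmetricJack N α κ.1.2 P) ∧
    -- constants `v_κ^{(α)}` that do not depend on `N`
    ∃ v : ℝ → Part → ℝ,
      (∀ (α : ℝ), 0 < α → ∀ κ : Part, v α κ ≠ 0) ∧
      -- the expansion of the kernel with parameter `α / (α + 1)`
      (∀ (α : ℝ), 0 < α → ∀ N : ℕ,
        HasFormalSum
          (fun κ : PartLE N => (1 / v (α / (α + 1)) κ.1) •
            (inX (jackP N (α / (α + 1)) κ.1.2) * inY (jackP N (α / (α + 1)) κ.1.2)))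
          (kernel N (α / (α + 1)))) ∧
      -- the `g_κ` and the form `⟨·,·⟩_g` are well defined, and the orthogonality holds
      (∀ (α : ℝ), 0 < α → ∀ N : ℕ,
        (∃! g : PartLE N → SymPoly N, IsGFamily N α g) ∧
        ∀ g : PartLE N → SymPoly N, IsGFamily N α g →
          (∃! B : SymPoly N →ₗ[ℝ] SymPoly N →ₗ[ℝ] ℝ, IsGForm g B) ∧
          ∀ B : SymPoly N →ₗ[ℝ] SymPoly N →ₗ[ℝ] ℝ, IsGForm g B →
            ∀ κ μ : PartLE N,
              B (jackP N α κ.1.2) (jackP N α μ.1.2) = if μ = κ then v α κ.1 else 0) := by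
  refine ⟨fun α hα N κ => existsUnique_jack hα κ, vConst, fun α hα κ => vConst_ne_zero hα κ,
    fun α hα N => ?_, fun α hα N => ⟨⟨gPoly hα N, isGFamily_gPoly hα,
      fun g hg => eq_gPoly_of_isGFamily hα hg⟩, fun g hg => ?_⟩⟩
  · have hα' : 0 < α / (α + 1) := by positivity
    simp only [vConst_eq hα']
    exact hasFormalSum_jackP hα'
  · obtain rfl := eq_gPoly_of_isGFamily hα hg
    refine ⟨⟨gForm hα N, isGForm_gForm hα, fun B hB => eq_gForm_of_isGForm hα hB⟩,
      fun B hB κ μ => ?_⟩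
    rw [eq_gForm_of_isGForm hα hB, gForm_jackP, vConst_eq hα]
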